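/- All systems $A,B,\dots$ are finite-dimensional (and nonzero), $\log=\log_2$, $-\log 0=+\infty$, and reference systems $R,R',\dots$ are finite-dimensional of arbitrary dimension. A superchannel is given by two quantum channels $\Theta=(\mathcal E_{C\to AS},\mathcal D_{BS\to D})$ with memory $S$; for a channel $\mathcal N_{AR\to BR'}$ put $\Theta(\mathcal N)=\mathcal D\circ\mathcal N\circ\mathcal E$, a channel $CR\to DR'$. $\Theta^{\otimes n}$ is the superchannel with components $\mathcal E^{\otimes n},\mathcal D^{\otimes n}$. Divergences. For states let $\tilde D_{1/2}(\rho\|\sigma)=-2\log\operatorname{tr}\big[(\sigma^{1/2}\rho\,\sigma^{1/2})^{1/2}\big]=-\log\|\sqrt\rho\sqrt\sigma\|_1^2$ (and $+\infty$ for orthogonal states). Write $D=\tilde D_{1/2}$. For channels, $D(\mathcal N\|\mathcal M)=\sup_{\rho}D((\mathcal N\otimes\mathrm{id}_R)(\rho)\|(\mathcal M\otimes\mathrm{id}_R)(\rho))$ and $D^A(\mathcal N\|\mathcal M)=\sup_{\rho,\tau}\big[D((\mathcal N\otimes\mathrm{id}_R)(\rho)\|(\mathcal M\otimes\mathrm{id}_R)(\tau))-D(\rho\|\tau)\big]$.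 For superchannels $\Theta_i=(\mathcal E_i,\mathcal D_i)$, $i=1,2$, with the same $A,B,C,D$ and possibly different memories, \begin{align*} \tilde D_{1/2}(\Theta_1\|\Theta_2)&=\sup_{\rho_{CR},\,\mathcal N}D(\Theta_1(\mathcal N)(\rho)\|\Theta_2(\mathcal N)(\rho)),\\ \tilde D_{1/2}^{\infty}(\Theta_1\|\Theta_2)&=\lim_{n}\tfrac1n\tilde D_{1/2}(\Theta_1^{\otimes n}\|\Theta_2^{\otimes n}),\\ \tilde D_{1/2}^{s\infty}(\Theta_1\|\Theta_2)&=\lim_n\tfrac1n\sup_{\mathcal N_{AR\to BR'}}D(\Theta_1(\mathcal N)^{\otimes n}\|\Theta_2(\mathcal N)^{\otimes n}),\\ \tilde D_{1/2}^{c\infty}(\Theta_1\|\Theta_2)&=\lim_n\tfrac1n\sup_{\rho_{CR},\,\mathcal N_{A^nR^n\to B^nR'}}D(\Theta_1^{\otimes n}(\mathcal N)(\rho^{\otimes n})\|\Theta_2^{\otimes n}(\mathcal N)(\rho^{\otimes n})),\\ \tilde D_{1/2}^{sA}(\Theta_1\|\Theta_2)&=\sup_{\mathcal N}D^A(\Theta_1(\mathcal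 N)\|\Theta_2(\mathcal N)),\\ \tilde D_{1/2}^{A}(\Theta_1\|\Theta_2)&=\sup_{\mathcal N,\mathcal M}\big[D^A(\Theta_1(\mathcal N)\|\Theta_2(\mathcal M))-D^A(\mathcal N\|\mathcal M)\big],\\ \tilde D_{1/2}^{A^*}(\Theta_1\|\Theta_2)&=\sup_{\mathcal N,\mathcal M,\bar{\mathcal N},\bar{\mathcal M}}\big[D^A(\Theta_1(\mathcal N)\circ\bar{\mathcal N}\|\Theta_2(\mathcal M)\circ\bar{\mathcal M})-D^A(\mathcal N\circ\mathcal E_1\circ\bar{\mathcal N}\|\mathcal M\circ\mathcal E_1\circ\bar{\mathcal M})\big], \end{align*} where $\mathcal N,\mathcal M$ range over channels $AR\to BR'$ and $\bar{\mathcal N},\bar{\mathcal M}$ over channels $X\to CR$, for all $R,R',X$ (suprema of differences are over the choices with finite subtrahend). Strategies. A strategy with $n\ge1$ uses, including a final binary measurement $\{Q_1,Q_2=1-Q_1\}$, yields an output state $\rho_i$ if the superchannel is $\Theta_i$; put $\alpha_n=\operatorname{tr}(Q_2\rho_1)$, $\beta_n=\operatorname{tr}(Q_1\rho_2)$ and,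 for $p\in(0,1)$, $\xi^n(p,\Theta_1,\Theta_2)=\sup-\frac1n\log\big(p\,\alpha_n+(1-p)\beta_n\big)$ over the strategies in the class. The classes and their outputs are: * ($p$, product) $\big(\Theta_i(\mathcal N)(\rho_{CR})\big)^{\otimes n}$; * ($sp$, parallel with product channels) $(\Theta_i(\mathcal N)^{\otimes n}\otimes\mathrm{id}_E)(\rho)$ with an arbitrary joint input state $\rho$ and reference $E$; * ($cp$, parallel with product states) $\Theta_i^{\otimes n}(\mathcal N)(\rho_{CR}^{\otimes n})$ with an arbitrary channel $\mathcal N_{A^nR^n\to B^nR'}$; * ($fp$, parallel) $\Theta_i^{\otimes n}(\mathcal N)(\rho)$ with an arbitrary state $\rho_{C^nR}$ and channel $\mathcal N_{A^nR\to B^nR'}$; * ($sa$, successive adaptive) a channel $\mathcal N$ is fixed and $\Theta_i(\mathcal N)$ is used $n$ times in succession on an initial state, with a memory and with arbitrary channels applied between the uses; * ($na$, nested adaptive) $\mathcal N_n(\rho_{CR})$, where $\mathcal N_1=\Theta_i(\mathcal A_n)$ and $\mathcal N_{j+1}=\Theta_i(\mathcal A_{n-j}\circ\mathcal N_j\circ\mathcal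 A_{n+j})$ for arbitrary channels $\mathcal A_1,\dots,\mathcal A_{2n-1}$; * ($fg$, fully general adaptive) the $n$ copies of $\mathcal E_i$ and the $n$ copies of $\mathcal D_i$ are used in any fixed order in which each copy of $\mathcal E_i$ precedes the $\mathcal D_i$ of the same superchannel, on an initial state, with arbitrary channels, which do not act on the memories $S$, in between. Theorem. The limits that define $\tilde D_{1/2}^{s\infty},\tilde D_{1/2}^{c\infty},\tilde D_{1/2}^{\infty}$ exist as extended real numbers, and for all superchannels $\Theta_1,\Theta_2$, all $p\in(0,1)$ and all $n\ge1$, \begin{align*} \xi_{p}^n(p,\Theta_1,\Theta_2) &\leq -\tfrac1n \log[p(1-p)] + \tilde D_{1/2}(\Theta_1 \| \Theta_2 ), \\ \xi_{sp}^n(p,\Theta_1,\Theta_2) &\leq -\tfrac1n \log[p(1-p)] + \tilde D^{s\infty}_{1/2}(\Theta_1 \| \Theta_2 ), \\ \xi_{cp}^n(p,\Theta_1,\Theta_2) &\leq -\tfrac1n \log[p(1-p)] + \tilde D^{c\infty}_{1/2}(\Theta_1 \| \Theta_2 ), \\ \xi_{fp}^n(p,\Theta_1,\Theta_2) &\leq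 -\tfrac1n \log[p(1-p)] + \tilde D^{\infty}_{1/2}(\Theta_1 \| \Theta_2 ), \\ \xi_{sa}^n(p,\Theta_1,\Theta_2) &\leq -\tfrac1n \log[p(1-p)] + \tilde D^{sA}_{1/2}(\Theta_1 \| \Theta_2 ), \\ \xi_{na}^n(p,\Theta_1,\Theta_2) &\leq -\tfrac1n \log[p(1-p)] + \tilde D^{A}_{1/2}(\Theta_1 \| \Theta_2 ), \\ \xi_{fg}^n(p,\Theta_1,\Theta_2) &\leq -\tfrac1n \log[p(1-p)] + \tilde D^{A^*}_{1/2}(\Theta_1 \| \Theta_2 ). \end{align*} -/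

import Mathlib

namespace QND

/-! Finite-dimensional quantum systems are finite types `X : Type`, the associated Hilbert space is
`ℂ^X`, and the composite of `X` and `Y` is `X × Y`. Logarithms are to base two. -/

section Basics

open scoped ComplexOrder

variable {X Y : Type} [Fintype X] [DecidableEq X] [Fintype Y] [DecidableEq Y]

/-- Linear operators on the system `X`. -/
abbrev Op (X : Type) : Type := Matrix X X ℂ

/-- Linear maps from operators on `X` to operators on `Y`. -/
abbrev SuperOp (X Y : Type) : Type := Op X →ₗ[ℂ] Op Y

/-- Quantum states (density operators) of the system `X`. -/
def IsState (ρ : Op X) : Prop := ρ.PosSemidef ∧ ρ.trace = 1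

/-- The map `Φ ⊗ id_R`. -/
def tensorId (Φ : SuperOp X Y) (R : Type) : SuperOp (X × R) (Y × R) where
  toFun M := Matrix.of fun y y' => Φ (Matrix.of fun x x' => M (x, y.2) (x', y'.2)) y.1 y'.1
  map_add' M N := by
    ext y y'
    exact congrFun₂ (map_add Φ (Matrix.of fun x x' => M (x, y.2) (x', y'.2))
      (Matrix.of fun x x' => N (x, y.2) (x', y'.2))) y.1 y'.1
  map_smul' c M := by
    ext y y'
    exact congrFun₂ (map_smul Φ c (Matrix.of fun x x' => M (x, y.2) (x', y'.2))) y.1 y'.1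

/-- Quantum channels: completely positive and trace-preserving linear maps. -/
def IsChannel (Φ : SuperOp X Y) : Prop :=
  (∀ (k : ℕ) (M : Op (X × Fin k)), M.PosSemidef → (tensorId Φ (Fin k) M).PosSemidef) ∧
    ∀ M : Op X, (Φ M).trace = M.trace

/-- Relabelling of the basis of a system, as a map on operators. -/
def relabel (e : X ≃ Y) : SuperOp X Y := (Matrix.reindexLinearEquiv ℂ ℂ e e).toLinearMap

/-- The map `Φ ⊗ ⋯ ⊗ Φ` (`n` factors); the `n`-fold power of the system `X` is `Fin n → X`. -/
def tensorPow (Φ : SuperOp X Y) (n : ℕ) : SuperOp (Fin n → X) (Fin n → Y) where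
  toFun M := Matrix.of fun y y' => ∑ x : Fin n → X, ∑ x' : Fin n → X,
    M x x' * ∏ i, Φ (Matrix.single (x i) (x' i) 1) (y i) (y' i)
  map_add' M N := by
    ext y y'
    simp only [Matrix.of_apply, Matrix.add_apply, add_mul, Finset.sum_add_distrib]
  map_smul' c M := by
    ext y y'
    simp only [Matrix.of_apply, Matrix.smul_apply, smul_eq_mul, RingHom.id_apply, Finset.mul_sum,
      mul_assoc]

/-- The operator `ρ ⊗ ⋯ ⊗ ρ` (`n` factors). -/
def opPow (ρ : Op X) (n : ℕ) : Op (Fin n → X) := Matrix.of fun x x' => ∏ i, ρ (x i) (x' i)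

/-- `-log₂ t` for `t ≥ 0`, with the value `+∞` at `t = 0`. -/
noncomputable def negLog (t : ℝ) : EReal :=
  if t ≤ 0 then ⊤ else ((-Real.logb 2 t : ℝ) : EReal)

/-- The square root of a positive semidefinite operator. -/
noncomputable def opSqrt (M : Op X) : Op X := cfc Real.sqrt M

/-- The sandwiched Rényi divergence `(1/(α-1)) log tr[(σ^((1-α)/(2α)) ρ σ^((1-α)/(2α)))^α]` at
`α = 1/2`, which is `-2 log tr[(σ^(1/2) ρ σ^(1/2))^(1/2)]`; it is `+∞` for orthogonal states. -/
noncomputable def stateDiv (ρ σ : Op X) : EReal :=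
  if (ρ * σ).trace = 0 then ⊤
  else ((-2 * Real.logb 2 (opSqrt (opSqrt σ * ρ * opSqrt σ)).trace.re : ℝ) : EReal)

/-- The channel divergence `D(Φ‖Ψ) = sup_ρ D((Φ ⊗ id_R)(ρ) ‖ (Ψ ⊗ id_R)(ρ))`. -/
noncomputable def chanDiv (Φ Ψ : SuperOp X Y) : EReal :=
  ⨆ (R : Type) (_ : Fintype R) (_ : DecidableEq R) (ρ : Op (X × R)) (_ : IsState ρ),
    stateDiv (tensorId Φ R ρ) (tensorId Ψ R ρ)

/-- The amortized channel divergence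
`D^A(Φ‖Ψ) = sup_{ρ,τ} D((Φ ⊗ id_R)(ρ) ‖ (Ψ ⊗ id_R)(τ)) - D(ρ‖τ)`. The difference is meaningful
only for finite `D(ρ‖τ)`; the supremum is over these pairs. -/
noncomputable def chanDivA (Φ Ψ : SuperOp X Y) : EReal :=
  ⨆ (R : Type) (_ : Fintype R) (_ : DecidableEq R) (ρ : Op (X × R)) (τ : Op (X × R))
    (_ : IsState ρ) (_ : IsState τ) (_ : stateDiv ρ τ ≠ ⊤),
    stateDiv (tensorId Φ R ρ) (tensorId Ψ R τ) - stateDiv ρ τ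

/-- The best symmetric error exponent that a final binary measurement `{Q, 1 - Q}` achieves for
`n` uses that end in `ρ₁` (first hypothesis, prior `p`) or in `ρ₂` (second hypothesis): the
supremum over `Q` of `-(1/n) log (p α + (1-p) β)`, with `α = tr((1-Q) ρ₁)` and `β = tr(Q ρ₂)`. -/
noncomputable def bestExponent (n : ℕ) (p : ℝ) (ρ₁ ρ₂ : Op X) : EReal :=
  ⨆ (Q : Op X) (_ : Q.PosSemidef) (_ : (1 - Q).PosSemidef),
    ((1 / (n : ℝ) : ℝ) : EReal) *
      negLog (p * ((1 - Q) * ρ₁).trace.re + (1 - p) * (Q * ρ₂).trace.re)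

/-- Interchange of the last two of three systems. -/
def swapLast (X Y Z : Type) : (X × Y) × Z ≃ (X × Z) × Y where
  toFun x := ((x.1.1, x.2), x.1.2)
  invFun x := ((x.1.1, x.2), x.1.2)
  left_inv _ := rfl
  right_inv _ := rfl

/-- Outcome of a successive use of the map `Φ : X → Y` on the initial state `ρ` with memory `M`
and intermediate maps `𝒜 0, 𝒜 1, …`: the value at `k` is the operator after `k + 1` uses
of `Φ`. -/
def seqOutput {M : Type} (Φ : SuperOp X Y) (ρ : Op (X × M)) (𝒜 : ℕ → SuperOp (Y × M) (X × M)) :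
    ℕ → Op (Y × M)
  | 0 => tensorId Φ M ρ
  | k + 1 => tensorId Φ M (𝒜 k (seqOutput Φ ρ 𝒜 k))

end Basics

/-- The data of a superchannel given by `enc : C → A S` and `dec : B S → D`, with
memory `S`. -/
structure Superchannel (C A B D S : Type) where
  enc : SuperOp C (A × S)
  dec : SuperOp (B × S) D

namespace Superchannel

section

variable {C A B D S : Type} [Fintype C] [DecidableEq C] [Fintype A] [DecidableEq A]
  [Fintype B] [DecidableEq B] [Fintype D] [DecidableEq D] [Fintype S] [DecidableEq S]

/-- Both components of a superchannel are quantum channels. -/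
def IsValid (Θ : Superchannel C A B D S) : Prop := IsChannel Θ.enc ∧ IsChannel Θ.dec

/-- The map `N ∘ enc : C R → B R' S`, for `N : A R → B R'`. -/
def applyEnc (Θ : Superchannel C A B D S) {R R' : Type}
    (N : SuperOp (A × R) (B × R')) : SuperOp (C × R) ((B × R') × S) :=
  tensorId N S ∘ₗ relabel (swapLast A S R) ∘ₗ tensorId Θ.enc R

/-- The map `(Θ ⊗ id)(N) = dec ∘ N ∘ enc : C R → D R'`, for `N : A R → B R'`. -/
def apply (Θ : Superchannel C A B D S) {R R' : Type}
    (N : SuperOp (A × R) (B × R')) : SuperOp (C × R) (D × R') :=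
  tensorId Θ.dec R' ∘ₗ relabel (swapLast B R' S) ∘ₗ Θ.applyEnc N

/-- The superchannel `Θ ⊗ ⋯ ⊗ Θ` (`n` factors), from channels `A^n → B^n` to
channels `C^n → D^n`. -/
def pow (Θ : Superchannel C A B D S) (n : ℕ) :
    Superchannel (Fin n → C) (Fin n → A) (Fin n → B) (Fin n → D) (Fin n → S) where
  enc := relabel (Equiv.arrowProdEquivProdArrow (Fin n) (fun _ => A) (fun _ => S)) ∘ₗ
    tensorPow Θ.enc n
  dec := tensorPow Θ.dec n ∘ₗ
    relabel (Equiv.arrowProdEquivProdArrow (Fin n) (fun _ => B) (fun _ => S)).symm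

/-- The channel obtained from `n` nested uses of the superchannel: the value at `0` is `Θ(mid)`,
and the value at `k + 1` is `Θ(post k ∘ N ∘ pre k)` for the value `N` at `k`. -/
def nested (Θ : Superchannel C A B D S) {R : Type} (mid : SuperOp (A × R) (B × R))
    (pre : ℕ → SuperOp (A × R) (C × R)) (post : ℕ → SuperOp (D × R) (B × R)) :
    ℕ → SuperOp (C × R) (D × R)
  | 0 => Θ.apply mid
  | k + 1 => Θ.apply (post k ∘ₗ nested Θ mid pre post k ∘ₗ pre k)

end

end Superchannel

/-! The divergences of two superchannels. The reference systems `R`, `R'` are arbitrary. -/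

section Divergences

variable {C A B D S₁ S₂ : Type} [Fintype C] [DecidableEq C] [Fintype A] [DecidableEq A]
  [Fintype B] [DecidableEq B] [Fintype D] [DecidableEq D] [Fintype S₁] [DecidableEq S₁]
  [Fintype S₂] [DecidableEq S₂]

/-- `D(Θ₁‖Θ₂) = sup_{ρ,N} D(Θ₁(N)(ρ) ‖ Θ₂(N)(ρ))`. -/
noncomputable def superDiv (Θ₁ : Superchannel C A B D S₁) (Θ₂ : Superchannel C A B D S₂) : EReal :=
  ⨆ (R : Type) (_ : Fintype R) (_ : DecidableEq R) (R' : Type) (_ : Fintype R')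
    (_ : DecidableEq R') (N : SuperOp (A × R) (B × R')) (_ : IsChannel N) (ρ : Op (C × R))
    (_ : IsState ρ), stateDiv (Θ₁.apply N ρ) (Θ₂.apply N ρ)

/-- `(1/n) D(Θ₁^{⊗n}‖Θ₂^{⊗n})`. -/
noncomputable def superDivSeq (Θ₁ : Superchannel C A B D S₁) (Θ₂ : Superchannel C A B D S₂)
    (n : ℕ) : EReal :=
  ((1 / (n : ℝ) : ℝ) : EReal) * superDiv (Θ₁.pow n) (Θ₂.pow n)

/-- `(1/n) sup_N D(Θ₁(N)^{⊗n}‖Θ₂(N)^{⊗n})`. -/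
noncomputable def superDivStateSeq (Θ₁ : Superchannel C A B D S₁)
    (Θ₂ : Superchannel C A B D S₂) (n : ℕ) : EReal :=
  ((1 / (n : ℝ) : ℝ) : EReal) *
    ⨆ (R : Type) (_ : Fintype R) (_ : DecidableEq R) (R' : Type) (_ : Fintype R')
      (_ : DecidableEq R') (N : SuperOp (A × R) (B × R')) (_ : IsChannel N),
      chanDiv (tensorPow (Θ₁.apply N) n) (tensorPow (Θ₂.apply N) n)

/-- The output of `n` parallel uses of `Θ`, on the product input `ρ^{⊗n}` and with the joint
channel `N : A^n R^n → B^n R'`. -/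
def productStateOutput {S : Type} [Fintype S] [DecidableEq S] (Θ : Superchannel C A B D S) (n : ℕ)
    {R R' : Type}
    (N : SuperOp ((Fin n → A) × (Fin n → R)) ((Fin n → B) × R')) (ρ : Op (C × R)) :
    Op ((Fin n → D) × R') :=
  (Θ.pow n).apply N
    (relabel (Equiv.arrowProdEquivProdArrow (Fin n) (fun _ => C) (fun _ => R)) (opPow ρ n))

/-- `(1/n) sup_{ρ,N} D(Θ₁^{⊗n}(N)(ρ^{⊗n}) ‖ Θ₂^{⊗n}(N)(ρ^{⊗n}))`. -/
noncomputable def superDivChanSeq (Θ₁ : Superchannel C A B D S₁)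
    (Θ₂ : Superchannel C A B D S₂) (n : ℕ) : EReal :=
  ((1 / (n : ℝ) : ℝ) : EReal) *
    ⨆ (R : Type) (_ : Fintype R) (_ : DecidableEq R) (R' : Type) (_ : Fintype R')
      (_ : DecidableEq R') (N : SuperOp ((Fin n → A) × (Fin n → R)) ((Fin n → B) × R'))
      (_ : IsChannel N) (ρ : Op (C × R)) (_ : IsState ρ),
      stateDiv (productStateOutput Θ₁ n N ρ) (productStateOutput Θ₂ n N ρ)

/-- The regularized divergence: the limit of `superDivSeq`, written as the lower limit (the two
agree whenever the limit exists). -/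
noncomputable def superDivReg (Θ₁ : Superchannel C A B D S₁) (Θ₂ : Superchannel C A B D S₂) :
    EReal := Filter.liminf (superDivSeq Θ₁ Θ₂) Filter.atTop

/-- The state-regularized divergence: the limit of `superDivStateSeq`. -/
noncomputable def superDivStateReg (Θ₁ : Superchannel C A B D S₁)
    (Θ₂ : Superchannel C A B D S₂) : EReal :=
  Filter.liminf (superDivStateSeq Θ₁ Θ₂) Filter.atTop

/-- The channel-regularized divergence: the limit of `superDivChanSeq`. -/
noncomputable def superDivChanReg (Θ₁ : Superchannel C A B D S₁)
    (Θ₂ : Superchannel C A B D S₂) : EReal :=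
  Filter.liminf (superDivChanSeq Θ₁ Θ₂) Filter.atTop

/-- The state-amortized divergence `D^{sA}(Θ₁‖Θ₂) = sup_N D^A(Θ₁(N)‖Θ₂(N))`. -/
noncomputable def superDivStateA (Θ₁ : Superchannel C A B D S₁)
    (Θ₂ : Superchannel C A B D S₂) : EReal :=
  ⨆ (R : Type) (_ : Fintype R) (_ : DecidableEq R) (R' : Type) (_ : Fintype R')
    (_ : DecidableEq R') (N : SuperOp (A × R) (B × R')) (_ : IsChannel N),
    chanDivA (Θ₁.apply N) (Θ₂.apply N)

/-- The amortized divergence `D^A(Θ₁‖Θ₂) = sup_{N,M} D^A(Θ₁(N)‖Θ₂(M)) - D^A(N‖M)`, over the pairs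
with `D^A(N‖M) < ∞`. -/
noncomputable def superDivA (Θ₁ : Superchannel C A B D S₁) (Θ₂ : Superchannel C A B D S₂) :
    EReal :=
  ⨆ (R : Type) (_ : Fintype R) (_ : DecidableEq R) (R' : Type) (_ : Fintype R')
    (_ : DecidableEq R') (N : SuperOp (A × R) (B × R')) (M : SuperOp (A × R) (B × R'))
    (_ : IsChannel N) (_ : IsChannel M) (_ : chanDivA N M ≠ ⊤),
    chanDivA (Θ₁.apply N) (Θ₂.apply M) - chanDivA N M

/-- The fully amortized divergence `D^{A*}(Θ₁‖Θ₂)`: the supremum over channels `N`, `M`, `N'`, `M'`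
of `D^A(Θ₁(N) ∘ N' ‖ Θ₂(M) ∘ M') - D^A(N ∘ enc₁ ∘ N' ‖ M ∘ enc₁ ∘ M')`, over the choices for
which the second term is finite. The first component `enc₁` of `Θ₁` appears twice. -/
noncomputable def superDivAStar (Θ₁ : Superchannel C A B D S₁) (Θ₂ : Superchannel C A B D S₂) :
    EReal :=
  ⨆ (R : Type) (_ : Fintype R) (_ : DecidableEq R) (R' : Type) (_ : Fintype R')
    (_ : DecidableEq R') (X : Type) (_ : Fintype X) (_ : DecidableEq X)
    (N : SuperOp (A × R) (B × R')) (M : SuperOp (A × R) (B × R'))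
    (N' : SuperOp X (C × R)) (M' : SuperOp X (C × R))
    (_ : IsChannel N) (_ : IsChannel M) (_ : IsChannel N') (_ : IsChannel M')
    (_ : chanDivA (Θ₁.applyEnc N ∘ₗ N') (Θ₁.applyEnc M ∘ₗ M') ≠ ⊤),
    chanDivA (Θ₁.apply N ∘ₗ N') (Θ₂.apply M ∘ₗ M')
      - chanDivA (Θ₁.applyEnc N ∘ₗ N') (Θ₁.applyEnc M ∘ₗ M')

end Divergences

/-! Fully general adaptive strategies. -/

/-- `Protocol C A B D m k X`: an adaptive protocol (before the final measurement) that has started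
`m` superchannels, `k` of which are still open (their first component has been used, their second
one has not), and in which the experimenter holds the system `X`. The open copies keep their
memories, which the experimenter cannot touch. -/
inductive Protocol (C A B D : Type) : ℕ → ℕ → Type → Type 1
  /-- Prepare the state `ρ`. -/
  | prepare {X : Type} [Fintype X] [DecidableEq X] (ρ : Op X) (hρ : IsState ρ) :
      Protocol C A B D 0 0 X
  /-- Apply the channel `𝒜 : X → C R` and use the first component of a new superchannel. -/
  | useEnc {m k : ℕ} {X R : Type} [Fintype X] [DecidableEq X] [Fintype R] [DecidableEq R]
      [Fintype C] [DecidableEq C] (P : Protocol C A B D m k X)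
      (𝒜 : SuperOp X (C × R)) (h𝒜 : IsChannel 𝒜) : Protocol C A B D (m + 1) (k + 1) (A × R)
  /-- Apply the channel `𝒜 : X → B R` and use the second component of the `j`-th open
  superchannel, which is then complete. -/
  | useDec {m k : ℕ} {X R : Type} [Fintype X] [DecidableEq X] [Fintype R] [DecidableEq R]
      [Fintype B] [DecidableEq B] (P : Protocol C A B D m (k + 1) X)
      (𝒜 : SuperOp X (B × R)) (h𝒜 : IsChannel 𝒜) (j : Fin (k + 1)) :
      Protocol C A B D m k (D × R)

namespace Protocol

section

variable {C A B D S : Type}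

/-- Regrouping after the first component of a new superchannel has been used: its memory joins
those of the `k` superchannels that were already open. -/
def openEquiv (A R S : Type) (k : ℕ) :
    (A × S) × (R × (Fin k → S)) ≃ (A × R) × (Fin (k + 1) → S) :=
  (Equiv.prodProdProdComm A S R (Fin k → S)).trans
    ((Equiv.refl (A × R)).prodCongr (Fin.insertNthEquiv (fun _ => S) 0))

/-- Regrouping before the second component of the `j`-th open superchannel is used: its memory is
taken out of the list of memories. -/
def closeEquiv (B R S : Type) (k : ℕ) (j : Fin (k + 1)) :
    (B × R) × (Fin (k + 1) → S) ≃ (B × S) × (R × (Fin k → S)) :=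
  ((Equiv.refl (B × R)).prodCongr (Fin.insertNthEquiv (fun _ => S) j).symm).trans
    (Equiv.prodProdProdComm B R S (Fin k → S))

/-- The joint state of the experimenter's system `X` and the memories of the `k` open
superchannels, when the protocol is carried out with `Θ`. -/
def run (Θ : Superchannel C A B D S) {m k : ℕ} {X : Type} :
    Protocol C A B D m k X → Op (X × (Fin k → S))
  | prepare ρ _ => relabel (Equiv.prodUnique _ (Fin 0 → S)).symm ρ
  | @useEnc _ _ _ _ _ k _ R _ _ _ _ _ _ P 𝒜 _ =>
      relabel (openEquiv A R S k)
        (tensorId Θ.enc (R × (Fin k → S))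
          (relabel (Equiv.prodAssoc C R (Fin k → S))
            (tensorId 𝒜 (Fin k → S) (run Θ P))))
  | @useDec _ _ _ _ _ k _ R _ _ _ _ _ _ P 𝒜 _ j =>
      relabel (Equiv.prodAssoc D R (Fin k → S)).symm
        (tensorId Θ.dec (R × (Fin k → S))
          (relabel (closeEquiv B R S k j)
            (tensorId 𝒜 (Fin (k + 1) → S) (run Θ P))))

/-- The final state of a protocol in which every superchannel has been completed. -/
def output (Θ : Superchannel C A B D S) {m : ℕ} {X : Type} (P : Protocol C A B D m 0 X) : Op X :=
  relabel (Equiv.prodUnique X (Fin 0 → S)) (run Θ P)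

end

end Protocol

/-! The non-asymptotic symmetric error exponents `ξ^n(p, Θ₁, Θ₂)`: the supremum of
`-(1/n) log (p α_n + (1-p) β_n)` over the strategies of each class, with `n ≥ 1` uses. -/

section Exponents

variable {C A B D S₁ S₂ : Type} [Fintype C] [DecidableEq C] [Fintype A] [DecidableEq A]
  [Fintype B] [DecidableEq B] [Fintype D] [DecidableEq D] [Fintype S₁] [DecidableEq S₁]
  [Fintype S₂] [DecidableEq S₂]

/-- Product strategies: `n` copies of a state `ρ` and of a channel `N`. -/
noncomputable def xiProduct (n : ℕ) (p : ℝ) (Θ₁ : Superchannel C A B D S₁)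
    (Θ₂ : Superchannel C A B D S₂) : EReal :=
  ⨆ (R : Type) (_ : Fintype R) (_ : DecidableEq R) (R' : Type) (_ : Fintype R')
    (_ : DecidableEq R') (N : SuperOp (A × R) (B × R')) (_ : IsChannel N) (ρ : Op (C × R))
    (_ : IsState ρ), bestExponent n p (opPow (Θ₁.apply N ρ) n) (opPow (Θ₂.apply N ρ) n)

/-- Parallel strategies with product channels: `n` copies of a channel `N`, joint input state. -/
noncomputable def xiParallelProductChannel (n : ℕ) (p : ℝ) (Θ₁ : Superchannel C A B D S₁)
    (Θ₂ : Superchannel C A B D S₂) : EReal :=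
  ⨆ (R : Type) (_ : Fintype R) (_ : DecidableEq R) (R' : Type) (_ : Fintype R')
    (_ : DecidableEq R') (E : Type) (_ : Fintype E) (_ : DecidableEq E)
    (N : SuperOp (A × R) (B × R')) (_ : IsChannel N) (ρ : Op ((Fin n → C × R) × E))
    (_ : IsState ρ), bestExponent n p (tensorId (tensorPow (Θ₁.apply N) n) E ρ)
      (tensorId (tensorPow (Θ₂.apply N) n) E ρ)

/-- Parallel strategies with product states: `n` copies of a state `ρ`, joint channel. -/
noncomputable def xiParallelProductState (n : ℕ) (p : ℝ) (Θ₁ : Superchannel C A B D S₁)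
    (Θ₂ : Superchannel C A B D S₂) : EReal :=
  ⨆ (R : Type) (_ : Fintype R) (_ : DecidableEq R) (R' : Type) (_ : Fintype R')
    (_ : DecidableEq R') (N : SuperOp ((Fin n → A) × (Fin n → R)) ((Fin n → B) × R'))
    (_ : IsChannel N) (ρ : Op (C × R)) (_ : IsState ρ),
    bestExponent n p (productStateOutput Θ₁ n N ρ) (productStateOutput Θ₂ n N ρ)

/-- General parallel strategies: joint channel and joint input state. -/
noncomputable def xiParallel (n : ℕ) (p : ℝ) (Θ₁ : Superchannel C A B D S₁)
    (Θ₂ : Superchannel C A B D S₂) : EReal :=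
  ⨆ (R : Type) (_ : Fintype R) (_ : DecidableEq R) (R' : Type) (_ : Fintype R')
    (_ : DecidableEq R') (N : SuperOp ((Fin n → A) × R) ((Fin n → B) × R')) (_ : IsChannel N)
    (ρ : Op ((Fin n → C) × R)) (_ : IsState ρ),
    bestExponent n p ((Θ₁.pow n).apply N ρ) ((Θ₂.pow n).apply N ρ)

/-- Successive adaptive strategies: a channel `N` is fixed, and the channel `Θ(N)` is used `n`
times, with adaptive channels `𝒜 0, …, 𝒜 (n - 2)` in between. -/
noncomputable def xiSuccessive (n : ℕ) (p : ℝ) (Θ₁ : Superchannel C A B D S₁)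
    (Θ₂ : Superchannel C A B D S₂) : EReal :=
  ⨆ (R : Type) (_ : Fintype R) (_ : DecidableEq R) (R' : Type) (_ : Fintype R')
    (_ : DecidableEq R') (M : Type) (_ : Fintype M) (_ : DecidableEq M)
    (N : SuperOp (A × R) (B × R')) (_ : IsChannel N) (ρ : Op ((C × R) × M)) (_ : IsState ρ)
    (𝒜 : ℕ → SuperOp ((D × R') × M) ((C × R) × M)) (_ : ∀ k, IsChannel (𝒜 k)),
    bestExponent n p (seqOutput (Θ₁.apply N) ρ 𝒜 (n - 1)) (seqOutput (Θ₂.apply N) ρ 𝒜 (n - 1))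

/-- Nested adaptive strategies: an input state `ρ` and `2n - 1` adaptive channels `mid`,
`pre 0, …, pre (n - 2)`, `post 0, …, post (n - 2)`. -/
noncomputable def xiNested (n : ℕ) (p : ℝ) (Θ₁ : Superchannel C A B D S₁)
    (Θ₂ : Superchannel C A B D S₂) : EReal :=
  ⨆ (R : Type) (_ : Fintype R) (_ : DecidableEq R) (ρ : Op (C × R)) (_ : IsState ρ)
    (mid : SuperOp (A × R) (B × R)) (_ : IsChannel mid)
    (pre : ℕ → SuperOp (A × R) (C × R)) (_ : ∀ k, IsChannel (pre k))
    (post : ℕ → SuperOp (D × R) (B × R)) (_ : ∀ k, IsChannel (post k)),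
    bestExponent n p (Θ₁.nested mid pre post (n - 1) ρ) (Θ₂.nested mid pre post (n - 1) ρ)

/-- Fully general adaptive strategies. -/
noncomputable def xiGeneral (n : ℕ) (p : ℝ) (Θ₁ : Superchannel C A B D S₁)
    (Θ₂ : Superchannel C A B D S₂) : EReal :=
  ⨆ (X : Type) (_ : Fintype X) (_ : DecidableEq X) (P : Protocol C A B D n 0 X),
    bestExponent n p (P.output Θ₁) (P.output Θ₂)

end Exponents

end QND

open QND

/-! The divergence is -log F² for the fidelity F(ρ, σ) = tr (√σ ρ √σ)^(1/2), and F is the maximum of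
Re tr Z over the operators Z for which the block matrix [[ρ, Z], [Z†, σ]] is positive semidefinite
(`exists_isCoupling`, `IsCoupling.re_trace_le_fid`). Channels carry such a Z along, which gives data
processing. Splitting tr Z along Q and 1 - Q and applying Cauchy–Schwarz gives p(1-p)F² ≤ pα +
(1-p)β (`mul_fid_sq_le_error`). Hence every strategy has exponent at most -(1/n) log(p(1-p)) plus
1/n times the divergence of its two output states (`bestExponent_le`), and only that divergence
remains to be bounded.

For non-adaptive classes the divergence is additive on product strategies, and a strategy for m uses
tensored with one for n uses is a strategy for m + n uses (`Superchannel.splits_apply_pow`). The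
attained values are thus nonnegative and superadditive, and a Fekete argument in the extended reals
shows that the normalized suprema converge and that the limit dominates each of them
(`tendsto_liminf_of_le_div`, `le_liminf_of_le_div`).

For adaptive classes the bound telescopes (`le_succ_mul_of_amortized`): the divergence is zero
before the first use, grows by at most the amortized quantity with each use, and does not grow under
the channels in between. Successive strategies telescope over states, nested ones over channels.

For fully general protocols the subtrahend in the amortized divergence contains the first encoder on
both sides. Accordingly the second hypothesis is followed through a hybrid in which completed
superchannels are Θ₂ while open ones have used the encoder of Θ₁. Opening a copy is then a common
channel and costs nothing. Closing one exchanges its encoder and applies its decoder; this costs at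
most the amortized divergence, because the state depends on each single open encoder as a comb
(`hasCombs`). With nothing open, the hybrid is the true run. The hybrid needs encoders with a common
memory, which padding provides (`Protocol.output_pad`). -/

namespace QND
set_option linter.unusedSectionVars false
open scoped ComplexOrder Kronecker

/-! ### Fidelity as a maximum over positive semidefinite block matrices -/

section Fidelity

variable {X Y : Type} [Fintype X] [DecidableEq X] [Fintype Y] [DecidableEq Y]

/-- The spectrum is finite, so the functional calculus is available for discontinuous functions too,
in particular for x ↦ (√x)⁻¹, which serves as a generalized inverse. -/
theorem continuousOn_spectrum (f : ℝ → ℝ) (M : Op X) : ContinuousOn f (spectrum ℝ M) :=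
  (Matrix.finite_real_spectrum (A := M)).continuousOn f

theorem cfc_mul_op (f g : ℝ → ℝ) (M : Op X) : cfc f M * cfc g M = cfc (fun x => f x * g x) M :=
  (cfc_mul f g M (continuousOn_spectrum _ _) (continuousOn_spectrum _ _)).symm

theorem conjTranspose_cfc (f : ℝ → ℝ) (M : Op X) : (cfc f M).conjTranspose = cfc f M :=
  (cfc_predicate (R := ℝ) f M : IsSelfAdjoint _)

theorem posSemidef_cfc {f : ℝ → ℝ} (hf : ∀ x, 0 ≤ f x) (M : Op X) : (cfc f M).PosSemidef := by
  have h : cfc f M = (cfc (fun x => √(f x)) M).conjTranspose * cfc (fun x => √(f x)) M := by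
    rw [conjTranspose_cfc, cfc_mul_op]
    simp only [Real.mul_self_sqrt (hf _)]
  rw [h]
  exact Matrix.posSemidef_conjTranspose_mul_self _

theorem spectrum_nonneg_of_posSemidef {M : Op X} (hM : M.PosSemidef) {x : ℝ}
    (hx : x ∈ spectrum ℝ M) : 0 ≤ x := by
  rw [hM.1.spectrum_real_eq_range_eigenvalues] at hx
  obtain ⟨i, rfl⟩ := hx
  exact hM.eigenvalues_nonneg i

theorem cfc_congr_of_posSemidef {M : Op X} (hM : M.PosSemidef) {f g : ℝ → ℝ}
    (h : ∀ x, 0 ≤ x → f x = g x) : cfc f M = cfc g M :=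
  cfc_congr fun _ hx => h _ (spectrum_nonneg_of_posSemidef hM hx)

theorem cfc_id_of_posSemidef {M : Op X} (hM : M.PosSemidef) : cfc (fun x : ℝ => x) M = M :=
  cfc_id' ℝ M hM.1.isSelfAdjoint

theorem mul_cfc_of_posSemidef {M : Op X} (hM : M.PosSemidef) (g : ℝ → ℝ) :
    M * cfc g M = cfc (fun x => x * g x) M := by
  rw [← cfc_mul_op, cfc_id_of_posSemidef hM]

theorem cfc_mul_of_posSemidef {M : Op X} (hM : M.PosSemidef) (g : ℝ → ℝ) :
    cfc g M * M = cfc (fun x => g x * x) M := by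
  rw [← cfc_mul_op, cfc_id_of_posSemidef hM]

theorem opSqrt_posSemidef (M : Op X) : (opSqrt M).PosSemidef :=
  posSemidef_cfc Real.sqrt_nonneg M

theorem opSqrt_conjTranspose (M : Op X) : (opSqrt M).conjTranspose = opSqrt M :=
  conjTranspose_cfc _ _

theorem opSqrt_mul_self {M : Op X} (hM : M.PosSemidef) : opSqrt M * opSqrt M = M := by
  rw [opSqrt, cfc_mul_op, cfc_congr_of_posSemidef hM (g := fun x => x)
    fun x hx => Real.mul_self_sqrt hx, cfc_id_of_posSemidef hM]

theorem opSqrt_of_mul_self {T : Op X} (hT : T.PosSemidef) : opSqrt (T * T) = T := by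
  have h : T * T = cfc (fun x : ℝ => x * x) T := by
    rw [← cfc_mul_op, cfc_id_of_posSemidef hT]
  have h2 := (cfc_comp (R := ℝ) Real.sqrt (fun x : ℝ => x * x) T hT.1.isSelfAdjoint
    (((Matrix.finite_real_spectrum (A := T)).image _).continuousOn _)
      (continuousOn_spectrum _ _)).symm
  rw [opSqrt, h, h2, cfc_congr_of_posSemidef hT (g := fun x => x), cfc_id_of_posSemidef hT]
  intro x hx
  simp [Real.sqrt_mul_self hx]

/-- The operators `Z` for which `[[ρ, Z], [Z†, σ]]` is positive semidefinite. -/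
def IsCoupling (ρ σ Z : Op X) : Prop := (Matrix.fromBlocks ρ Z Z.conjTranspose σ).PosSemidef

/-- Congruence of the block matrix by diag(L, N). -/
theorem IsCoupling.conj {ρ σ Z : Op X} (h : IsCoupling ρ σ Z) (L N : Op X) :
    IsCoupling (L * ρ * L.conjTranspose) (N * σ * N.conjTranspose) (L * Z * N.conjTranspose) := by
  have := h.mul_mul_conjTranspose_same (Matrix.fromBlocks L 0 0 N)
  simpa [IsCoupling, Matrix.fromBlocks_multiply, Matrix.fromBlocks_conjTranspose,
    Matrix.mul_assoc] using this

/-- Summing the 2 × 2 principal submatrices at the index pairs (`inl x`, `inr x`) is a partial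
trace. The resulting 2 × 2 matrix of traces is positive semidefinite, and its determinant gives this
Cauchy–Schwarz inequality. -/
theorem IsCoupling.norm_trace_sq_le {ρ σ Z : Op X} (h : IsCoupling ρ σ Z) :
    ‖Z.trace‖ ^ 2 ≤ ρ.trace.re * σ.trace.re := by
  have h1 : (!![ρ.trace, Z.trace; star Z.trace, σ.trace] : Matrix (Fin 2) (Fin 2) ℂ).PosSemidef := by
    have := Matrix.posSemidef_sum Finset.univ (fun (x : X) _ => h.submatrix ![Sum.inl x, Sum.inr x])
    convert this using 1
    ext i j
    rw [Matrix.sum_apply]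
    fin_cases i <;> fin_cases j <;> simp [Matrix.trace]
  have hρ := h1.diag_nonneg (i := 0)
  have hσ := h1.diag_nonneg (i := 1)
  have h2 := h1.det_nonneg
  rw [Matrix.det_fin_two] at h2
  simp only [Matrix.of_apply, Matrix.cons_val', Matrix.cons_val_zero, Matrix.cons_val_one,
    Matrix.cons_val_fin_one] at h2 hρ hσ
  have e : Z.trace * star Z.trace = ((‖Z.trace‖ ^ 2 : ℝ) : ℂ) := by
    rw [Complex.star_def, Complex.mul_conj, Complex.normSq_eq_norm_sq]
  rw [e] at h2
  have h3 := (Complex.le_def.1 h2).1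
  have h4 := (Complex.le_def.1 hρ).2
  simp [-Complex.ofReal_pow] at h3 h4
  rw [← h4] at h3
  simpa using h3

theorem IsCoupling.symm {ρ σ Z : Op X} (h : IsCoupling ρ σ Z) :
    IsCoupling σ ρ Z.conjTranspose := by
  have := h.submatrix Sum.swap
  convert this using 1
  rw [IsCoupling]
  congr! 1
  ext (i | i) (j | j) <;> simp

/-- After congruence by diag(Z†, 1) the off-diagonal trace is tr Z†Z, and Cauchy–Schwarz bounds it
by zero. Together with congruence by a kernel projection this shows that Z lives on the supports of
the diagonal blocks. -/
theorem IsCoupling.eq_zero_right {ρ Z : Op X} (h : IsCoupling ρ 0 Z) : Z = 0 := by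
  have := (h.conj Z.conjTranspose 1).norm_trace_sq_le
  simp only [Matrix.conjTranspose_one, Matrix.mul_one, Matrix.trace_zero,
    Complex.zero_re, mul_zero] at this
  have h0 : (Z.conjTranspose * Z).trace = 0 := norm_eq_zero.1 (by nlinarith [norm_nonneg (Z.conjTranspose * Z).trace])
  exact Matrix.trace_conjTranspose_mul_self_eq_zero_iff.1 h0

theorem IsCoupling.eq_zero_left {σ Z : Op X} (h : IsCoupling 0 σ Z) : Z = 0 :=
  Matrix.conjTranspose_eq_zero.1 h.symm.eq_zero_right

/-- The (square root) fidelity. -/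
noncomputable def fid (ρ σ : Op X) : ℝ := (opSqrt (opSqrt σ * ρ * opSqrt σ)).trace.re

theorem fid_nonneg (ρ σ : Op X) : 0 ≤ fid ρ σ :=
  (Complex.le_def.1 (opSqrt_posSemidef _).trace_nonneg).1

theorem posSemidef_sqrt_mul_mul_sqrt {ρ : Op X} (hρ : ρ.PosSemidef) (σ : Op X) :
    (opSqrt σ * ρ * opSqrt σ).PosSemidef := by
  have := hρ.mul_mul_conjTranspose_same (opSqrt σ)
  rwa [opSqrt_conjTranspose] at this

/-- The optimal Z comes from the polar decomposition of T = √ρ √σ: since T†T = P, the operator W = T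
P^(-1/2) is a contraction, and Z = √ρ W √σ has trace tr(P P^(-1/2)) = tr √P. -/
theorem exists_isCoupling {ρ σ : Op X} (hρ : ρ.PosSemidef) (hσ : σ.PosSemidef) :
    ∃ Z, IsCoupling ρ σ Z ∧ Z.trace.re = fid ρ σ := by
  set r := opSqrt ρ with hr
  set s := opSqrt σ with hs
  have hrr : r * r = ρ := opSqrt_mul_self hρ
  have hss : s * s = σ := opSqrt_mul_self hσ
  have hrc : r.conjTranspose = r := opSqrt_conjTranspose _
  have hsc : s.conjTranspose = s := opSqrt_conjTranspose _
  set P := s * ρ * s with hP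
  have hPp : P.PosSemidef := posSemidef_sqrt_mul_mul_sqrt hρ σ
  have hTT : (r * s).conjTranspose * (r * s) = P := by
    rw [Matrix.conjTranspose_mul, hrc, hsc, hP, ← hrr]
    simp only [Matrix.mul_assoc]
  -- A generalized inverse square root: it is 0 at 0, so W vanishes on the kernel of P and W†W is
  -- the support projection of P.
  set g : ℝ → ℝ := fun x => (√x)⁻¹ with hg
  set W := r * s * cfc g P with hW
  have hWW : (1 - W.conjTranspose * (1 : Op X)⁻¹ * W).PosSemidef := by
    have e : W.conjTranspose * (1 : Op X)⁻¹ * W = cfc (fun x => g x * x * g x) P := by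
      rw [inv_one, Matrix.mul_one, hW, Matrix.conjTranspose_mul, conjTranspose_cfc, Matrix.mul_assoc,
        ← Matrix.mul_assoc (r * s).conjTranspose, hTT, ← Matrix.mul_assoc,
        cfc_mul_of_posSemidef hPp, cfc_mul_op]
    rw [e, ← cfc_one ℝ P hPp.1.isSelfAdjoint, ← cfc_sub _ _ _ (continuousOn_spectrum _ _)
      (continuousOn_spectrum _ _)]
    refine posSemidef_cfc (fun x => ?_) P
    rcases le_or_gt x 0 with hx | hx
    · simp [hg, Real.sqrt_eq_zero'.2 hx]
    · have : √x ≠ 0 := (Real.sqrt_pos.2 hx).ne'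
      have h2 : g x * x * g x = 1 := by
        simp only [hg]
        field_simp
        rw [Real.sq_sqrt hx.le]
      simp [h2]
  -- Schur complement: [[1, W], [W†, 1]] is positive semidefinite exactly when 1 - W†W is.
  have h1 : IsCoupling (1 : Op X) 1 W := by
    have : Invertible (1 : Op X) := invertibleOne
    exact (Matrix.PosDef.fromBlocks₁₁ (A := (1 : Op X)) W 1 Matrix.PosDef.one).2 hWW
  refine ⟨r * W * s, ?_, ?_⟩
  · have := h1.conj r s
    rwa [hrc, hsc, Matrix.mul_one, Matrix.mul_one, hrr, hss] at this
  · have : (r * W * s).trace = (P * cfc g P).trace := by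
      have hTT' : P * cfc g P = s * (r * W) := by
        nth_rw 1 [← hTT]
        rw [hW, Matrix.conjTranspose_mul, hrc, hsc]
        simp only [Matrix.mul_assoc]
      rw [Matrix.trace_mul_comm, hTT']
    rw [this, mul_cfc_of_posSemidef hPp, fid, opSqrt, cfc_congr_of_posSemidef hPp]
    intro x hx
    simp only [hg]
    rcases hx.eq_or_lt with rfl | hx
    · simp
    · rw [← div_eq_mul_inv, Real.div_sqrt]

/-- Congruence by L = P^(-1/4) √σ and N = P^(1/4) σ^(-1/2) balances the two sides: both diagonal
blocks acquire trace tr √P, while the off-diagonal trace stays tr Z. Cauchy–Schwarz then reads |tr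
Z|² ≤ F². All inverses are generalized, so the supports need separate care. -/
theorem IsCoupling.re_trace_le_fid {ρ σ Z : Op X} (h : IsCoupling ρ σ Z) (hρ : ρ.PosSemidef)
    (hσ : σ.PosSemidef) : Z.trace.re ≤ fid ρ σ := by
  set s := opSqrt σ with hs
  have hsc : s.conjTranspose = s := opSqrt_conjTranspose _
  have hss : s * s = σ := opSqrt_mul_self hσ
  set P := s * ρ * s with hP
  have hPp : P.PosSemidef := posSemidef_sqrt_mul_mul_sqrt hρ σ
  set t : Op X := cfc (fun x => (√x)⁻¹) σ with ht
  have htc : t.conjTranspose = t := conjTranspose_cfc _ _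
  -- The indicator of x > 0, so `cfc u σ` is the support projection of σ; `v` below plays the same
  -- role for P.
  set u : ℝ → ℝ := fun x => √x * (√x)⁻¹ with hu
  have hu1 : ∀ x : ℝ, 0 ≤ x → x * u x = x := by
    intro x hx
    rcases hx.eq_or_lt with rfl | hx
    · simp
    · simp [hu, mul_inv_cancel₀ (Real.sqrt_pos.2 hx).ne']
  have hu2 : ∀ x : ℝ, 0 ≤ x → √x * u x = √x := by
    intro x hx
    rcases hx.eq_or_lt with rfl | hx
    · simp
    · simp [hu, mul_inv_cancel₀ (Real.sqrt_pos.2 hx).ne']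
  have hst : s * t = cfc u σ := cfc_mul_op _ _ _
  have hts : t * s = cfc u σ := by
    rw [ht, hs, opSqrt, cfc_mul_op]; simp only [hu, mul_comm]
  have hsu : s * cfc u σ = s := by
    rw [hs, opSqrt, cfc_mul_op, cfc_congr_of_posSemidef hσ hu2]
  have hσu : σ * cfc u σ = σ := by
    rw [mul_cfc_of_posSemidef hσ, cfc_congr_of_posSemidef hσ hu1, cfc_id_of_posSemidef hσ]
  -- Congruence by 1 minus the support projection annihilates the σ block, hence also the
  -- off-diagonal block.
  have hZu : Z * cfc u σ = Z := by
    have h1 := h.conj 1 (1 - cfc u σ)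
    have h0 : (1 - cfc u σ) * σ * (1 - cfc u σ).conjTranspose = 0 := by
      rw [Matrix.mul_assoc, Matrix.conjTranspose_sub, conjTranspose_cfc, Matrix.conjTranspose_one,
        Matrix.mul_sub, hσu, Matrix.mul_one, sub_self, Matrix.mul_zero]
    rw [h0] at h1
    have h2 := h1.eq_zero_right
    rw [Matrix.conjTranspose_sub, conjTranspose_cfc, Matrix.conjTranspose_one, Matrix.one_mul,
      Matrix.mul_sub, Matrix.mul_one, sub_eq_zero] at h2
    exact h2.symm
  set a : ℝ → ℝ := fun x => √√x with ha
  set b : ℝ → ℝ := fun x => (√√x)⁻¹ with hb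
  set v : ℝ → ℝ := fun x => a x * b x with hv
  have hv1 : ∀ x : ℝ, 0 ≤ x → x * v x = x := by
    intro x hx
    rcases hx.eq_or_lt with rfl | hx
    · simp
    · simp [hv, ha, hb, mul_inv_cancel₀ (Real.sqrt_pos.2 (Real.sqrt_pos.2 hx)).ne']
  have hPv : P * cfc v P = P := by
    rw [mul_cfc_of_posSemidef hPp, cfc_congr_of_posSemidef hPp hv1, cfc_id_of_posSemidef hPp]
  -- The same argument on the left, with (1 - v(P)) √σ annihilating the ρ block.
  have hvsZ : cfc v P * s * Z = s * Z := by
    have h1 := h.conj ((1 - cfc v P) * s) 1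
    have h0 : (1 - cfc v P) * s * ρ * ((1 - cfc v P) * s).conjTranspose = 0 := by
      have : (1 - cfc v P) * s * ρ * ((1 - cfc v P) * s).conjTranspose
          = (1 - cfc v P) * (P * (1 - cfc v P)) := by
        rw [Matrix.conjTranspose_mul, hsc, Matrix.conjTranspose_sub, conjTranspose_cfc,
          Matrix.conjTranspose_one, hP]
        simp only [Matrix.mul_assoc]
      rw [this, Matrix.mul_sub P, hPv, Matrix.mul_one, sub_self, Matrix.mul_zero]
    rw [h0] at h1
    have h2 := h1.eq_zero_left
    rw [Matrix.conjTranspose_one, Matrix.mul_one, Matrix.sub_mul, Matrix.sub_mul, Matrix.one_mul,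
      sub_eq_zero] at h2
    exact h2.symm
  have key := (h.conj (cfc b P * s) (cfc a P * t)).norm_trace_sq_le
  have e1 : (cfc b P * s * ρ * (cfc b P * s).conjTranspose).trace = (opSqrt P).trace := by
    have : cfc b P * s * ρ * (cfc b P * s).conjTranspose = cfc b P * P * cfc b P := by
      rw [Matrix.conjTranspose_mul, hsc, conjTranspose_cfc, hP]
      simp only [Matrix.mul_assoc]
    rw [this, cfc_mul_of_posSemidef hPp, cfc_mul_op, opSqrt, cfc_congr_of_posSemidef hPp]
    intro x hx
    rcases hx.eq_or_lt with rfl | hx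
    · simp
    · have h1 : √√x ≠ 0 := (Real.sqrt_pos.2 (Real.sqrt_pos.2 hx)).ne'
      simp only [hb]
      field_simp
      rw [Real.sq_sqrt (Real.sqrt_nonneg _), Real.mul_self_sqrt hx.le]
  have e2 : (cfc a P * t * σ * (cfc a P * t).conjTranspose).trace = (opSqrt P).trace := by
    have h1 : cfc a P * t * σ * (cfc a P * t).conjTranspose
        = cfc a P * (cfc u σ * cfc u σ * cfc a P) := by
      have h2 : t * σ * t = cfc u σ * cfc u σ := by
        nth_rw 1 [← hts]
        rw [← hst]
        nth_rw 1 [← hss]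
        simp only [Matrix.mul_assoc]
      rw [Matrix.conjTranspose_mul, htc, conjTranspose_cfc, ← h2]
      simp only [Matrix.mul_assoc]
    have haa : cfc a P * cfc a P = opSqrt P := by
      rw [cfc_mul_op, opSqrt]
      simp only [ha, Real.mul_self_sqrt (Real.sqrt_nonneg _)]
    have hPu : P * cfc u σ = P := by
      rw [hP, Matrix.mul_assoc, hsu]
    have hsP : opSqrt P * cfc u σ = opSqrt P := by
      have : opSqrt P = cfc (fun x => (√x)⁻¹) P * P := by
        rw [cfc_mul_of_posSemidef hPp, opSqrt, cfc_congr_of_posSemidef hPp]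
        intro x hx
        rw [mul_comm, ← div_eq_mul_inv, Real.div_sqrt]
      rw [this, Matrix.mul_assoc, hPu]
    rw [h1, Matrix.trace_mul_comm, Matrix.mul_assoc, haa, Matrix.trace_mul_comm,
      ← Matrix.mul_assoc, hsP, hsP]
  have e3 : (cfc b P * s * Z * (cfc a P * t).conjTranspose).trace = Z.trace := by
    have hba : cfc a P * cfc b P = cfc v P := cfc_mul_op _ _ _
    rw [Matrix.conjTranspose_mul, htc, conjTranspose_cfc, ← Matrix.mul_assoc, Matrix.trace_mul_comm]
    simp only [← Matrix.mul_assoc]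
    rw [hba, hvsZ, Matrix.trace_mul_comm, ← Matrix.mul_assoc, Matrix.trace_mul_comm, hts, hZu]
  rw [e1, e2, e3] at key
  have hF : fid ρ σ = (opSqrt P).trace.re := rfl
  rw [← hF, ← sq] at key
  exact (Complex.re_le_norm _).trans (le_of_sq_le_sq key (fid_nonneg _ _))

end Fidelity

/-! ### Channels, relabellings and constant channels -/

section Channels

variable {X Y Z R : Type}

theorem tensorId_apply (Φ : SuperOp X Y) (R : Type) (M : Op (X × R)) (y y' : Y × R) :
    tensorId Φ R M y y' = Φ (Matrix.of fun x x' => M (x, y.2) (x', y'.2)) y.1 y'.1 := rfl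

theorem relabel_apply (e : X ≃ Y) (M : Op X) (y y' : Y) :
    relabel e M y y' = M (e.symm y) (e.symm y') := rfl

theorem relabel_symm_apply_relabel (e : X ≃ Y) (M : Op X) : relabel e.symm (relabel e M) = M := by
  ext; simp [relabel_apply]

theorem tensorId_kronecker (Φ : SuperOp X Y) (M : Op X) (N : Op R) :
    tensorId Φ R (M ⊗ₖ N) = Φ M ⊗ₖ N := by
  ext y y'
  rw [tensorId_apply, Matrix.kronecker_apply]
  have : (Matrix.of fun x x' => (M ⊗ₖ N) (x, y.2) (x', y'.2)) = N y.2 y'.2 • M := by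
    ext x x'; simp [mul_comm]
  rw [this, map_smul, Matrix.smul_apply, smul_eq_mul, mul_comm]

variable [Fintype X] [DecidableEq X] [Fintype Y] [DecidableEq Y] [Fintype Z] [DecidableEq Z]
  [Fintype R] [DecidableEq R]

theorem superOp_ext_single {Φ Ψ : SuperOp X Y}
    (h : ∀ i j, Φ (Matrix.single i j 1) = Ψ (Matrix.single i j 1)) : Φ = Ψ := by
  refine Matrix.ext_linearMap _ fun i j => ?_
  ext1
  simpa using h i j

theorem superOp_ext_kronecker {Φ Ψ : SuperOp (X × Y) Z}
    (h : ∀ (M : Op X) (N : Op Y), Φ (M ⊗ₖ N) = Ψ (M ⊗ₖ N)) : Φ = Ψ := by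
  refine superOp_ext_single fun i j => ?_
  have := h (Matrix.single i.1 j.1 1) (Matrix.single i.2 j.2 1)
  rwa [Matrix.single_kronecker_single, mul_one] at this

/-- Complete positivity is required only for the references `Fin k`; an enumeration of R transports
it to every finite reference. -/
theorem IsChannel.tensorId_posSemidef {Φ : SuperOp X Y} (hΦ : IsChannel Φ) {M : Op (X × R)}
    (hM : M.PosSemidef) : (tensorId Φ R M).PosSemidef := by
  let e := Fintype.equivFin R
  have h := hΦ.1 (Fintype.card R) (M.submatrix (Prod.map id e.symm) (Prod.map id e.symm))
    (hM.submatrix _)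
  have h2 := h.submatrix (Prod.map id e)
  convert h2 using 1
  ext y y'
  simp only [Matrix.submatrix_apply, tensorId_apply, Prod.map, id, Equiv.symm_apply_apply]

theorem IsChannel.posSemidef {Φ : SuperOp X Y} (hΦ : IsChannel Φ) {M : Op X}
    (hM : M.PosSemidef) : (Φ M).PosSemidef :=
  (hΦ.tensorId_posSemidef (R := Unit) (hM.submatrix Prod.fst)).submatrix fun y => (y, ())

theorem IsChannel.map_isState {Φ : SuperOp X Y} (hΦ : IsChannel Φ) {ρ : Op X} (hρ : IsState ρ) :
    IsState (Φ ρ) := ⟨hΦ.posSemidef hρ.1, (hΦ.2 ρ).trans hρ.2⟩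

theorem IsChannel.comp {Φ : SuperOp X Y} {Ψ : SuperOp Y Z} (hΨ : IsChannel Ψ) (hΦ : IsChannel Φ) :
    IsChannel (Ψ ∘ₗ Φ) :=
  ⟨fun k _ hM => hΨ.1 k _ (hΦ.1 k _ hM), fun M => (hΨ.2 _).trans (hΦ.2 M)⟩

theorem IsChannel.tensorId {Φ : SuperOp X Y} (hΦ : IsChannel Φ) (R : Type) [Fintype R]
    [DecidableEq R] : IsChannel (tensorId Φ R) := by
  refine ⟨fun k M hM => ?_, fun M => ?_⟩
  · exact (hΦ.tensorId_posSemidef (hM.submatrix (Equiv.prodAssoc X R (Fin k)).symm)).submatrix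
      (Equiv.prodAssoc Y R (Fin k))
  · simp only [Matrix.trace, Matrix.diag, Fintype.sum_prod_type_right, tensorId_apply]
    refine Finset.sum_congr rfl fun r _ => ?_
    exact hΦ.2 (Matrix.of fun x x' => M (x, r) (x', r))

theorem isChannel_relabel (e : X ≃ Y) : IsChannel (relabel e) := by
  refine ⟨fun k M hM => ?_, fun M => ?_⟩
  · exact hM.submatrix fun y : Y × Fin k => (e.symm y.1, y.2)
  · exact Equiv.sum_comp e.symm fun x => M x x

theorem IsState.relabel {ρ : Op X} (hρ : IsState ρ) (e : X ≃ Y) : IsState (relabel e ρ) :=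
  (isChannel_relabel e).map_isState hρ

theorem IsState.kronecker {ρ : Op X} {σ : Op Y} (hρ : IsState ρ) (hσ : IsState σ) :
    IsState (ρ ⊗ₖ σ) :=
  ⟨hρ.1.kronecker hσ.1, by rw [Matrix.trace_kronecker, hρ.2, hσ.2, one_mul]⟩

/-- The map that discards its input and prepares `τ`. -/
def replacement (X : Type) [Fintype X] (τ : Op Y) : SuperOp X Y :=
  (Matrix.traceLinearMap X ℂ ℂ).smulRight τ

theorem replacement_apply (τ : Op Y) (M : Op X) : replacement X τ M = M.trace • τ := rfl

theorem tensorId_replacement (τ : Op Y) (M : Op (X × R)) :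
    tensorId (replacement X τ) R M
      = τ ⊗ₖ ∑ x : X, M.submatrix (fun r : R => (x, r)) (fun r => (x, r)) := by
  ext y y'
  rw [tensorId_apply, replacement_apply, Matrix.kronecker_apply, Matrix.sum_apply]
  simp [Matrix.trace, mul_comm]

theorem isChannel_replacement {τ : Op Y} (hτ : IsState τ) : IsChannel (replacement X τ) := by
  refine ⟨fun k M hM => ?_, fun M => ?_⟩
  · rw [tensorId_replacement]
    exact hτ.1.kronecker (Matrix.posSemidef_sum _ fun x _ => hM.submatrix _)
  · rw [replacement_apply, Matrix.trace_smul, hτ.2, smul_eq_mul, mul_one]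

theorem isState_single (x : X) : IsState (Matrix.single x x (1 : ℂ)) := by
  refine ⟨?_, by simp⟩
  rw [← Matrix.diagonal_single]
  refine Matrix.PosSemidef.diagonal fun i => ?_
  by_cases h : i = x
  · subst h; simp
  · simp [h]

theorem IsState.nonempty {ρ : Op X} (hρ : IsState ρ) : Nonempty X := by
  by_contra h
  rw [not_nonempty_iff] at h
  have := hρ.2
  simp [Matrix.trace] at this

end Channels

/-! ### Data processing, additivity and the error bound -/

section Divergence

variable {X Y : Type} [Fintype X] [DecidableEq X] [Fintype Y] [DecidableEq Y]

/-- The block matrix is an operator on X with a two-dimensional reference, so complete positivity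
with `k = 2` applies. The image is Hermitian, which yields Φ(Z†) = Φ(Z)†. -/
theorem IsCoupling.map {ρ σ Z : Op X} (h : IsCoupling ρ σ Z) {Φ : SuperOp X Y}
    (hΦ : IsChannel Φ) : IsCoupling (Φ ρ) (Φ σ) (Φ Z) := by
  have h1 := (hΦ.1 2 _ (h.submatrix fun x : X × Fin 2 =>
    (![Sum.inl x.1, Sum.inr x.1] : Fin 2 → X ⊕ X) x.2)).submatrix
      (Sum.elim (fun y => (y, 0)) (fun y => (y, 1)) : Y ⊕ Y → Y × Fin 2)
  have h2 : (Matrix.fromBlocks (Φ ρ) (Φ Z) (Φ Z.conjTranspose) (Φ σ)).PosSemidef := by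
    convert h1 using 1
    ext (i | i) (j | j) <;> rfl
  have h3 : Φ Z.conjTranspose = (Φ Z).conjTranspose :=
    (Matrix.isHermitian_fromBlocks_iff.1 h2.1).2.1.symm
  rwa [h3] at h2

/-- The image of an optimal Z is a candidate for the image states and has the same trace. -/
theorem fid_le_fid_map {ρ σ : Op X} (hρ : ρ.PosSemidef) (hσ : σ.PosSemidef) {Φ : SuperOp X Y}
    (hΦ : IsChannel Φ) : fid ρ σ ≤ fid (Φ ρ) (Φ σ) := by
  obtain ⟨Z, hZ, hF⟩ := exists_isCoupling hρ hσ
  rw [← hF, ← hΦ.2 Z]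
  exact (hZ.map hΦ).re_trace_le_fid (hΦ.posSemidef hρ) (hΦ.posSemidef hσ)

theorem opSqrt_kronecker {ρ : Op X} {σ : Op Y} (hρ : ρ.PosSemidef) (hσ : σ.PosSemidef) :
    opSqrt (ρ ⊗ₖ σ) = opSqrt ρ ⊗ₖ opSqrt σ := by
  rw [← opSqrt_of_mul_self ((opSqrt_posSemidef ρ).kronecker (opSqrt_posSemidef σ)),
    ← Matrix.mul_kronecker_mul, opSqrt_mul_self hρ, opSqrt_mul_self hσ]

theorem fid_kronecker {ρ₁ σ₁ : Op X} {ρ₂ σ₂ : Op Y} (hρ₁ : ρ₁.PosSemidef) (hσ₁ : σ₁.PosSemidef)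
    (hρ₂ : ρ₂.PosSemidef) (hσ₂ : σ₂.PosSemidef) :
    fid (ρ₁ ⊗ₖ ρ₂) (σ₁ ⊗ₖ σ₂) = fid ρ₁ σ₁ * fid ρ₂ σ₂ := by
  rw [fid, opSqrt_kronecker hσ₁ hσ₂, ← Matrix.mul_kronecker_mul, ← Matrix.mul_kronecker_mul,
    opSqrt_kronecker (posSemidef_sqrt_mul_mul_sqrt hρ₁ _) (posSemidef_sqrt_mul_mul_sqrt hρ₂ _),
    Matrix.trace_kronecker, Complex.mul_re]
  have := (Complex.le_def.1 (opSqrt_posSemidef (opSqrt σ₁ * ρ₁ * opSqrt σ₁)).trace_nonneg).2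
  rw [← this]
  simp [fid]

theorem fid_sq_le_one {ρ σ : Op X} (hρ : IsState ρ) (hσ : IsState σ) : fid ρ σ ^ 2 ≤ 1 := by
  obtain ⟨Z, hZ, hF⟩ := exists_isCoupling hρ.1 hσ.1
  have := hZ.norm_trace_sq_le
  rw [hρ.2, hσ.2, Complex.one_re, mul_one] at this
  rw [← hF]
  exact (sq_le_sq.2 ((Complex.abs_re_le_norm _).trans (le_abs_self _))).trans this

theorem fid_self {ρ : Op X} (hρ : IsState ρ) : fid ρ ρ = 1 := by
  have h := opSqrt_mul_self hρ.1
  have : opSqrt ρ * ρ * opSqrt ρ = ρ * ρ := by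
    conv_rhs => rw [← h]
    nth_rw 2 [← h]
    simp only [Matrix.mul_assoc]
  rw [fid, this, opSqrt_of_mul_self hρ.1, hρ.2, Complex.one_re]

/-- With P = √σ ρ √σ, tr ρσ = tr P is the squared Hilbert–Schmidt norm of √P, whose trace is F; both
vanish exactly when √P = 0. -/
theorem fid_eq_zero_iff {ρ σ : Op X} (hρ : ρ.PosSemidef) (hσ : σ.PosSemidef) :
    (ρ * σ).trace = 0 ↔ fid ρ σ = 0 := by
  set P := opSqrt σ * ρ * opSqrt σ with hP
  have hPp : P.PosSemidef := posSemidef_sqrt_mul_mul_sqrt hρ σ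
  have h1 : (ρ * σ).trace = (opSqrt P * opSqrt P).trace := by
    rw [opSqrt_mul_self hPp, hP, Matrix.trace_mul_comm (opSqrt σ * ρ), ← Matrix.mul_assoc,
      opSqrt_mul_self hσ, Matrix.trace_mul_comm]
  have h2 : (ρ * σ).trace = 0 ↔ opSqrt P = 0 := by
    rw [h1]
    nth_rw 1 [← opSqrt_conjTranspose P]
    exact Matrix.trace_conjTranspose_mul_self_eq_zero_iff
  rw [h2, ← (opSqrt_posSemidef P).trace_eq_zero_iff, fid, ← hP]
  have := (Complex.le_def.1 (opSqrt_posSemidef P).trace_nonneg).2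
  rw [Complex.ext_iff, ← this]
  simp

theorem negLog_antitone {s t : ℝ} (h : s ≤ t) : negLog t ≤ negLog s := by
  unfold negLog
  split_ifs with h1 h2 h2
  · exact le_rfl
  · exact absurd (h.trans h1) h2
  · exact le_top
  · exact EReal.coe_le_coe_iff.2
      (neg_le_neg (Real.logb_le_logb_of_le one_lt_two (not_le.1 h2) h))

theorem negLog_of_pos {t : ℝ} (h : 0 < t) : negLog t = ((-Real.logb 2 t : ℝ) : EReal) :=
  if_neg (not_le.2 h)

theorem negLog_zero : negLog 0 = ⊤ := if_pos le_rfl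

theorem negLog_one : negLog 1 = 0 := by simp [negLog_of_pos one_pos]

theorem negLog_ne_bot (t : ℝ) : negLog t ≠ ⊥ := by
  unfold negLog; split_ifs <;> simp

theorem negLog_mul {s t : ℝ} (hs : 0 ≤ s) (ht : 0 ≤ t) :
    negLog (s * t) = negLog s + negLog t := by
  rcases hs.eq_or_lt with rfl | hs
  · rw [zero_mul, negLog_zero, EReal.top_add_of_ne_bot (negLog_ne_bot _)]
  rcases ht.eq_or_lt with rfl | ht
  · rw [mul_zero, negLog_zero, EReal.add_top_of_ne_bot (negLog_ne_bot _)]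
  rw [negLog_of_pos hs, negLog_of_pos ht, negLog_of_pos (mul_pos hs ht),
    Real.logb_mul hs.ne' ht.ne', ← EReal.coe_add, neg_add]

theorem negLog_nonneg {t : ℝ} (ht : t ≤ 1) : 0 ≤ negLog t :=
  negLog_one.symm.le.trans (negLog_antitone ht)

/-- Orthogonal states need no separate treatment afterwards: `negLog` is antitone on all reals and
turns products of nonnegative reals into sums, with the value +∞ at 0 included. -/
theorem stateDiv_eq_negLog {ρ σ : Op X} (hρ : ρ.PosSemidef) (hσ : σ.PosSemidef) :
    stateDiv ρ σ = negLog (fid ρ σ ^ 2) := by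
  unfold stateDiv
  split_ifs with h
  · rw [(fid_eq_zero_iff hρ hσ).1 h, zero_pow two_ne_zero, negLog_zero]
  · have h0 : 0 < fid ρ σ :=
      (fid_nonneg ρ σ).lt_of_ne' fun h' => h ((fid_eq_zero_iff hρ hσ).2 h')
    rw [negLog_of_pos (pow_pos h0 2), Real.logb_pow]
    simp [fid]

theorem stateDiv_nonneg {ρ σ : Op X} (hρ : IsState ρ) (hσ : IsState σ) : 0 ≤ stateDiv ρ σ := by
  rw [stateDiv_eq_negLog hρ.1 hσ.1]
  exact negLog_nonneg (fid_sq_le_one hρ hσ)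

theorem stateDiv_self {ρ : Op X} (hρ : IsState ρ) : stateDiv ρ ρ = 0 := by
  rw [stateDiv_eq_negLog hρ.1 hρ.1, fid_self hρ, one_pow, negLog_one]

theorem stateDiv_kronecker {ρ₁ σ₁ : Op X} {ρ₂ σ₂ : Op Y} (hρ₁ : ρ₁.PosSemidef)
    (hσ₁ : σ₁.PosSemidef) (hρ₂ : ρ₂.PosSemidef) (hσ₂ : σ₂.PosSemidef) :
    stateDiv (ρ₁ ⊗ₖ ρ₂) (σ₁ ⊗ₖ σ₂) = stateDiv ρ₁ σ₁ + stateDiv ρ₂ σ₂ := by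
  rw [stateDiv_eq_negLog (hρ₁.kronecker hρ₂) (hσ₁.kronecker hσ₂), stateDiv_eq_negLog hρ₁ hσ₁,
    stateDiv_eq_negLog hρ₂ hσ₂, fid_kronecker hρ₁ hσ₁ hρ₂ hσ₂, mul_pow,
    negLog_mul (sq_nonneg _) (sq_nonneg _)]

/-- Data processing for the state divergence. -/
theorem stateDiv_map_le {ρ σ : Op X} (hρ : ρ.PosSemidef) (hσ : σ.PosSemidef) {Φ : SuperOp X Y}
    (hΦ : IsChannel Φ) : stateDiv (Φ ρ) (Φ σ) ≤ stateDiv ρ σ := by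
  rw [stateDiv_eq_negLog hρ hσ, stateDiv_eq_negLog (hΦ.posSemidef hρ) (hΦ.posSemidef hσ)]
  exact negLog_antitone (pow_le_pow_left₀ (fid_nonneg _ _) (fid_le_fid_map hρ hσ hΦ) 2)

theorem stateDiv_relabel {ρ σ : Op X} (hρ : ρ.PosSemidef) (hσ : σ.PosSemidef) (e : X ≃ Y) :
    stateDiv (relabel e ρ) (relabel e σ) = stateDiv ρ σ := by
  refine le_antisymm (stateDiv_map_le hρ hσ (isChannel_relabel e)) ?_
  have := stateDiv_map_le ((isChannel_relabel e).posSemidef hρ)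
    ((isChannel_relabel e).posSemidef hσ) (isChannel_relabel e.symm)
  rwa [relabel_symm_apply_relabel, relabel_symm_apply_relabel] at this

theorem re_trace_mul_nonneg {Q M : Op X} (hQ : Q.PosSemidef) (hM : M.PosSemidef) :
    0 ≤ (Q * M).trace.re := by
  have := (posSemidef_sqrt_mul_mul_sqrt hM Q).trace_nonneg
  rw [Matrix.trace_mul_comm, ← Matrix.mul_assoc, opSqrt_mul_self hQ] at this
  exact (Complex.le_def.1 this).1

theorem IsCoupling.norm_trace_mul_sq_le {ρ σ Z : Op X} (h : IsCoupling ρ σ Z) {Q : Op X}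
    (hQ : Q.PosSemidef) : ‖(Q * Z).trace‖ ^ 2 ≤ (Q * ρ).trace.re * (Q * σ).trace.re := by
  have h1 := (h.conj (opSqrt Q) (opSqrt Q)).norm_trace_sq_le
  rw [opSqrt_conjTranspose] at h1
  have e : ∀ M : Op X, (opSqrt Q * M * opSqrt Q).trace = (Q * M).trace := fun M => by
    rw [Matrix.trace_mul_comm, ← Matrix.mul_assoc, opSqrt_mul_self hQ]
  rwa [e, e, e] at h1

/-- Lower bound on the Bayesian error of a binary measurement in terms of the fidelity. -/
theorem mul_fid_sq_le_error {ρ σ Q : Op X} (hρ : IsState ρ) (hσ : IsState σ) (hQ : Q.PosSemidef)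
    (hQ' : (1 - Q).PosSemidef) {p : ℝ} (hp : 0 < p) (hp' : p < 1) :
    p * (1 - p) * fid ρ σ ^ 2
      ≤ p * ((1 - Q) * ρ).trace.re + (1 - p) * (Q * σ).trace.re := by
  obtain ⟨Z, hZ, hF⟩ := exists_isCoupling hρ.1 hσ.1
  have h1 := hZ.norm_trace_mul_sq_le hQ
  have h2 := hZ.norm_trace_mul_sq_le hQ'
  have e : ∀ M : Op X, ((1 - Q) * M).trace.re = M.trace.re - (Q * M).trace.re := fun M => by
    rw [Matrix.sub_mul, Matrix.one_mul, Matrix.trace_sub, Complex.sub_re]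
  have hα := re_trace_mul_nonneg hQ' hρ.1
  have hβ := re_trace_mul_nonneg hQ hσ.1
  have hα' := re_trace_mul_nonneg hQ hρ.1
  have hβ' := re_trace_mul_nonneg hQ' hσ.1
  -- Split tr Z = tr QZ + tr (1-Q)Z for an optimal Z.
  have h3 : fid ρ σ ≤ ‖(Q * Z).trace‖ + ‖((1 - Q) * Z).trace‖ := by
    have := (Complex.re_le_norm (Q * Z).trace)
    have := (Complex.re_le_norm ((1 - Q) * Z).trace)
    have := e Z
    linarith
  have e1 := e ρ
  have e2 := e σ
  rw [hρ.2, Complex.one_re] at e1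
  rw [hσ.2, Complex.one_re] at e2
  set α := ((1 - Q) * ρ).trace.re
  set β := (Q * σ).trace.re
  set x := ‖(Q * Z).trace‖
  set y := ‖((1 - Q) * Z).trace‖
  have hx0 : 0 ≤ x := norm_nonneg _
  have hy0 : 0 ≤ y := norm_nonneg _
  -- In each product of two traces only the error probability is kept; the other factor is a
  -- probability, hence at most 1.
  have hx : x ^ 2 ≤ β := by nlinarith
  have hy : y ^ 2 ≤ α := by nlinarith
  have hF0 := fid_nonneg ρ σ
  have h4 : fid ρ σ ^ 2 ≤ (x + y) ^ 2 := pow_le_pow_left₀ hF0 h3 2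
  -- The difference of the two sides is exactly (p y - (1-p) x)².
  have h5 : p * (1 - p) * (x + y) ^ 2 ≤ p * y ^ 2 + (1 - p) * x ^ 2 := by
    nlinarith [sq_nonneg (p * y - (1 - p) * x)]
  have hq : 0 < 1 - p := sub_pos.2 hp'
  calc p * (1 - p) * fid ρ σ ^ 2 ≤ p * (1 - p) * (x + y) ^ 2 := by gcongr
    _ ≤ p * y ^ 2 + (1 - p) * x ^ 2 := h5
    _ ≤ p * α + (1 - p) * β := by gcongr

/-- Holds for any pair of states, so it treats all classes of strategies alike and leaves only the
divergence of the outputs to be estimated. -/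
theorem bestExponent_le {ρ σ : Op X} (hρ : IsState ρ) (hσ : IsState σ) {p : ℝ} (hp : 0 < p)
    (hp' : p < 1) (n : ℕ) :
    bestExponent n p ρ σ ≤ ((-(1 / (n : ℝ)) * Real.logb 2 (p * (1 - p)) : ℝ) : EReal)
      + ((1 / (n : ℝ) : ℝ) : EReal) * stateDiv ρ σ := by
  refine iSup_le fun Q => iSup_le fun hQ => iSup_le fun hQ' => ?_
  have hn : (0 : EReal) ≤ ((1 / (n : ℝ) : ℝ) : EReal) := by
    rw [EReal.coe_nonneg]; positivity
  have hpp : 0 < p * (1 - p) := mul_pos hp (sub_pos.2 hp')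
  refine (mul_le_mul_of_nonneg_left
    (negLog_antitone (mul_fid_sq_le_error hρ hσ hQ hQ' hp hp')) hn).trans ?_
  rw [negLog_mul hpp.le (sq_nonneg _), ← stateDiv_eq_negLog hρ.1 hσ.1,
    EReal.left_distrib_of_nonneg_of_ne_top hn (EReal.coe_ne_top _), negLog_of_pos hpp,
    ← EReal.coe_mul, neg_mul, mul_neg]

end Divergence

/-! ### Tensor products of maps and tensor powers, up to identification of systems -/

section TensorMap

variable {X Y Z X₁ X₂ Y₁ Y₂ Z₁ Z₂ R R₁ R₂ : Type}

/-- The map `Φ ⊗ Ψ`. -/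
def tensorMap (Φ : SuperOp X₁ Y₁) (Ψ : SuperOp X₂ Y₂) : SuperOp (X₁ × X₂) (Y₁ × Y₂) :=
  relabel (Equiv.prodComm Y₂ Y₁) ∘ₗ tensorId Ψ Y₁ ∘ₗ relabel (Equiv.prodComm Y₁ X₂) ∘ₗ
    tensorId Φ X₂

theorem relabel_prodComm_kronecker (M : Op X) (N : Op Y) :
    relabel (Equiv.prodComm X Y) (M ⊗ₖ N) = N ⊗ₖ M := by
  ext; simp [relabel_apply, mul_comm]

theorem tensorMap_kronecker (Φ : SuperOp X₁ Y₁) (Ψ : SuperOp X₂ Y₂) (M : Op X₁) (N : Op X₂) :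
    tensorMap Φ Ψ (M ⊗ₖ N) = Φ M ⊗ₖ Ψ N := by
  simp only [tensorMap, LinearMap.comp_apply, tensorId_kronecker, relabel_prodComm_kronecker]

theorem relabel_trans (e : X ≃ Y) (f : Y ≃ Z) : relabel (e.trans f) = relabel f ∘ₗ relabel e := rfl

variable [Fintype X] [DecidableEq X] [Fintype Y] [DecidableEq Y] [Fintype Z] [DecidableEq Z]
  [Fintype X₁] [DecidableEq X₁] [Fintype X₂] [DecidableEq X₂] [Fintype Y₁] [DecidableEq Y₁]
  [Fintype Y₂] [DecidableEq Y₂] [Fintype Z₁] [DecidableEq Z₁] [Fintype Z₂] [DecidableEq Z₂]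
  [Fintype R] [DecidableEq R] [Fintype R₁] [DecidableEq R₁] [Fintype R₂] [DecidableEq R₂]

theorem IsChannel.tensorMap {Φ : SuperOp X₁ Y₁} {Ψ : SuperOp X₂ Y₂} (hΦ : IsChannel Φ)
    (hΨ : IsChannel Ψ) : IsChannel (tensorMap Φ Ψ) :=
  (isChannel_relabel _).comp ((hΨ.tensorId _).comp ((isChannel_relabel _).comp (hΦ.tensorId _)))

theorem superOp_ext_kronecker₄ {Φ Ψ : SuperOp ((X₁ × R₁) × (X₂ × R₂)) Z}
    (h : ∀ (M₁ : Op X₁) (N₁ : Op R₁) (M₂ : Op X₂) (N₂ : Op R₂),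
      Φ ((M₁ ⊗ₖ N₁) ⊗ₖ (M₂ ⊗ₖ N₂)) = Ψ ((M₁ ⊗ₖ N₁) ⊗ₖ (M₂ ⊗ₖ N₂))) : Φ = Ψ := by
  refine superOp_ext_single fun i j => ?_
  have := h (Matrix.single i.1.1 j.1.1 1) (Matrix.single i.1.2 j.1.2 1)
    (Matrix.single i.2.1 j.2.1 1) (Matrix.single i.2.2 j.2.2 1)
  simpa only [Matrix.single_kronecker_single, mul_one] using this

theorem tensorMap_comp (Φ : SuperOp X₁ Y₁) (Ψ : SuperOp X₂ Y₂) (Φ' : SuperOp Y₁ Z₁)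
    (Ψ' : SuperOp Y₂ Z₂) :
    tensorMap (Φ' ∘ₗ Φ) (Ψ' ∘ₗ Ψ) = tensorMap Φ' Ψ' ∘ₗ tensorMap Φ Ψ :=
  superOp_ext_kronecker fun M N => by simp only [LinearMap.comp_apply, tensorMap_kronecker]

theorem relabel_prodCongr_kronecker (e : X₁ ≃ Y₁) (f : X₂ ≃ Y₂) (M : Op X₁) (N : Op X₂) :
    relabel (e.prodCongr f) (M ⊗ₖ N) = relabel e M ⊗ₖ relabel f N := rfl

theorem tensorMap_relabel (e : X₁ ≃ Y₁) (f : X₂ ≃ Y₂) :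
    tensorMap (relabel e) (relabel f) = relabel (e.prodCongr f) :=
  superOp_ext_kronecker fun M N => by
    rw [tensorMap_kronecker, relabel_prodCongr_kronecker]

/-- `Φ` is `Φ₁ ⊗ Φ₂`, up to the identifications `j` and `j'`. -/
def Splits (j : X₁ × X₂ ≃ X) (j' : Y₁ × Y₂ ≃ Y) (Φ : SuperOp X Y) (Φ₁ : SuperOp X₁ Y₁)
    (Φ₂ : SuperOp X₂ Y₂) : Prop :=
  Φ ∘ₗ relabel j = relabel j' ∘ₗ tensorMap Φ₁ Φ₂

theorem Splits.apply_kronecker {j : X₁ × X₂ ≃ X} {j' : Y₁ × Y₂ ≃ Y} {Φ : SuperOp X Y}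
    {Φ₁ : SuperOp X₁ Y₁} {Φ₂ : SuperOp X₂ Y₂} (h : Splits j j' Φ Φ₁ Φ₂) (M : Op X₁) (N : Op X₂) :
    Φ (relabel j (M ⊗ₖ N)) = relabel j' (Φ₁ M ⊗ₖ Φ₂ N) := by
  rw [← tensorMap_kronecker]
  exact LinearMap.congr_fun h (M ⊗ₖ N)

theorem Splits.comp {j : X₁ × X₂ ≃ X} {j' : Y₁ × Y₂ ≃ Y} {j'' : Z₁ × Z₂ ≃ Z} {Φ : SuperOp X Y}
    {Φ₁ : SuperOp X₁ Y₁} {Φ₂ : SuperOp X₂ Y₂} {Ψ : SuperOp Y Z}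
    {Ψ₁ : SuperOp Y₁ Z₁} {Ψ₂ : SuperOp Y₂ Z₂} (h' : Splits j' j'' Ψ Ψ₁ Ψ₂)
    (h : Splits j j' Φ Φ₁ Φ₂) : Splits j j'' (Ψ ∘ₗ Φ) (Ψ₁ ∘ₗ Φ₁) (Ψ₂ ∘ₗ Φ₂) := by
  unfold Splits at *
  rw [LinearMap.comp_assoc, h, ← LinearMap.comp_assoc, h', tensorMap_comp, LinearMap.comp_assoc]

theorem splits_relabel {j : X₁ × X₂ ≃ X} {j' : Y₁ × Y₂ ≃ Y} {e : X ≃ Y} {e₁ : X₁ ≃ Y₁}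
    {e₂ : X₂ ≃ Y₂} (h : ∀ x, e (j x) = j' (e₁ x.1, e₂ x.2)) :
    Splits j j' (relabel e) (relabel e₁) (relabel e₂) := by
  unfold Splits
  rw [tensorMap_relabel, ← relabel_trans, ← relabel_trans]
  congr 1
  ext x
  exact h x

/-- The identification `(X₁ × R₁) × (X₂ × R₂) ≃ X × R` for given identifications
`X₁ × X₂ ≃ X` and `R₁ × R₂ ≃ R`. -/
def joinEquiv (j : X₁ × X₂ ≃ X) (e : R₁ × R₂ ≃ R) : (X₁ × R₁) × (X₂ × R₂) ≃ X × R :=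
  (Equiv.prodProdProdComm X₁ R₁ X₂ R₂).trans (j.prodCongr e)

theorem relabel_joinEquiv_kronecker (j : X₁ × X₂ ≃ X) (e : R₁ × R₂ ≃ R) (M₁ : Op X₁) (N₁ : Op R₁)
    (M₂ : Op X₂) (N₂ : Op R₂) : relabel (joinEquiv j e) ((M₁ ⊗ₖ N₁) ⊗ₖ (M₂ ⊗ₖ N₂))
      = relabel j (M₁ ⊗ₖ M₂) ⊗ₖ relabel e (N₁ ⊗ₖ N₂) := by
  ext x x'
  simp only [relabel_apply]
  exact mul_mul_mul_comm _ _ _ _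

/-- Checked on product operators, where `joinEquiv` regroups the four factors into system and
reference. -/
theorem Splits.tensorId {j : X₁ × X₂ ≃ X} {j' : Y₁ × Y₂ ≃ Y} {Φ : SuperOp X Y}
    {Φ₁ : SuperOp X₁ Y₁} {Φ₂ : SuperOp X₂ Y₂} (h : Splits j j' Φ Φ₁ Φ₂) (e : R₁ × R₂ ≃ R) :
    Splits (joinEquiv j e) (joinEquiv j' e) (tensorId Φ R) (tensorId Φ₁ R₁) (tensorId Φ₂ R₂) :=
  superOp_ext_kronecker₄ fun M₁ N₁ M₂ N₂ => by
    simp only [LinearMap.comp_apply, relabel_joinEquiv_kronecker, tensorId_kronecker,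
      tensorMap_kronecker, h.apply_kronecker]

/-- The map that is `Φ₁ ⊗ Φ₂` up to the identifications `j` and `j'`. -/
def joinMap (j : X₁ × X₂ ≃ X) (j' : Y₁ × Y₂ ≃ Y) (Φ₁ : SuperOp X₁ Y₁) (Φ₂ : SuperOp X₂ Y₂) :
    SuperOp X Y := relabel j' ∘ₗ tensorMap Φ₁ Φ₂ ∘ₗ relabel j.symm

theorem splits_joinMap (j : X₁ × X₂ ≃ X) (j' : Y₁ × Y₂ ≃ Y) (Φ₁ : SuperOp X₁ Y₁)
    (Φ₂ : SuperOp X₂ Y₂) : Splits j j' (joinMap j j' Φ₁ Φ₂) Φ₁ Φ₂ := by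
  ext1 M
  simp only [joinMap, LinearMap.comp_apply, relabel_symm_apply_relabel]

theorem Splits.eq_joinMap {j : X₁ × X₂ ≃ X} {j' : Y₁ × Y₂ ≃ Y} {Φ : SuperOp X Y}
    {Φ₁ : SuperOp X₁ Y₁} {Φ₂ : SuperOp X₂ Y₂} (h : Splits j j' Φ Φ₁ Φ₂) :
    Φ = joinMap j j' Φ₁ Φ₂ := by
  have h2 : relabel j ∘ₗ relabel j.symm = LinearMap.id := by
    ext1 M; exact relabel_symm_apply_relabel j.symm M
  rw [joinMap, ← LinearMap.comp_assoc, ← h, LinearMap.comp_assoc, h2, LinearMap.comp_id]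

theorem isChannel_joinMap (j : X₁ × X₂ ≃ X) (j' : Y₁ × Y₂ ≃ Y) {Φ₁ : SuperOp X₁ Y₁}
    {Φ₂ : SuperOp X₂ Y₂} (h₁ : IsChannel Φ₁) (h₂ : IsChannel Φ₂) :
    IsChannel (joinMap j j' Φ₁ Φ₂) :=
  (isChannel_relabel _).comp ((h₁.tensorMap h₂).comp (isChannel_relabel _))

/-- A word of length m + n is a prefix and a suffix; the defining double sum and the product over
positions factor accordingly. -/
theorem splits_tensorPow (Φ : SuperOp X Y) (m n : ℕ) :
    Splits (Fin.appendEquiv m n) (Fin.appendEquiv m n) (tensorPow Φ (m + n)) (tensorPow Φ m)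
      (tensorPow Φ n) := by
  refine superOp_ext_kronecker fun M N => ?_
  rw [LinearMap.comp_apply, LinearMap.comp_apply, tensorMap_kronecker]
  ext y y'
  rw [relabel_apply, Matrix.kronecker_apply]
  simp only [tensorPow, LinearMap.coe_mk, AddHom.coe_mk, Matrix.of_apply]
  rw [← (Fin.appendEquiv m n).sum_comp]
  simp_rw [← (Fin.appendEquiv (α := X) m n).sum_comp, relabel_apply, Equiv.symm_apply_apply,
    Fin.prod_univ_add, Fintype.sum_prod_type, Matrix.kronecker_apply, Finset.sum_mul_sum]
  refine Finset.sum_congr rfl fun a _ => ?_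
  refine Finset.sum_congr rfl fun b _ => ?_
  refine Finset.sum_congr rfl fun a' _ => ?_
  refine Finset.sum_congr rfl fun b' _ => ?_
  simp only [Fin.appendEquiv, Equiv.coe_fn_mk, Equiv.coe_fn_symm_mk, Fin.append_left,
    Fin.append_right]
  exact mul_mul_mul_comm _ _ _ _

theorem tensorPow_zero (Φ : SuperOp X Y) :
    tensorPow Φ 0 = relabel (Equiv.ofUnique (Fin 0 → X) (Fin 0 → Y)) := by
  ext1 M
  ext y y'
  rw [relabel_apply]
  simp only [tensorPow, LinearMap.coe_mk, AddHom.coe_mk, Matrix.of_apply, Finset.univ_unique,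
    Finset.sum_singleton, Fin.prod_univ_zero, mul_one]
  rfl

theorem tensorPow_one (Φ : SuperOp X Y) :
    tensorPow Φ 1 = relabel (Equiv.funUnique (Fin 1) Y).symm ∘ₗ Φ ∘ₗ
      relabel (Equiv.funUnique (Fin 1) X) := by
  refine superOp_ext_single fun i j => ?_
  ext y y'
  simp only [LinearMap.comp_apply]
  rw [relabel_apply]
  have : relabel (Equiv.funUnique (Fin 1) X) (Matrix.single i j (1 : ℂ))
      = Matrix.single (i 0) (j 0) 1 := by
    ext x x'
    simp only [relabel_apply, Matrix.single_apply, funext_iff, Fin.forall_fin_one]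
    rfl
  rw [this]
  simp only [tensorPow, LinearMap.coe_mk, AddHom.coe_mk, Matrix.of_apply, Matrix.single_apply]
  simp only [ite_and, ite_mul, one_mul, zero_mul, Finset.sum_ite_eq, Finset.mem_univ, if_true,
    Fin.prod_univ_one, Finset.sum_ite_irrel, Finset.sum_const_zero]
  rfl

/-- Complete positivity is not read off the defining sum: by induction the power is, up to
relabelling, a tensor product of two channels. -/
theorem IsChannel.tensorPow {Φ : SuperOp X Y} (hΦ : IsChannel Φ) (n : ℕ) :
    IsChannel (tensorPow Φ n) := by
  induction n with
  | zero => rw [tensorPow_zero]; exact isChannel_relabel _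
  | succ n ih =>
    rw [(splits_tensorPow Φ n 1).eq_joinMap]
    refine isChannel_joinMap _ _ ih ?_
    rw [tensorPow_one]
    exact (isChannel_relabel _).comp (hΦ.comp (isChannel_relabel _))

theorem opPow_add (ρ : Op X) (m n : ℕ) :
    opPow ρ (m + n) = relabel (Fin.appendEquiv m n) (opPow ρ m ⊗ₖ opPow ρ n) := by
  ext x x'
  rw [relabel_apply, Matrix.kronecker_apply]
  simp only [opPow, Matrix.of_apply, Fin.prod_univ_add]
  rfl

theorem opPow_one (ρ : Op X) : opPow ρ 1 = relabel (Equiv.funUnique (Fin 1) X).symm ρ := by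
  ext x x'
  simp only [opPow, Matrix.of_apply, Fin.prod_univ_one]
  rfl

theorem opPow_zero (ρ : Op X) : opPow ρ 0 = 1 := by
  ext x x'
  rw [Subsingleton.elim x x']
  simp [opPow]

theorem IsState.opPow {ρ : Op X} (hρ : IsState ρ) (n : ℕ) : IsState (opPow ρ n) := by
  induction n with
  | zero => rw [opPow_zero]; exact ⟨Matrix.PosSemidef.one, by simp⟩
  | succ n ih =>
    rw [opPow_add, opPow_one]
    exact (ih.kronecker (hρ.relabel _)).relabel _

theorem stateDiv_opPow {ρ σ : Op X} (hρ : IsState ρ) (hσ : IsState σ) (n : ℕ) :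
    stateDiv (opPow ρ n) (opPow σ n) = n * stateDiv ρ σ := by
  induction n with
  | zero =>
    rw [opPow_zero, opPow_zero]
    simp only [Nat.cast_zero, zero_mul]
    exact stateDiv_self ⟨Matrix.PosSemidef.one, by simp⟩
  | succ n ih =>
    have h1 := hρ.opPow n
    have h2 := hσ.opPow n
    have h3 := hρ.relabel (Equiv.funUnique (Fin 1) X).symm
    have h4 := hσ.relabel (Equiv.funUnique (Fin 1) X).symm
    rw [opPow_add, opPow_add, opPow_one, opPow_one,
      stateDiv_relabel (h1.1.kronecker h3.1) (h2.1.kronecker h4.1),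
      stateDiv_kronecker h1.1 h2.1 h3.1 h4.1, stateDiv_relabel hρ.1 hσ.1, ih, Nat.cast_succ,
      EReal.right_distrib_of_nonneg (by positivity) zero_le_one, one_mul]

end TensorMap

/-! ### Validity and tensor splitting of superchannel powers -/

section Superchannels

variable {C A B D S R R' : Type} [Fintype C] [DecidableEq C] [Fintype A] [DecidableEq A]
  [Fintype B] [DecidableEq B] [Fintype D] [DecidableEq D] [Fintype S] [DecidableEq S]
  [Fintype R] [DecidableEq R] [Fintype R'] [DecidableEq R']

theorem Superchannel.IsValid.applyEnc {Θ : Superchannel C A B D S} (hΘ : Θ.IsValid)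
    {N : SuperOp (A × R) (B × R')} (hN : IsChannel N) : IsChannel (Θ.applyEnc N) :=
  (hN.tensorId S).comp ((isChannel_relabel _).comp (hΘ.1.tensorId R))

theorem Superchannel.IsValid.apply {Θ : Superchannel C A B D S} (hΘ : Θ.IsValid)
    {N : SuperOp (A × R) (B × R')} (hN : IsChannel N) : IsChannel (Θ.apply N) :=
  (hΘ.2.tensorId R').comp ((isChannel_relabel _).comp (hΘ.applyEnc hN))

theorem Superchannel.IsValid.pow {Θ : Superchannel C A B D S} (hΘ : Θ.IsValid) (n : ℕ) :
    (Θ.pow n).IsValid :=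
  ⟨(isChannel_relabel _).comp (hΘ.1.tensorPow n), (hΘ.2.tensorPow n).comp (isChannel_relabel _)⟩

/-- Encoder, interchange of systems, inserted channel and decoder each split into an m-part and an
n-part, and splittings compose. Parallel strategies can therefore be tensored, which is the source
of superadditivity. -/
theorem Superchannel.splits_apply_pow (Θ : Superchannel C A B D S) (m n : ℕ)
    {R₁ R₂ R₁' R₂' : Type} [Fintype R₁] [DecidableEq R₁] [Fintype R₂] [DecidableEq R₂]
    [Fintype R₁'] [DecidableEq R₁'] [Fintype R₂'] [DecidableEq R₂'] (e : R₁ × R₂ ≃ R)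
    (e' : R₁' × R₂' ≃ R') {N : SuperOp ((Fin (m + n) → A) × R) ((Fin (m + n) → B) × R')}
    {N₁ : SuperOp ((Fin m → A) × R₁) ((Fin m → B) × R₁')}
    {N₂ : SuperOp ((Fin n → A) × R₂) ((Fin n → B) × R₂')}
    (hN : Splits (joinEquiv (Fin.appendEquiv m n) e) (joinEquiv (Fin.appendEquiv m n) e') N N₁ N₂) :
    Splits (joinEquiv (Fin.appendEquiv m n) e) (joinEquiv (Fin.appendEquiv m n) e')
      ((Θ.pow (m + n)).apply N) ((Θ.pow m).apply N₁) ((Θ.pow n).apply N₂) := by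
  have henc : Splits (Fin.appendEquiv m n) (joinEquiv (Fin.appendEquiv m n) (Fin.appendEquiv m n))
      (Θ.pow (m + n)).enc (Θ.pow m).enc (Θ.pow n).enc := by
    refine Splits.comp (splits_relabel ?_) (splits_tensorPow Θ.enc m n)
    rintro ⟨x, y⟩
    refine Prod.ext ?_ ?_ <;> ext i <;> refine Fin.addCases (fun i => ?_) (fun i => ?_) i <;>
      simp [joinEquiv, Fin.appendEquiv, Equiv.arrowProdEquivProdArrow]
  have hdec : Splits (joinEquiv (Fin.appendEquiv m n) (Fin.appendEquiv m n)) (Fin.appendEquiv m n)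
      (Θ.pow (m + n)).dec (Θ.pow m).dec (Θ.pow n).dec := by
    refine Splits.comp (splits_tensorPow Θ.dec m n) (splits_relabel ?_)
    rintro ⟨x, y⟩
    funext i
    refine Fin.addCases (fun i => ?_) (fun i => ?_) i <;>
      simp [joinEquiv, Fin.appendEquiv, Equiv.arrowProdEquivProdArrow]
  have hswap : Splits
      (joinEquiv (joinEquiv (Fin.appendEquiv m n) (Fin.appendEquiv m n)) e)
      (joinEquiv (joinEquiv (Fin.appendEquiv m n) e) (Fin.appendEquiv m n))
      (relabel (swapLast (Fin (m + n) → A) (Fin (m + n) → S) R))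
      (relabel (swapLast (Fin m → A) (Fin m → S) R₁))
      (relabel (swapLast (Fin n → A) (Fin n → S) R₂)) := splits_relabel fun _ => rfl
  have hswap' : Splits
      (joinEquiv (joinEquiv (Fin.appendEquiv m n) e') (Fin.appendEquiv m n))
      (joinEquiv (joinEquiv (Fin.appendEquiv m n) (Fin.appendEquiv m n)) e')
      (relabel (swapLast (Fin (m + n) → B) R' (Fin (m + n) → S)))
      (relabel (swapLast (Fin m → B) R₁' (Fin m → S)))
      (relabel (swapLast (Fin n → B) R₂' (Fin n → S))) := splits_relabel fun _ => rfl
  exact (hdec.tensorId e').comp (hswap'.comp ((hN.tensorId _).comp (hswap.comp (henc.tensorId e))))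

end Superchannels

/-! ### A Fekete lemma and telescoping in the extended reals -/

section ExtendedReals

open Filter Topology

/-- Division with remainder gives ⌊m/n⌋ a(n) ≤ a(m); now divide by m and use ⌊m/n⌋/m → 1/n. The
hypothesis is written with a quotient so that its right side is free of the strategy, and a supremum
a(n) can be bounded strategy by strategy. -/
theorem le_liminf_of_le_div {a : ℕ → EReal}
    (h : ∀ n k r : ℕ, 1 ≤ n → 1 ≤ k → a n ≤ a (k * n + r) / k) {n : ℕ} (hn : 1 ≤ n) :
    ((1 / (n : ℝ) : ℝ) : EReal) * a n
      ≤ liminf (fun m : ℕ => ((1 / (m : ℝ) : ℝ) : EReal) * a m) atTop := by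
  have hn0 : (0 : ℝ) < n := by exact_mod_cast hn
  have hdiv : ∀ m, n ≤ m → ((m / n : ℕ) : EReal) * a n ≤ a m := by
    intro m hm
    have hk : 1 ≤ m / n := (Nat.one_le_div_iff hn).2 hm
    have h1 := h n (m / n) (m % n) hn hk
    rw [Nat.div_add_mod'] at h1
    rw [mul_comm]
    exact (EReal.le_div_iff_mul_le (by exact_mod_cast hk) (EReal.natCast_ne_top _)).1 h1
  rcases eq_or_ne (a n) ⊥ with hbot | hbot
  · rw [hbot, EReal.coe_mul_bot_of_pos (by positivity)]
    exact bot_le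
  rcases eq_or_ne (a n) ⊤ with htop | htop
  · refine le_liminf_of_le (by isBoundedDefault) ?_
    filter_upwards [eventually_ge_atTop n] with m hm
    have hm0 : (0 : ℝ) < m := by exact_mod_cast hn.trans hm
    have h1 := hdiv m hm
    have hk : 1 ≤ m / n := (Nat.one_le_div_iff hn).2 hm
    rw [htop, EReal.mul_top_of_pos (by exact_mod_cast hk), top_le_iff] at h1
    rw [h1, EReal.coe_mul_top_of_pos (by positivity)]
    exact le_top
  · lift a n to ℝ using ⟨htop, hbot⟩ with x hx
    have hlim : Tendsto (fun m : ℕ => (((m / n : ℕ) : ℝ) / m * x : ℝ)) atTop (𝓝 (1 / n * x)) := by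
      have h1 := (tendsto_nat_floor_mul_div_atTop (R := ℝ) (a := 1 / n) (by positivity)).comp
        tendsto_natCast_atTop_atTop
      refine (h1.mul_const x).congr fun m => ?_
      simp only [Function.comp_apply]
      rw [one_div_mul_eq_div, Nat.floor_div_eq_div]
    have hlim' := ((continuous_coe_real_ereal.tendsto _).comp hlim).liminf_eq
    rw [← EReal.coe_mul, ← hlim']
    refine liminf_le_liminf ?_ (by isBoundedDefault) (by isBoundedDefault)
    filter_upwards [eventually_ge_atTop n] with m hm
    have h1 := hdiv m hm
    refine le_trans (le_of_eq ?_) (mul_le_mul_of_nonneg_left h1 (EReal.coe_nonneg.2 (by positivity)))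
    simp only [Function.comp_apply]
    rw [← EReal.coe_natCast, ← EReal.coe_mul, ← EReal.coe_mul]
    congr 1
    ring

/-- Each term with n ≥ 1 lies below the lower limit, hence so does the upper limit. -/
theorem tendsto_liminf_of_le_div {a : ℕ → EReal}
    (h : ∀ n k r : ℕ, 1 ≤ n → 1 ≤ k → a n ≤ a (k * n + r) / k) :
    Tendsto (fun m : ℕ => ((1 / (m : ℝ) : ℝ) : EReal) * a m) atTop
      (𝓝 (liminf (fun m : ℕ => ((1 / (m : ℝ) : ℝ) : EReal) * a m) atTop)) := by
  refine tendsto_of_le_liminf_of_limsup_le le_rfl ?_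
  refine limsup_le_of_le (by isBoundedDefault) ?_
  filter_upwards [eventually_ge_atTop 1] with n hn
  exact le_liminf_of_le_div h hn

/-- Superadditivity is used for individual values rather than suprema, so no supremum of a sum is
needed. The r leftover uses contribute some nonnegative value. -/
theorem exists_mul_le_of_superadditive {V : ℕ → Set EReal} (h0 : ∀ n, ∀ v ∈ V n, 0 ≤ v)
    (hadd : ∀ m n, ∀ v ∈ V m, ∀ w ∈ V n, ∃ u ∈ V (m + n), v + w ≤ u)
    (hne : ∀ n, (V n).Nonempty) (n r : ℕ) {v : EReal} (hv : v ∈ V n) (k : ℕ) :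
    ∃ u ∈ V (k * n + r), (k : EReal) * v ≤ u := by
  induction k with
  | zero =>
    obtain ⟨u, hu⟩ := hne (0 * n + r)
    refine ⟨u, hu, ?_⟩
    rw [Nat.cast_zero, zero_mul]
    exact h0 _ _ hu
  | succ k ih =>
    obtain ⟨u, hu, hku⟩ := ih
    obtain ⟨w, hw, huw⟩ := hadd _ _ u hu v hv
    have e : k * n + r + n = (k + 1) * n + r := by ring
    refine ⟨w, e ▸ hw, ?_⟩
    rw [Nat.cast_succ, EReal.right_distrib_of_nonneg (by positivity) zero_le_one, one_mul]
    exact (add_le_add_left hku v).trans huw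

theorem le_div_of_superadditive {V : ℕ → Set EReal} {a : ℕ → EReal} (h0 : ∀ n, ∀ v ∈ V n, 0 ≤ v)
    (hadd : ∀ m n, ∀ v ∈ V m, ∀ w ∈ V n, ∃ u ∈ V (m + n), v + w ≤ u)
    (hne : ∀ n, (V n).Nonempty) (ha : ∀ n, ∀ v ∈ V n, v ≤ a n) {n : ℕ} {v : EReal} (hv : v ∈ V n)
    {k : ℕ} (hk : 1 ≤ k) (r : ℕ) : v ≤ a (k * n + r) / k := by
  obtain ⟨u, hu, hku⟩ := exists_mul_le_of_superadditive h0 hadd hne n r hv k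
  rw [EReal.le_div_iff_mul_le (by exact_mod_cast hk) (EReal.natCast_ne_top _), mul_comm]
  exact hku.trans (ha _ _ hu)

/-- One step of telescoping. The amortized inequality is known only when the earlier divergence d is
finite: if δ = ⊤ the conclusion is trivial, and otherwise d ≤ kδ forces finiteness. -/
theorem le_succ_mul_of_amortized {δ d d' : EReal} {k : ℕ} (hδ : 0 ≤ δ) (h : d ≠ ⊤ → d' ≤ δ + d)
    (hd : d ≤ k * δ) : d' ≤ ((k + 1 : ℕ) : EReal) * δ := by
  rcases eq_or_ne δ ⊤ with rfl | htop
  · rw [EReal.mul_top_of_pos (by exact_mod_cast Nat.succ_pos k)]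
    exact le_top
  · have hk : (k : EReal) * δ ≠ ⊤ := by
      lift δ to ℝ using ⟨htop, (EReal.bot_lt_zero.trans_le hδ).ne'⟩
      rw [← EReal.coe_natCast, ← EReal.coe_mul]
      exact EReal.coe_ne_top _
    have hd' : d ≠ ⊤ := fun e => hk (top_le_iff.1 (e ▸ hd))
    rw [Nat.cast_succ, EReal.right_distrib_of_nonneg (by positivity) zero_le_one, one_mul, add_comm]
    exact (h hd').trans (add_le_add_right hd δ)

theorem one_div_mul_le_of_le_mul {n : ℕ} (hn : 1 ≤ n) {d δ : EReal} (h : d ≤ n * δ) :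
    ((1 / (n : ℝ) : ℝ) : EReal) * d ≤ δ := by
  have hn0 : (n : ℝ) ≠ 0 := by positivity
  refine (mul_le_mul_of_nonneg_left h (EReal.coe_nonneg.2 (by positivity))).trans (le_of_eq ?_)
  rw [← mul_assoc, ← EReal.coe_natCast, ← EReal.coe_mul, one_div_mul_cancel hn0, EReal.coe_one,
    one_mul]

end ExtendedReals

/-! ### Amortized channel divergence, successive uses and parallel uses -/

section ChannelDivergence

variable {W X Y Z : Type} [Fintype W] [DecidableEq W] [Fintype X] [DecidableEq X] [Fintype Y]
  [DecidableEq Y] [Fintype Z] [DecidableEq Z]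

theorem isState_one_unit : IsState (1 : Op Unit) := ⟨Matrix.PosSemidef.one, by simp⟩

theorem exists_isState (X : Type) [Fintype X] [DecidableEq X] [Nonempty X] :
    ∃ ρ : Op X, IsState ρ :=
  ⟨_, isState_single (Classical.arbitrary X)⟩

theorem stateDiv_tensorId_le_chanDivA_add (Φ Ψ : SuperOp X Y) {R : Type} [Fintype R]
    [DecidableEq R] {ρ τ : Op (X × R)} (hρ : IsState ρ) (hτ : IsState τ)
    (hfin : stateDiv ρ τ ≠ ⊤) :
    stateDiv (tensorId Φ R ρ) (tensorId Ψ R τ) ≤ chanDivA Φ Ψ + stateDiv ρ τ := by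
  have hbot : stateDiv ρ τ ≠ ⊥ := (EReal.bot_lt_zero.trans_le (stateDiv_nonneg hρ hτ)).ne'
  rw [← EReal.sub_le_iff_le_add (Or.inl hbot) (Or.inl hfin)]
  exact le_iSup_of_le R <| le_iSup_of_le inferInstance <| le_iSup_of_le inferInstance <| le_iSup_of_le ρ <|
    le_iSup_of_le τ <| le_iSup_of_le hρ <| le_iSup_of_le hτ <| le_iSup_of_le hfin le_rfl

theorem stateDiv_kronecker_one {ρ τ : Op X} (hρ : ρ.PosSemidef) (hτ : τ.PosSemidef) :
    stateDiv (ρ ⊗ₖ (1 : Op Unit)) (τ ⊗ₖ (1 : Op Unit)) = stateDiv ρ τ := by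
  rw [stateDiv_kronecker hρ hτ isState_one_unit.1 isState_one_unit.1,
    stateDiv_self isState_one_unit, add_zero]

theorem stateDiv_map_le_chanDivA_add {Φ Ψ : SuperOp X Y} (hΦ : IsChannel Φ) (hΨ : IsChannel Ψ)
    {ρ τ : Op X} (hρ : IsState ρ) (hτ : IsState τ) (hfin : stateDiv ρ τ ≠ ⊤) :
    stateDiv (Φ ρ) (Ψ τ) ≤ chanDivA Φ Ψ + stateDiv ρ τ := by
  rw [← stateDiv_kronecker_one hρ.1 hτ.1] at hfin ⊢
  rw [← stateDiv_kronecker_one (hΦ.posSemidef hρ.1) (hΨ.posSemidef hτ.1), ← tensorId_kronecker,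
    ← tensorId_kronecker]
  exact stateDiv_tensorId_le_chanDivA_add Φ Ψ (hρ.kronecker isState_one_unit)
    (hτ.kronecker isState_one_unit) hfin

theorem stateDiv_map_le_chanDivA {Φ Ψ : SuperOp X Y} (hΦ : IsChannel Φ) (hΨ : IsChannel Ψ)
    {ρ : Op X} (hρ : IsState ρ) : stateDiv (Φ ρ) (Ψ ρ) ≤ chanDivA Φ Ψ := by
  have := stateDiv_map_le_chanDivA_add hΦ hΨ hρ hρ
  simpa [stateDiv_self hρ] using this

theorem chanDivA_nonneg [Nonempty X] {Φ Ψ : SuperOp X Y} (hΦ : IsChannel Φ)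
    (hΨ : IsChannel Ψ) : 0 ≤ chanDivA Φ Ψ := by
  obtain ⟨ρ, hρ⟩ := exists_isState X
  exact (stateDiv_nonneg (hΦ.map_isState hρ) (hΨ.map_isState hρ)).trans
    (stateDiv_map_le_chanDivA hΦ hΨ hρ)

theorem chanDivA_le {Φ Ψ : SuperOp X Y} {c : EReal}
    (h : ∀ (R : Type) [Fintype R] [DecidableEq R] (ρ τ : Op (X × R)), IsState ρ → IsState τ →
      stateDiv ρ τ ≠ ⊤ → stateDiv (tensorId Φ R ρ) (tensorId Ψ R τ) - stateDiv ρ τ ≤ c) :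
    chanDivA Φ Ψ ≤ c :=
  iSup_le fun R => iSup_le fun _ => iSup_le fun _ => iSup_le fun ρ => iSup_le fun τ =>
    iSup_le fun hρ => iSup_le fun hτ => iSup_le fun hfin => h R ρ τ hρ hτ hfin

theorem chanDivA_self_le {Φ : SuperOp X Y} (hΦ : IsChannel Φ) : chanDivA Φ Φ ≤ 0 :=
  chanDivA_le fun R _ _ ρ τ hρ hτ _ => EReal.sub_le_of_le_add <| by
    rw [zero_add]; exact stateDiv_map_le hρ.1 hτ.1 (hΦ.tensorId R)

/-- Data processing twice: `post` lowers the output divergence, and `pre` lowers the input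
divergence that is subtracted in the bound for N and M, keeping it finite. -/
theorem chanDivA_comp_le {pre : SuperOp W X} {N M : SuperOp X Y} {post : SuperOp Y Z}
    (hpre : IsChannel pre) (hN : IsChannel N) (hM : IsChannel M) (hpost : IsChannel post) :
    chanDivA (post ∘ₗ N ∘ₗ pre) (post ∘ₗ M ∘ₗ pre) ≤ chanDivA N M := by
  refine chanDivA_le fun R _ _ ρ τ hρ hτ hfin => ?_
  have hρ' := (hpre.tensorId R).map_isState hρ
  have hτ' := (hpre.tensorId R).map_isState hτ
  have h1 := stateDiv_map_le hρ.1 hτ.1 (hpre.tensorId R)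
  have h2 := stateDiv_map_le ((hN.tensorId R).map_isState hρ').1
    ((hM.tensorId R).map_isState hτ').1 (hpost.tensorId R)
  refine (EReal.sub_le_sub h2 h1).trans (EReal.sub_le_of_le_add ?_)
  exact stateDiv_tensorId_le_chanDivA_add N M hρ' hτ' (ne_top_of_le_ne_top hfin h1)

theorem seqOutput_isState {M : Type} [Fintype M] [DecidableEq M] {Φ : SuperOp X Y}
    (hΦ : IsChannel Φ) {ρ : Op (X × M)} (hρ : IsState ρ) {𝒜 : ℕ → SuperOp (Y × M) (X × M)}
    (h𝒜 : ∀ k, IsChannel (𝒜 k)) (k : ℕ) : IsState (seqOutput Φ ρ 𝒜 k) := by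
  induction k with
  | zero => exact (hΦ.tensorId M).map_isState hρ
  | succ k ih => exact (hΦ.tensorId M).map_isState ((h𝒜 k).map_isState ih)

/-- Telescoping from divergence 0 at the common input: each use adds at most the amortized
divergence and the channels in between add nothing. -/
theorem stateDiv_seqOutput_le {M : Type} [Fintype M] [DecidableEq M] {Φ Ψ : SuperOp X Y}
    (hΦ : IsChannel Φ) (hΨ : IsChannel Ψ) {ρ : Op (X × M)} (hρ : IsState ρ)
    {𝒜 : ℕ → SuperOp (Y × M) (X × M)} (h𝒜 : ∀ k, IsChannel (𝒜 k)) (k : ℕ) :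
    stateDiv (seqOutput Φ ρ 𝒜 k) (seqOutput Ψ ρ 𝒜 k)
      ≤ ((k + 1 : ℕ) : EReal) * chanDivA Φ Ψ := by
  have : Nonempty X := hρ.nonempty.map Prod.fst
  have h0 := chanDivA_nonneg hΦ hΨ
  induction k with
  | zero =>
    refine le_succ_mul_of_amortized h0 (stateDiv_tensorId_le_chanDivA_add Φ Ψ hρ hρ) ?_
    rw [stateDiv_self hρ, Nat.cast_zero, zero_mul]
  | succ k ih =>
    have h1 := seqOutput_isState hΦ hρ h𝒜 k
    have h2 := seqOutput_isState hΨ hρ h𝒜 k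
    exact le_succ_mul_of_amortized h0
      (stateDiv_tensorId_le_chanDivA_add Φ Ψ ((h𝒜 k).map_isState h1) ((h𝒜 k).map_isState h2))
      ((stateDiv_map_le h1.1 h2.1 (h𝒜 k)).trans ih)

theorem le_chanDiv (Φ Ψ : SuperOp X Y) {R : Type} [Fintype R] [DecidableEq R] {ρ : Op (X × R)}
    (hρ : IsState ρ) : stateDiv (tensorId Φ R ρ) (tensorId Ψ R ρ) ≤ chanDiv Φ Ψ :=
  le_iSup_of_le R <| le_iSup_of_le inferInstance <| le_iSup_of_le inferInstance <| le_iSup_of_le ρ <|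
    le_iSup_of_le hρ le_rfl

/-- Values of the divergence between outputs of `n` parallel uses of two channels. -/
def parallelValues (Φ Ψ : SuperOp X Y) (n : ℕ) : Set EReal :=
  {v | ∃ (E : Type) (_ : Fintype E) (_ : DecidableEq E) (ρ : Op ((Fin n → X) × E)),
    IsState ρ ∧ v = stateDiv (tensorId (tensorPow Φ n) E ρ) (tensorId (tensorPow Ψ n) E ρ)}

/-- Additivity of the divergence on a product strategy. -/
theorem stateDiv_splits {X₁ X₂ Y₁ Y₂ : Type} [Fintype X₁] [DecidableEq X₁] [Fintype X₂]
    [DecidableEq X₂] [Fintype Y₁] [DecidableEq Y₁] [Fintype Y₂] [DecidableEq Y₂]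
    {j : X₁ × X₂ ≃ X} {j' : Y₁ × Y₂ ≃ Y} {Φ Ψ : SuperOp X Y} {Φ₁ Ψ₁ : SuperOp X₁ Y₁}
    {Φ₂ Ψ₂ : SuperOp X₂ Y₂} (hΦ : Splits j j' Φ Φ₁ Φ₂) (hΨ : Splits j j' Ψ Ψ₁ Ψ₂)
    (hΦ₁ : IsChannel Φ₁) (hΦ₂ : IsChannel Φ₂) (hΨ₁ : IsChannel Ψ₁) (hΨ₂ : IsChannel Ψ₂)
    {ρ₁ : Op X₁} {ρ₂ : Op X₂} (hρ₁ : IsState ρ₁) (hρ₂ : IsState ρ₂) :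
    stateDiv (Φ (relabel j (ρ₁ ⊗ₖ ρ₂))) (Ψ (relabel j (ρ₁ ⊗ₖ ρ₂)))
      = stateDiv (Φ₁ ρ₁) (Ψ₁ ρ₁) + stateDiv (Φ₂ ρ₂) (Ψ₂ ρ₂) := by
  have h1 := hΦ₁.posSemidef hρ₁.1
  have h2 := hΦ₂.posSemidef hρ₂.1
  have h3 := hΨ₁.posSemidef hρ₁.1
  have h4 := hΨ₂.posSemidef hρ₂.1
  rw [hΦ.apply_kronecker, hΨ.apply_kronecker, stateDiv_relabel (h1.kronecker h2) (h3.kronecker h4),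
    stateDiv_kronecker h1 h3 h2 h4]

theorem parallelValues_le_div [Nonempty X] {Φ Ψ : SuperOp X Y} (hΦ : IsChannel Φ)
    (hΨ : IsChannel Ψ) {a : ℕ → EReal} (ha : ∀ n, ∀ v ∈ parallelValues Φ Ψ n, v ≤ a n) {n : ℕ}
    {v : EReal} (hv : v ∈ parallelValues Φ Ψ n) {k : ℕ} (hk : 1 ≤ k) (r : ℕ) :
    v ≤ a (k * n + r) / k := by
  refine le_div_of_superadditive ?_ ?_ ?_ ha hv hk r
  · rintro n _ ⟨E, _, _, ρ, hρ, rfl⟩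
    exact stateDiv_nonneg (((hΦ.tensorPow n).tensorId E).map_isState hρ)
      (((hΨ.tensorPow n).tensorId E).map_isState hρ)
  · rintro m n _ ⟨E₁, _, _, ρ₁, hρ₁, rfl⟩ _ ⟨E₂, _, _, ρ₂, hρ₂, rfl⟩
    refine ⟨_, ⟨E₁ × E₂, inferInstance, inferInstance, relabel (joinEquiv (Fin.appendEquiv m n)
      (Equiv.refl _)) (ρ₁ ⊗ₖ ρ₂), (hρ₁.kronecker hρ₂).relabel _, rfl⟩, le_of_eq ?_⟩
    exact (stateDiv_splits ((splits_tensorPow Φ m n).tensorId _)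
      ((splits_tensorPow Ψ m n).tensorId _) ((hΦ.tensorPow m).tensorId _)
      ((hΦ.tensorPow n).tensorId _) ((hΨ.tensorPow m).tensorId _)
      ((hΨ.tensorPow n).tensorId _) hρ₁ hρ₂).symm
  · intro n
    obtain ⟨ρ, hρ⟩ := exists_isState ((Fin n → X) × Unit)
    exact ⟨_, Unit, inferInstance, inferInstance, ρ, hρ, rfl⟩

end ChannelDivergence

/-! ### Superadditivity of the three regularized quantities -/

section Regularization

variable {C A B D S₁ S₂ : Type} [Fintype C] [DecidableEq C] [Fintype A] [DecidableEq A]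
  [Fintype B] [DecidableEq B] [Fintype D] [DecidableEq D] [Fintype S₁] [DecidableEq S₁]
  [Fintype S₂] [DecidableEq S₂]

/-- `sup_N D(Θ₁(N)^{⊗n}‖Θ₂(N)^{⊗n})`. -/
noncomputable def productChannelDiv (Θ₁ : Superchannel C A B D S₁) (Θ₂ : Superchannel C A B D S₂)
    (n : ℕ) : EReal :=
  ⨆ (R : Type) (_ : Fintype R) (_ : DecidableEq R) (R' : Type) (_ : Fintype R')
    (_ : DecidableEq R') (N : SuperOp (A × R) (B × R')) (_ : IsChannel N),
    chanDiv (tensorPow (Θ₁.apply N) n) (tensorPow (Θ₂.apply N) n)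

/-- `sup_{ρ,N} D(Θ₁^{⊗n}(N)(ρ^{⊗n}) ‖ Θ₂^{⊗n}(N)(ρ^{⊗n}))`. -/
noncomputable def productStateDiv (Θ₁ : Superchannel C A B D S₁) (Θ₂ : Superchannel C A B D S₂)
    (n : ℕ) : EReal :=
  ⨆ (R : Type) (_ : Fintype R) (_ : DecidableEq R) (R' : Type) (_ : Fintype R')
    (_ : DecidableEq R') (N : SuperOp ((Fin n → A) × (Fin n → R)) ((Fin n → B) × R'))
    (_ : IsChannel N) (ρ : Op (C × R)) (_ : IsState ρ),
    stateDiv (productStateOutput Θ₁ n N ρ) (productStateOutput Θ₂ n N ρ)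

theorem le_productChannelDiv (Θ₁ : Superchannel C A B D S₁) (Θ₂ : Superchannel C A B D S₂)
    (n : ℕ) {R R' E : Type} [Fintype R] [DecidableEq R] [Fintype R'] [DecidableEq R'] [Fintype E]
    [DecidableEq E] {N : SuperOp (A × R) (B × R')} (hN : IsChannel N)
    {ρ : Op ((Fin n → C × R) × E)} (hρ : IsState ρ) :
    stateDiv (tensorId (tensorPow (Θ₁.apply N) n) E ρ) (tensorId (tensorPow (Θ₂.apply N) n) E ρ)
      ≤ productChannelDiv Θ₁ Θ₂ n :=
  (le_chanDiv _ _ hρ).trans <| le_iSup_of_le R <| le_iSup_of_le inferInstance <| le_iSup_of_le inferInstance <|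
    le_iSup_of_le R' <| le_iSup_of_le inferInstance <| le_iSup_of_le inferInstance <| le_iSup_of_le N <|
    le_iSup_of_le hN le_rfl

theorem le_productStateDiv (Θ₁ : Superchannel C A B D S₁) (Θ₂ : Superchannel C A B D S₂)
    (n : ℕ) {R R' : Type} [Fintype R] [DecidableEq R] [Fintype R'] [DecidableEq R']
    {N : SuperOp ((Fin n → A) × (Fin n → R)) ((Fin n → B) × R')} (hN : IsChannel N)
    {ρ : Op (C × R)} (hρ : IsState ρ) :
    stateDiv (productStateOutput Θ₁ n N ρ) (productStateOutput Θ₂ n N ρ)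
      ≤ productStateDiv Θ₁ Θ₂ n :=
  le_iSup_of_le R <| le_iSup_of_le inferInstance <| le_iSup_of_le inferInstance <| le_iSup_of_le R' <| le_iSup_of_le inferInstance <|
    le_iSup_of_le inferInstance <| le_iSup_of_le N <| le_iSup_of_le hN <| le_iSup_of_le ρ <|
    le_iSup_of_le hρ le_rfl

theorem le_superDiv (Θ₁ : Superchannel C A B D S₁) (Θ₂ : Superchannel C A B D S₂)
    {R R' : Type} [Fintype R] [DecidableEq R] [Fintype R'] [DecidableEq R']
    {N : SuperOp (A × R) (B × R')} (hN : IsChannel N) {ρ : Op (C × R)} (hρ : IsState ρ) :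
    stateDiv (Θ₁.apply N ρ) (Θ₂.apply N ρ) ≤ superDiv Θ₁ Θ₂ :=
  le_iSup_of_le R <| le_iSup_of_le inferInstance <| le_iSup_of_le inferInstance <| le_iSup_of_le R' <| le_iSup_of_le inferInstance <|
    le_iSup_of_le inferInstance <| le_iSup_of_le N <| le_iSup_of_le hN <| le_iSup_of_le ρ <|
    le_iSup_of_le hρ le_rfl

variable {Θ₁ : Superchannel C A B D S₁} {Θ₂ : Superchannel C A B D S₂}

theorem productChannelDiv_le_div (hΘ₁ : Θ₁.IsValid) (hΘ₂ : Θ₂.IsValid) (n k r : ℕ) (hn : 1 ≤ n)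
    (hk : 1 ≤ k) : productChannelDiv Θ₁ Θ₂ n ≤ productChannelDiv Θ₁ Θ₂ (k * n + r) / k := by
  refine iSup_le fun R => iSup_le fun _ => iSup_le fun _ => iSup_le fun R' => iSup_le fun _ =>
    iSup_le fun _ => iSup_le fun N => iSup_le fun hN => iSup_le fun E => iSup_le fun _ =>
    iSup_le fun _ => iSup_le fun ρ => iSup_le fun hρ => ?_
  -- The input state gives a nonempty index set, and n ≥ 1 supplies a coordinate to read a point
  -- from. For n = 0 the empty power carries a state in any case.
  have : Nonempty (C × R) := hρ.nonempty.map fun x => x.1 ⟨0, hn⟩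
  refine parallelValues_le_div (hΘ₁.apply hN) (hΘ₂.apply hN) ?_
    ⟨E, inferInstance, inferInstance, ρ, hρ, rfl⟩ hk r
  rintro m _ ⟨E, _, _, ρ, hρ, rfl⟩
  exact le_productChannelDiv Θ₁ Θ₂ m hN hρ

theorem productStateOutput_isState {S : Type} [Fintype S] [DecidableEq S]
    {Θ : Superchannel C A B D S} (hΘ : Θ.IsValid) (n : ℕ) {R R' : Type} [Fintype R]
    [DecidableEq R] [Fintype R'] [DecidableEq R']
    {N : SuperOp ((Fin n → A) × (Fin n → R)) ((Fin n → B) × R')} (hN : IsChannel N)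
    {ρ : Op (C × R)} (hρ : IsState ρ) : IsState (productStateOutput Θ n N ρ) :=
  ((hΘ.pow n).apply hN).map_isState ((hρ.opPow n).relabel _)

theorem opPow_relabel_add {X R : Type} [Fintype X] [DecidableEq X] [Fintype R] [DecidableEq R]
    (ρ : Op (X × R)) (m n : ℕ) :
    relabel (Equiv.arrowProdEquivProdArrow (Fin (m + n)) (fun _ => X) (fun _ => R))
        (opPow ρ (m + n))
      = relabel (joinEquiv (Fin.appendEquiv m n) (Fin.appendEquiv m n))
        (relabel (Equiv.arrowProdEquivProdArrow (Fin m) (fun _ => X) (fun _ => R)) (opPow ρ m) ⊗ₖ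
          relabel (Equiv.arrowProdEquivProdArrow (Fin n) (fun _ => X) (fun _ => R))
            (opPow ρ n)) := by
  ext x x'
  simp only [relabel_apply, opPow, Matrix.of_apply, Fin.prod_univ_add]
  rfl

theorem productStateDiv_le_div [Nonempty B] (hΘ₁ : Θ₁.IsValid) (hΘ₂ : Θ₂.IsValid) (n k r : ℕ)
    (hk : 1 ≤ k) : productStateDiv Θ₁ Θ₂ n ≤ productStateDiv Θ₁ Θ₂ (k * n + r) / k := by
  refine iSup_le fun R => iSup_le fun _ => iSup_le fun _ => iSup_le fun R' => iSup_le fun _ =>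
    iSup_le fun _ => iSup_le fun N => iSup_le fun hN => iSup_le fun ρ => iSup_le fun hρ => ?_
  -- The state ρ stays fixed while the joint channel varies: only then is the tensor product of the
  -- two inputs again a power of one state.
  refine le_div_of_superadditive (V := fun n => {v | ∃ (R' : Type) (_ : Fintype R')
    (_ : DecidableEq R') (N : SuperOp ((Fin n → A) × (Fin n → R)) ((Fin n → B) × R')),
      IsChannel N ∧ v = stateDiv (productStateOutput Θ₁ n N ρ) (productStateOutput Θ₂ n N ρ)})
    ?_ ?_ ?_ ?_ ⟨R', inferInstance, inferInstance, N, hN, rfl⟩ hk r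
  · rintro n _ ⟨R', _, _, N, hN, rfl⟩
    exact stateDiv_nonneg (productStateOutput_isState hΘ₁ n hN hρ)
      (productStateOutput_isState hΘ₂ n hN hρ)
  · rintro m n _ ⟨R₁, _, _, N₁, hN₁, rfl⟩ _ ⟨R₂, _, _, N₂, hN₂, rfl⟩
    refine ⟨_, ⟨R₁ × R₂, inferInstance, inferInstance,
      joinMap (joinEquiv (Fin.appendEquiv m n) (Fin.appendEquiv m n))
        (joinEquiv (Fin.appendEquiv m n) (Equiv.refl _)) N₁ N₂,
      isChannel_joinMap _ _ hN₁ hN₂, rfl⟩, le_of_eq ?_⟩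
    simp only [productStateOutput]
    rw [opPow_relabel_add]
    exact (stateDiv_splits (Θ₁.splits_apply_pow m n _ _ (splits_joinMap _ _ _ _))
      (Θ₂.splits_apply_pow m n _ _ (splits_joinMap _ _ _ _)) ((hΘ₁.pow m).apply hN₁)
      ((hΘ₁.pow n).apply hN₂) ((hΘ₂.pow m).apply hN₁) ((hΘ₂.pow n).apply hN₂)
      ((hρ.opPow m).relabel _) ((hρ.opPow n).relabel _)).symm
  · intro n
    -- A constant channel shows that some value exists for every number of uses; this fills the r
    -- leftover uses.
    obtain ⟨τ, hτ⟩ := exists_isState ((Fin n → B) × Unit)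
    exact ⟨_, Unit, inferInstance, inferInstance, replacement _ τ, isChannel_replacement hτ, rfl⟩
  · rintro m _ ⟨R', _, _, N, hN, rfl⟩
    exact le_productStateDiv Θ₁ Θ₂ m hN hρ

theorem superDiv_pow_le_div [Nonempty B] [Nonempty C] (hΘ₁ : Θ₁.IsValid) (hΘ₂ : Θ₂.IsValid)
    (n k r : ℕ) (hk : 1 ≤ k) :
    superDiv (Θ₁.pow n) (Θ₂.pow n)
      ≤ superDiv (Θ₁.pow (k * n + r)) (Θ₂.pow (k * n + r)) / k := by
  refine iSup_le fun R => iSup_le fun _ => iSup_le fun _ => iSup_le fun R' => iSup_le fun _ =>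
    iSup_le fun _ => iSup_le fun N => iSup_le fun hN => iSup_le fun ρ => iSup_le fun hρ => ?_
  refine le_div_of_superadditive (V := fun n => {v | ∃ (R : Type) (_ : Fintype R)
    (_ : DecidableEq R) (R' : Type) (_ : Fintype R') (_ : DecidableEq R')
    (N : SuperOp ((Fin n → A) × R) ((Fin n → B) × R')) (ρ : Op ((Fin n → C) × R)),
      IsChannel N ∧ IsState ρ ∧ v = stateDiv ((Θ₁.pow n).apply N ρ) ((Θ₂.pow n).apply N ρ)})
    (a := fun n => superDiv (Θ₁.pow n) (Θ₂.pow n)) ?_ ?_ ?_ ?_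
    ⟨R, inferInstance, inferInstance, R', inferInstance, inferInstance, N, ρ, hN, hρ, rfl⟩ hk r
  · rintro n _ ⟨R, _, _, R', _, _, N, ρ, hN, hρ, rfl⟩
    exact stateDiv_nonneg (((hΘ₁.pow n).apply hN).map_isState hρ)
      (((hΘ₂.pow n).apply hN).map_isState hρ)
  · rintro m n _ ⟨R₁, _, _, R₁', _, _, N₁, ρ₁, hN₁, hρ₁, rfl⟩ _
      ⟨R₂, _, _, R₂', _, _, N₂, ρ₂, hN₂, hρ₂, rfl⟩
    refine ⟨_, ⟨R₁ × R₂, inferInstance, inferInstance, R₁' × R₂', inferInstance, inferInstance,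
      joinMap (joinEquiv (Fin.appendEquiv m n) (Equiv.refl _))
        (joinEquiv (Fin.appendEquiv m n) (Equiv.refl _)) N₁ N₂,
      relabel (joinEquiv (Fin.appendEquiv m n) (Equiv.refl _)) (ρ₁ ⊗ₖ ρ₂),
      isChannel_joinMap _ _ hN₁ hN₂, (hρ₁.kronecker hρ₂).relabel _, rfl⟩, le_of_eq ?_⟩
    exact (stateDiv_splits (Θ₁.splits_apply_pow m n _ _ (splits_joinMap _ _ _ _))
      (Θ₂.splits_apply_pow m n _ _ (splits_joinMap _ _ _ _)) ((hΘ₁.pow m).apply hN₁)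
      ((hΘ₁.pow n).apply hN₂) ((hΘ₂.pow m).apply hN₁) ((hΘ₂.pow n).apply hN₂) hρ₁ hρ₂).symm
  · intro n
    obtain ⟨τ, hτ⟩ := exists_isState ((Fin n → B) × Unit)
    obtain ⟨ρ, hρ⟩ := exists_isState ((Fin n → C) × Unit)
    exact ⟨_, Unit, inferInstance, inferInstance, Unit, inferInstance, inferInstance,
      replacement _ τ, ρ, isChannel_replacement hτ, hρ, rfl⟩
  · rintro m _ ⟨R, _, _, R', _, _, N, ρ, hN, hρ, rfl⟩
    exact le_superDiv _ _ hN hρ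

end Regularization

/-! ### Nested strategies: telescoping over channels -/

section Nested

variable {C A B D S₁ S₂ : Type} [Fintype C] [DecidableEq C] [Fintype A] [DecidableEq A]
  [Fintype B] [DecidableEq B] [Fintype D] [DecidableEq D] [Fintype S₁] [DecidableEq S₁]
  [Fintype S₂] [DecidableEq S₂] {Θ₁ : Superchannel C A B D S₁} {Θ₂ : Superchannel C A B D S₂}
  {R : Type} [Fintype R] [DecidableEq R] {mid : SuperOp (A × R) (B × R)}
  {pre : ℕ → SuperOp (A × R) (C × R)} {post : ℕ → SuperOp (D × R) (B × R)}

theorem Superchannel.IsValid.nested (hΘ₁ : Θ₁.IsValid) (hmid : IsChannel mid)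
    (hpre : ∀ k, IsChannel (pre k)) (hpost : ∀ k, IsChannel (post k)) (k : ℕ) :
    IsChannel (Θ₁.nested mid pre post k) := by
  induction k with
  | zero => exact hΘ₁.apply hmid
  | succ k ih => exact hΘ₁.apply ((hpost k).comp (ih.comp (hpre k)))

theorem chanDivA_apply_le_superDivA_add (Θ₁ : Superchannel C A B D S₁)
    (Θ₂ : Superchannel C A B D S₂) {R' : Type} [Fintype R'] [DecidableEq R'] [Nonempty (A × R)]
    {N M : SuperOp (A × R) (B × R')} (hN : IsChannel N) (hM : IsChannel M)
    (hfin : chanDivA N M ≠ ⊤) :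
    chanDivA (Θ₁.apply N) (Θ₂.apply M) ≤ superDivA Θ₁ Θ₂ + chanDivA N M := by
  have hbot : chanDivA N M ≠ ⊥ := (EReal.bot_lt_zero.trans_le (chanDivA_nonneg hN hM)).ne'
  rw [← EReal.sub_le_iff_le_add (Or.inl hbot) (Or.inl hfin)]
  exact le_iSup_of_le R <| le_iSup_of_le inferInstance <| le_iSup_of_le inferInstance <| le_iSup_of_le R' <|
    le_iSup_of_le inferInstance <| le_iSup_of_le inferInstance <| le_iSup_of_le N <| le_iSup_of_le M <|
    le_iSup_of_le hN <| le_iSup_of_le hM <| le_iSup_of_le hfin le_rfl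

/-- Test the supremum on N = M a constant channel: the subtracted term is at most 0 and the
divergence of the outputs is at least 0. -/
theorem superDivA_nonneg [Nonempty C] [Nonempty A] [Nonempty B] (hΘ₁ : Θ₁.IsValid)
    (hΘ₂ : Θ₂.IsValid) : 0 ≤ superDivA Θ₁ Θ₂ := by
  obtain ⟨τ, hτ⟩ := exists_isState (B × Unit)
  have hN : IsChannel (replacement (A × Unit) τ) := isChannel_replacement hτ
  have h0 := chanDivA_self_le hN
  have h1 := chanDivA_apply_le_superDivA_add Θ₁ Θ₂ hN hN
    (ne_top_of_le_ne_top EReal.zero_ne_top h0)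
  exact (chanDivA_nonneg (hΘ₁.apply hN) (hΘ₂.apply hN)).trans
    (h1.trans ((add_le_add_right h0 _).trans (add_zero _).le))

/-- The telescoping of successive strategies one level up, with superchannels acting on channels;
`chanDivA_comp_le` takes the place of data processing. -/
theorem chanDivA_nested_le [Nonempty C] [Nonempty A] [Nonempty B] [Nonempty R]
    (hΘ₁ : Θ₁.IsValid) (hΘ₂ : Θ₂.IsValid) (hmid : IsChannel mid)
    (hpre : ∀ k, IsChannel (pre k)) (hpost : ∀ k, IsChannel (post k)) (k : ℕ) :
    chanDivA (Θ₁.nested mid pre post k) (Θ₂.nested mid pre post k)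
      ≤ ((k + 1 : ℕ) : EReal) * superDivA Θ₁ Θ₂ := by
  have h0 := superDivA_nonneg hΘ₁ hΘ₂
  induction k with
  | zero =>
    refine le_succ_mul_of_amortized h0 (chanDivA_apply_le_superDivA_add Θ₁ Θ₂ hmid hmid) ?_
    rw [Nat.cast_zero, zero_mul]
    exact chanDivA_self_le hmid
  | succ k ih =>
    have h1 := hΘ₁.nested hmid hpre hpost k
    have h2 := hΘ₂.nested hmid hpre hpost k
    exact le_succ_mul_of_amortized h0 (chanDivA_apply_le_superDivA_add Θ₁ Θ₂
      ((hpost k).comp (h1.comp (hpre k))) ((hpost k).comp (h2.comp (hpre k))))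
      ((chanDivA_comp_le (hpre k) h1 h2 (hpost k)).trans ih)

end Nested

/-! ### The fully amortized divergence as a one-step bound on states -/

section Amortization

variable {C A B D S S₁ S₂ : Type} [Fintype C] [DecidableEq C] [Fintype A] [DecidableEq A]
  [Fintype B] [DecidableEq B] [Fintype D] [DecidableEq D] [Fintype S] [DecidableEq S]
  [Fintype S₁] [DecidableEq S₁] [Fintype S₂] [DecidableEq S₂]

/-- Replacing the second component of `Θ₁` by that of `Θ₂`, under the second hypothesis only,
costs at most `δ`. -/
def IsAmortizedBound (Θ₁ : Superchannel C A B D S₁) (Θ₂ : Superchannel C A B D S₂)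
    (δ : EReal) : Prop :=
  ∀ (R R' : Type) [Fintype R] [DecidableEq R] [Fintype R'] [DecidableEq R']
    (N M : SuperOp (A × R) (B × R')) (ω₁ ω₂ : Op (C × R)), IsChannel N → IsChannel M →
    IsState ω₁ → IsState ω₂ → stateDiv (Θ₁.applyEnc N ω₁) (Θ₁.applyEnc M ω₂) ≠ ⊤ →
    stateDiv (Θ₁.apply N ω₁) (Θ₂.apply M ω₂)
      ≤ δ + stateDiv (Θ₁.applyEnc N ω₁) (Θ₁.applyEnc M ω₂)

theorem comp_replacement {X Y Z : Type} [Fintype X] [DecidableEq X] (Φ : SuperOp Y Z) (τ : Op Y) :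
    Φ ∘ₗ replacement X τ = replacement X (Φ τ) := by
  ext1 M
  exact map_smul Φ _ _

/-- With trivial input the whole initial state sits on the reference, which remains as a tensor
factor. Its divergence is additive and cancels against the subtracted term. -/
theorem chanDivA_replacement {X : Type} [Fintype X] [DecidableEq X] {a b : Op X} (ha : IsState a)
    (hb : IsState b) : chanDivA (replacement Unit a) (replacement Unit b) = stateDiv a b := by
  refine le_antisymm (chanDivA_le fun R _ _ ρ τ hρ hτ hfin => EReal.sub_le_of_le_add ?_) ?_
  · have e : ∀ M : Op (Unit × R), ∑ x : Unit, M.submatrix (fun r : R => (x, r)) (fun r => (x, r))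
        = relabel (Equiv.punitProd R) M := fun M => by
      rw [Fintype.sum_unique]; rfl
    rw [tensorId_replacement, tensorId_replacement, e, e]
    have hρ' := hρ.relabel (Equiv.punitProd R)
    have hτ' := hτ.relabel (Equiv.punitProd R)
    rw [stateDiv_kronecker ha.1 hb.1 hρ'.1 hτ'.1, stateDiv_relabel hρ.1 hτ.1]
  · have := stateDiv_map_le_chanDivA (isChannel_replacement (X := Unit) ha)
      (isChannel_replacement (X := Unit) hb) isState_one_unit
    simpa [replacement_apply] using this

/-- Take X trivial and let the two channels into C R prepare ω₁ and ω₂. All composites are then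
constant channels, for which the amortized divergence is the divergence of the prepared states. -/
theorem isAmortizedBound_superDivAStar {Θ₁ : Superchannel C A B D S₁}
    {Θ₂ : Superchannel C A B D S₂} (hΘ₁ : Θ₁.IsValid) (hΘ₂ : Θ₂.IsValid) :
    IsAmortizedBound Θ₁ Θ₂ (superDivAStar Θ₁ Θ₂) := by
  intro R R' _ _ _ _ N M ω₁ ω₂ hN hM hω₁ hω₂ hfin
  have h1 := (hΘ₁.applyEnc hN).map_isState hω₁
  have h2 := (hΘ₁.applyEnc hM).map_isState hω₂
  have e1 := chanDivA_replacement h1 h2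
  have e2 := chanDivA_replacement ((hΘ₁.apply hN).map_isState hω₁)
    ((hΘ₂.apply hM).map_isState hω₂)
  rw [← comp_replacement, ← comp_replacement] at e1 e2
  have hbot : stateDiv (Θ₁.applyEnc N ω₁) (Θ₁.applyEnc M ω₂) ≠ ⊥ :=
    (EReal.bot_lt_zero.trans_le (stateDiv_nonneg h1 h2)).ne'
  rw [← EReal.sub_le_iff_le_add (Or.inl hbot) (Or.inl hfin), ← e1, ← e2]
  rw [← e1] at hfin
  exact le_iSup_of_le R <| le_iSup_of_le inferInstance <| le_iSup_of_le inferInstance <|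
    le_iSup_of_le R' <| le_iSup_of_le inferInstance <| le_iSup_of_le inferInstance <|
    le_iSup_of_le Unit <| le_iSup_of_le inferInstance <| le_iSup_of_le inferInstance <|
    le_iSup_of_le N <| le_iSup_of_le M <| le_iSup_of_le _ <| le_iSup_of_le _ <|
    le_iSup_of_le hN <| le_iSup_of_le hM <| le_iSup_of_le (isChannel_replacement hω₁) <|
    le_iSup_of_le (isChannel_replacement hω₂) <| le_iSup_of_le hfin le_rfl

theorem IsAmortizedBound.nonneg [Nonempty C] [Nonempty A] [Nonempty B]
    {Θ₁ : Superchannel C A B D S₁} {Θ₂ : Superchannel C A B D S₂} {δ : EReal}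
    (h : IsAmortizedBound Θ₁ Θ₂ δ) (hΘ₁ : Θ₁.IsValid) (hΘ₂ : Θ₂.IsValid) : 0 ≤ δ := by
  obtain ⟨τ, hτ⟩ := exists_isState (B × Unit)
  obtain ⟨ω, hω⟩ := exists_isState (C × Unit)
  have hN : IsChannel (replacement (A × Unit) τ) := isChannel_replacement hτ
  have h0 := stateDiv_self ((hΘ₁.applyEnc hN).map_isState hω)
  have h1 := h _ _ _ _ ω ω hN hN hω hω (by rw [h0]; exact EReal.zero_ne_top)
  rw [h0, add_zero] at h1
  exact (stateDiv_nonneg ((hΘ₁.apply hN).map_isState hω) ((hΘ₂.apply hN).map_isState hω)).trans h1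

end Amortization

/-! ### Enlarging the memory by an inert state -/

section Padding

variable {X Y R R₀ T : Type}

/-- An entry of (Φ ⊗ id)(M) depends only on the slice of M at the given reference indices.
Proportional slices give proportional entries, even across different references. -/
theorem tensorId_apply_of_slice {Φ : SuperOp X Y} {M : Op (X × R)} {M₀ : Op (X × R₀)} {r r' : R}
    {r₀ r₀' : R₀} {c : ℂ} (h : ∀ x x', M (x, r) (x', r') = c * M₀ (x, r₀) (x', r₀')) (y y' : Y) :
    tensorId Φ R M (y, r) (y', r') = c * tensorId Φ R₀ M₀ (y, r₀) (y', r₀') := by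
  have : (Matrix.of fun x x' => M (x, r) (x', r'))
      = c • Matrix.of fun x x' => M₀ (x, r₀) (x', r₀') := by
    ext x x'; exact h x x'
  simp only [tensorId_apply]
  rw [this, map_smul, Matrix.smul_apply, smul_eq_mul]

variable [Fintype X] [DecidableEq X] [Fintype T] [DecidableEq T]

/-- The map `M ↦ M ⊗ τ`. -/
def attach (X : Type) (τ : Op T) : SuperOp X (X × T) :=
  relabel (Equiv.prodComm T X) ∘ₗ tensorId (replacement Unit τ) X ∘ₗ
    relabel (Equiv.punitProd X).symm

/-- The partial trace over the second system. -/
def detach (X T : Type) [Fintype T] : SuperOp (X × T) X :=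
  relabel (Equiv.punitProd X) ∘ₗ tensorId (replacement T (1 : Op Unit)) X ∘ₗ
    relabel (Equiv.prodComm X T)

theorem attach_apply (τ : Op T) (M : Op X) : attach X τ M = M ⊗ₖ τ := by
  ext x x'
  simp only [attach, LinearMap.comp_apply]
  rw [relabel_apply, tensorId_apply, replacement_apply]
  simp only [Matrix.trace, Fintype.sum_unique]
  rfl

theorem detach_kronecker {τ : Op T} (hτ : IsState τ) (M : Op X) : detach X T (M ⊗ₖ τ) = M := by
  simp only [detach, LinearMap.comp_apply]
  rw [relabel_prodComm_kronecker, tensorId_kronecker, replacement_apply, hτ.2, one_smul]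
  ext x x'
  rw [relabel_apply, Matrix.kronecker_apply]
  simp

theorem isChannel_attach {τ : Op T} (hτ : IsState τ) : IsChannel (attach X τ) :=
  (isChannel_relabel _).comp (((isChannel_replacement hτ).tensorId X).comp (isChannel_relabel _))

theorem isChannel_detach : IsChannel (detach X T) :=
  (isChannel_relabel _).comp
    (((isChannel_replacement isState_one_unit).tensorId X).comp (isChannel_relabel _))

variable {C A B D S S' : Type} [Fintype C] [DecidableEq C] [Fintype A] [DecidableEq A]
  [Fintype B] [DecidableEq B] [Fintype D] [DecidableEq D] [Fintype S] [DecidableEq S]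
  [Fintype S'] [DecidableEq S']

/-- The identification `(X × S) × T ≃ X × S'` for a given `S' ≃ S × T`. -/
def memoryEquiv (X : Type) (e : S' ≃ S × T) : (X × S) × T ≃ X × S' :=
  (Equiv.prodAssoc X S T).trans ((Equiv.refl X).prodCongr e.symm)

/-- The superchannel `Θ` with an enlarged memory `S' ≃ S × T`, whose second part is in
the state `τ`. -/
def Superchannel.pad (Θ : Superchannel C A B D S) (e : S' ≃ S × T) (τ : Op T) :
    Superchannel C A B D S' where
  enc := relabel (memoryEquiv A e) ∘ₗ attach (A × S) τ ∘ₗ Θ.enc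
  dec := Θ.dec ∘ₗ detach (B × S) T ∘ₗ relabel (memoryEquiv B e).symm

theorem Superchannel.IsValid.pad {Θ : Superchannel C A B D S} (hΘ : Θ.IsValid) (e : S' ≃ S × T)
    {τ : Op T} (hτ : IsState τ) : (Θ.pad e τ).IsValid :=
  ⟨(isChannel_relabel _).comp ((isChannel_attach hτ).comp hΘ.1),
    hΘ.2.comp (isChannel_detach.comp (isChannel_relabel _))⟩

theorem Superchannel.pad_enc_apply (Θ : Superchannel C A B D S) (e : S' ≃ S × T) (τ : Op T)
    (M : Op C) (a a' : A) (s s' : S') : (Θ.pad e τ).enc M (a, s) (a', s')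
      = τ (e s).2 (e s').2 * Θ.enc M (a, (e s).1) (a', (e s').1) := by
  simp only [pad, LinearMap.comp_apply]
  rw [relabel_apply, attach_apply, Matrix.kronecker_apply, mul_comm]
  rfl

/-- The decoder discards the extra memory, and the factor τ has trace one. -/
theorem Superchannel.pad_dec_of_eq (Θ : Superchannel C A B D S) (e : S' ≃ S × T) {τ : Op T}
    (hτ : IsState τ) {M : Op (B × S')} {K : Op (B × S)} {c : ℂ}
    (h : ∀ b b' s s', M (b, s) (b', s')
      = c * (τ (e s).2 (e s').2 * K (b, (e s).1) (b', (e s').1))) :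
    (Θ.pad e τ).dec M = c • Θ.dec K := by
  have : relabel (memoryEquiv B e).symm M = c • (K ⊗ₖ τ) := by
    ext x x'
    rw [relabel_apply, Matrix.smul_apply, Matrix.kronecker_apply, smul_eq_mul, mul_comm (K _ _)]
    refine (h _ _ _ _).trans ?_
    simp
  simp only [pad, LinearMap.comp_apply]
  rw [this, map_smul, detach_kronecker hτ, map_smul]

theorem Superchannel.pad_applyEnc_apply (Θ : Superchannel C A B D S) (e : S' ≃ S × T) (τ : Op T)
    {R R' : Type} (N : SuperOp (A × R) (B × R')) (M : Op (C × R)) (y y' : B × R') (s s' : S') :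
    (Θ.pad e τ).applyEnc N M (y, s) (y', s')
      = τ (e s).2 (e s').2 * Θ.applyEnc N M (y, (e s).1) (y', (e s').1) := by
  simp only [applyEnc, LinearMap.comp_apply]
  refine tensorId_apply_of_slice (fun x x' => ?_) y y'
  exact Θ.pad_enc_apply e τ _ _ _ _ _

theorem Superchannel.pad_applyEnc (Θ : Superchannel C A B D S) (e : S' ≃ S × T) (τ : Op T)
    {R R' : Type} (N : SuperOp (A × R) (B × R')) (M : Op (C × R)) :
    (Θ.pad e τ).applyEnc N M = relabel (memoryEquiv (B × R') e) (Θ.applyEnc N M ⊗ₖ τ) := by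
  ext ⟨y, s⟩ ⟨y', s'⟩
  rw [pad_applyEnc_apply, relabel_apply, Matrix.kronecker_apply, mul_comm]
  rfl

theorem Superchannel.pad_apply (Θ : Superchannel C A B D S) (e : S' ≃ S × T) {τ : Op T}
    (hτ : IsState τ) {R R' : Type} (N : SuperOp (A × R) (B × R')) :
    (Θ.pad e τ).apply N = Θ.apply N := by
  ext1 M
  ext ⟨d, r⟩ ⟨d', r'⟩
  simp only [apply, LinearMap.comp_apply]
  rw [tensorId_apply, tensorId_apply]
  rw [Θ.pad_dec_of_eq e hτ (c := 1), one_smul]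
  intro b b' s s'
  rw [one_mul]
  exact Θ.pad_applyEnc_apply e τ N M _ _ _ _

/-- Both states in the subtracted term come from the first superchannel, so both gain the same
factor τ₁, which adds divergence 0; the completed superchannels are unchanged. -/
theorem IsAmortizedBound.pad {S₁ S₂ T₁ T₂ : Type} [Fintype S₁] [DecidableEq S₁] [Fintype S₂]
    [DecidableEq S₂] [Fintype T₁] [DecidableEq T₁] [Fintype T₂] [DecidableEq T₂]
    {Θ₁ : Superchannel C A B D S₁} {Θ₂ : Superchannel C A B D S₂} {δ : EReal}
    (h : IsAmortizedBound Θ₁ Θ₂ δ) (hΘ₁ : Θ₁.IsValid) (e₁ : S' ≃ S₁ × T₁) (e₂ : S' ≃ S₂ × T₂)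
    {τ₁ : Op T₁} {τ₂ : Op T₂} (hτ₁ : IsState τ₁) (hτ₂ : IsState τ₂) :
    IsAmortizedBound (Θ₁.pad e₁ τ₁) (Θ₂.pad e₂ τ₂) δ := by
  intro R R' _ _ _ _ N M ω₁ ω₂ hN hM hω₁ hω₂
  have h1 := (hΘ₁.applyEnc hN).map_isState hω₁
  have h2 := (hΘ₁.applyEnc hM).map_isState hω₂
  rw [Θ₁.pad_apply e₁ hτ₁, Θ₂.pad_apply e₂ hτ₂, Θ₁.pad_applyEnc, Θ₁.pad_applyEnc,
    stateDiv_relabel (h1.1.kronecker hτ₁.1) (h2.1.kronecker hτ₁.1),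
    stateDiv_kronecker h1.1 h2.1 hτ₁.1 hτ₁.1, stateDiv_self hτ₁, add_zero]
  exact h R R' N M ω₁ ω₂ hN hM hω₁ hω₂

/-- Every open memory carries its own factor τ, untouched until its decoder discards it. The formula
is entrywise, so the induction needs no regrouping of tensor factors. -/
theorem Protocol.run_pad (Θ : Superchannel C A B D S) (e : S' ≃ S × T) {τ : Op T}
    (hτ : IsState τ) {m k : ℕ} {X : Type} (P : Protocol C A B D m k X) (x x' : X)
    (w w' : Fin k → S') :
    run (Θ.pad e τ) P (x, w) (x', w') = (∏ i, τ (e (w i)).2 (e (w' i)).2) *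
      run Θ P (x, fun i => (e (w i)).1) (x', fun i => (e (w' i)).1) := by
  induction P with
  | prepare ρ hρ =>
    simp only [run, Finset.univ_eq_empty, Finset.prod_empty, one_mul]
    rfl
  | @useEnc m k X R _ _ _ _ _ _ P 𝒜 h𝒜 ih =>
    simp only [run]
    rw [relabel_apply, relabel_apply]
    obtain ⟨a, r⟩ := x
    obtain ⟨a', r'⟩ := x'
    have h1 : ∀ c c', relabel (Equiv.prodAssoc C R (Fin k → S'))
        (tensorId 𝒜 (Fin k → S') (run (Θ.pad e τ) P)) (c, (r, fun i => w i.succ))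
          (c', (r', fun i => w' i.succ))
        = (∏ i : Fin k, τ (e (w i.succ)).2 (e (w' i.succ)).2) *
          relabel (Equiv.prodAssoc C R (Fin k → S)) (tensorId 𝒜 (Fin k → S) (run Θ P))
            (c, (r, fun i => (e (w i.succ)).1)) (c', (r', fun i => (e (w' i.succ)).1)) := by
      intro c c'
      exact tensorId_apply_of_slice (fun x x' => ih x x' _ _) _ _
    have h2 := tensorId_apply_of_slice (Φ := (Θ.pad e τ).enc) h1 (a, w 0) (a', w' 0)
    have h3 : tensorId (Θ.pad e τ).enc (R × (Fin k → S))
        (relabel (Equiv.prodAssoc C R (Fin k → S)) (tensorId 𝒜 (Fin k → S) (run Θ P)))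
          ((a, w 0), (r, fun i => (e (w i.succ)).1))
          ((a', w' 0), (r', fun i => (e (w' i.succ)).1)) = _ := Θ.pad_enc_apply e τ _ _ _ _ _
    rw [h3] at h2
    rw [Fin.prod_univ_succ, mul_comm (τ _ _), mul_assoc]
    exact h2
  | @useDec m k X R _ _ _ _ _ _ P 𝒜 h𝒜 j ih =>
    simp only [run]
    obtain ⟨d, r⟩ := x
    obtain ⟨d', r'⟩ := x'
    rw [relabel_apply, relabel_apply, tensorId_apply, tensorId_apply]
    rw [Θ.pad_dec_of_eq e hτ (c := ∏ i : Fin k, τ (e (w i)).2 (e (w' i)).2)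
      (K := Matrix.of fun x x' => relabel (Protocol.closeEquiv B R S k j)
        (tensorId 𝒜 (Fin (k + 1) → S) (run Θ P)) (x, (r, fun i => (e (w i)).1))
          (x', (r', fun i => (e (w' i)).1)))]
    · rfl
    · intro b b' s s'
      have h1 := tensorId_apply_of_slice (Φ := 𝒜) (fun x x' => ih x x'
        (j.insertNth s w) (j.insertNth s' w')) (b, r) (b', r')
      have h2 : ∀ (s : S') (w : Fin k → S'), (fun i => (e ((j.insertNth s w : Fin (k + 1) → S') i)).1)
          = (j.insertNth (e s).1 (fun i => (e (w i)).1) : Fin (k + 1) → S) := by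
        intro s w
        rw [Fin.eq_insertNth_iff]
        refine ⟨by simp, ?_⟩
        funext i
        simp [Fin.removeNth]
      -- Separate the factor τ of the memory being closed from those that stay open.
      rw [h2, h2, Fin.prod_univ_succAbove _ j] at h1
      simp only [Fin.insertNth_apply_same, Fin.insertNth_apply_succAbove] at h1
      rw [← mul_assoc, mul_comm (∏ i, _)]
      exact h1

theorem Protocol.output_pad (Θ : Superchannel C A B D S) (e : S' ≃ S × T) {τ : Op T}
    (hτ : IsState τ) {m : ℕ} {X : Type} (P : Protocol C A B D m 0 X) :
    output (Θ.pad e τ) P = output Θ P := by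
  ext x x'
  simp only [output, relabel_apply]
  refine (run_pad Θ e hτ P x x' _ _).trans ?_
  rw [Finset.univ_eq_empty, Finset.prod_empty, one_mul]
  congr 1 <;> exact Prod.ext rfl (Subsingleton.elim _ _)

end Padding

/-! ### Fully general protocols: hybrids and combs -/

namespace Protocol

section

variable {C A B D S : Type}

/-- Use of the first component `E` of a new superchannel after the channel `𝒜`. -/
def encStep {X R : Type} (E : SuperOp C (A × S)) (𝒜 : SuperOp X (C × R)) (k : ℕ) :
    SuperOp (X × (Fin k → S)) ((A × R) × (Fin (k + 1) → S)) :=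
  relabel (openEquiv A R S k) ∘ₗ tensorId E (R × (Fin k → S)) ∘ₗ
    relabel (Equiv.prodAssoc C R (Fin k → S)) ∘ₗ tensorId 𝒜 (Fin k → S)

/-- Use of the second component `E` of the `j`-th open superchannel after the channel `𝒜`. -/
def decStep {X R : Type} (E : SuperOp (B × S) D) (𝒜 : SuperOp X (B × R)) {k : ℕ}
    (j : Fin (k + 1)) : SuperOp (X × (Fin (k + 1) → S)) ((D × R) × (Fin k → S)) :=
  relabel (Equiv.prodAssoc D R (Fin k → S)).symm ∘ₗ tensorId E (R × (Fin k → S)) ∘ₗ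
    relabel (closeEquiv B R S k j) ∘ₗ tensorId 𝒜 (Fin (k + 1) → S)

/-- The state of a protocol in which the open superchannels use the first components `f` and the
completed ones are given by `Θ`. -/
def hybridRun (Θ : Superchannel C A B D S) {m k : ℕ} {X : Type} :
    Protocol C A B D m k X → (Fin k → SuperOp C (A × S)) → Op (X × (Fin k → S))
  | prepare ρ _, _ => relabel (Equiv.prodUnique _ (Fin 0 → S)).symm ρ
  | useEnc P 𝒜 _, f => encStep (f 0) 𝒜 _ (hybridRun Θ P fun i => f i.succ)
  | useDec P 𝒜 _ j, f => decStep Θ.dec 𝒜 j (hybridRun Θ P (j.insertNth Θ.enc f))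

theorem insertNth_const {α : Type*} {k : ℕ} (j : Fin (k + 1)) (a : α) :
    (j.insertNth a fun _ => a : Fin (k + 1) → α) = fun _ => a := by
  rw [Fin.insertNth_eq_iff]
  exact ⟨rfl, rfl⟩

/-- Exchanges the order of two insertions; needed when one slot is closed while another is being
tracked. -/
theorem insertNth_comm {α : Type*} {k : ℕ} (i : Fin (k + 2)) (j : Fin (k + 1)) (a b : α)
    (f : Fin k → α) :
    (i.insertNth a (j.insertNth b f : Fin (k + 1) → α) : Fin (k + 2) → α)
      = (i.succAbove j).insertNth b ((j.predAbove i).insertNth a f : Fin (k + 1) → α) := by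
  rw [Fin.eq_insertNth_iff]
  refine ⟨by simp, ?_⟩
  rw [Fin.eq_insertNth_iff]
  refine ⟨?_, ?_⟩
  · simp only [Fin.removeNth, Fin.succAbove_succAbove_predAbove, Fin.insertNth_apply_same]
  · rw [← Fin.removeNth_removeNth_eq_swap, Fin.removeNth_insertNth, Fin.removeNth_insertNth]

theorem hybridRun_const (Θ : Superchannel C A B D S) {m k : ℕ} {X : Type}
    (P : Protocol C A B D m k X) : hybridRun Θ P (fun _ => Θ.enc) = run Θ P := by
  induction P with
  | prepare ρ hρ => rfl
  | useEnc P 𝒜 h𝒜 ih => simp only [hybridRun, ih]; rfl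
  | useDec P 𝒜 h𝒜 j ih => simp only [hybridRun, insertNth_const, ih]; rfl

/-- Separation of the memory of the `j`-th open superchannel. -/
def splitMemory (X S : Type) {k : ℕ} (j : Fin (k + 1)) :
    X × (Fin (k + 1) → S) ≃ (X × (Fin k → S)) × S where
  toFun x := ((x.1, j.removeNth x.2), x.2 j)
  invFun x := (x.1.1, j.insertNth x.2 x.1.2)
  left_inv x := by simp
  right_inv x := by simp

/-- A new superchannel takes position 0, so its encoder has just acted and only a regrouping
follows: the simplest comb. -/
theorem splitMemory_encStep_zero {X R : Type} (E : SuperOp C (A × S)) (𝒜 : SuperOp X (C × R))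
    (k : ℕ) (M : Op (X × (Fin k → S))) :
    relabel (splitMemory (A × R) S 0) (encStep E 𝒜 k M)
      = tensorId (relabel (Equiv.prodAssoc A R (Fin k → S)).symm) S
          (relabel (swapLast A S (R × (Fin k → S))) (tensorId E (R × (Fin k → S))
            (relabel (Equiv.prodAssoc C R (Fin k → S)) (tensorId 𝒜 (Fin k → S) M)))) := by
  ext ⟨⟨⟨a, r⟩, t⟩, s⟩ ⟨⟨⟨a', r'⟩, t'⟩, s'⟩
  have h : ∀ a r s (t : Fin k → S), (openEquiv A R S k).symm
      ((a, r), (Fin.insertNth 0 s t : Fin (k + 1) → S)) = ((a, s), (r, t)) := by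
    intro a r s t
    rw [Equiv.symm_apply_eq]
    rfl
  simp only [encStep, LinearMap.comp_apply]
  rw [relabel_apply, relabel_apply]
  exact congrArg₂ (tensorId E (R × (Fin k → S)) _) (h a r s t) (h a' r' s' t')

/-- An older memory is a bystander when a new superchannel opens; its index moves from j to j + 1.
-/
theorem splitMemory_encStep_succ {X R : Type} (E : SuperOp C (A × S)) (𝒜 : SuperOp X (C × R))
    (k : ℕ) (j : Fin (k + 1)) (M : Op (X × (Fin (k + 1) → S))) :
    relabel (splitMemory (A × R) S j.succ) (encStep E 𝒜 (k + 1) M)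
      = tensorId (encStep E 𝒜 k) S (relabel (splitMemory X S j) M) := by
  ext ⟨⟨⟨a, r⟩, t⟩, s⟩ ⟨⟨⟨a', r'⟩, t'⟩, s'⟩
  have h : ∀ a r s (t : Fin (k + 1) → S), (openEquiv A R S (k + 1)).symm
      ((a, r), (j.succ.insertNth s t : Fin (k + 2) → S))
        = ((a, t 0), (r, (j.insertNth s (Fin.removeNth 0 t) : Fin (k + 1) → S))) := by
    intro a r s t
    rw [Equiv.symm_apply_eq]
    refine Prod.ext rfl ?_
    change (j.succ.insertNth s t : Fin (k + 2) → S)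
      = Fin.insertNth 0 (t 0) (j.insertNth s (Fin.removeNth 0 t) : Fin (k + 1) → S)
    rw [Fin.insertNth_zero', ← Fin.insertNth_succ_cons, ← Fin.insertNth_zero',
      Fin.insertNth_self_removeNth]
  simp only [encStep, LinearMap.comp_apply]
  rw [relabel_apply, relabel_apply]
  exact congrArg₂ (tensorId E (R × (Fin (k + 1) → S)) _) (h a r s t) (h a' r' s' t')

/-- The memory at j after slot i has closed was at `i.succAbove j` before. With that bystander set
aside, the closing slot has index `j.predAbove i`. -/
theorem splitMemory_decStep {X R : Type} (E : SuperOp (B × S) D) (𝒜 : SuperOp X (B × R))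
    {k : ℕ} (i : Fin (k + 2)) (j : Fin (k + 1)) (M : Op (X × (Fin (k + 2) → S))) :
    relabel (splitMemory (D × R) S j) (decStep E 𝒜 i M)
      = tensorId (decStep E 𝒜 (j.predAbove i)) S
          (relabel (splitMemory X S (i.succAbove j)) M) := by
  ext ⟨⟨⟨d, r⟩, t⟩, s⟩ ⟨⟨⟨d', r'⟩, t'⟩, s'⟩
  have h : ∀ (b : B) (r : R) s s₀ (t : Fin k → S), (closeEquiv B R S (k + 1) i).symm
      ((b, s₀), (r, (j.insertNth s t : Fin (k + 1) → S)))
        = ((b, r), ((i.succAbove j).insertNth s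
            ((j.predAbove i).insertNth s₀ t : Fin (k + 1) → S) : Fin (k + 2) → S)) := by
    intro b r s s₀ t
    rw [← insertNth_comm]
    rfl
  have hM : (Matrix.of fun y y' : B × S => tensorId 𝒜 (Fin (k + 2) → S) M
      ((closeEquiv B R S (k + 1) i).symm (y, (r, (j.insertNth s t : Fin (k + 1) → S))))
      ((closeEquiv B R S (k + 1) i).symm (y', (r', (j.insertNth s' t' : Fin (k + 1) → S)))))
      = Matrix.of fun y y' : B × S => tensorId 𝒜 (Fin (k + 2) → S) M
        ((y.1, r), ((i.succAbove j).insertNth s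
            ((j.predAbove i).insertNth y.2 t : Fin (k + 1) → S) : Fin (k + 2) → S))
        ((y'.1, r'), ((i.succAbove j).insertNth s'
            ((j.predAbove i).insertNth y'.2 t' : Fin (k + 1) → S) : Fin (k + 2) → S)) := by
    ext ⟨b, s₀⟩ ⟨b', s₀'⟩
    exact congrArg₂ (tensorId 𝒜 (Fin (k + 2) → S) M) (h b r s s₀ t)
      (h b' r' s' s₀' t')
  exact congrArg (fun K => E K d d') hM

variable [hC : Fintype C] [dC : DecidableEq C] [Fintype A] [DecidableEq A]
  [hB : Fintype B] [dB : DecidableEq B] [Fintype D] [DecidableEq D] [Fintype S] [DecidableEq S]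

theorem isChannel_encStep {X R : Type} [Fintype X] [DecidableEq X] [Fintype R] [DecidableEq R]
    {E : SuperOp C (A × S)} (hE : IsChannel E) {𝒜 : SuperOp X (C × R)} (h𝒜 : IsChannel 𝒜)
    (k : ℕ) : IsChannel (encStep E 𝒜 k) :=
  (isChannel_relabel _).comp ((hE.tensorId _).comp ((isChannel_relabel _).comp (h𝒜.tensorId _)))

theorem isChannel_decStep {X R : Type} [Fintype X] [DecidableEq X] [Fintype R] [DecidableEq R]
    {E : SuperOp (B × S) D} (hE : IsChannel E) {𝒜 : SuperOp X (B × R)} (h𝒜 : IsChannel 𝒜)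
    {k : ℕ} (j : Fin (k + 1)) : IsChannel (decStep E 𝒜 j) :=
  (isChannel_relabel _).comp ((hE.tensorId _).comp ((isChannel_relabel _).comp (h𝒜.tensorId _)))

theorem forall_insertNth {α : Type*} {p : α → Prop} {k : ℕ} (j : Fin (k + 1)) {a : α}
    {f : Fin k → α} (ha : p a) (hf : ∀ i, p (f i)) (i : Fin (k + 1)) :
    p ((j.insertNth a f : Fin (k + 1) → α) i) := by
  refine Fin.succAboveCases j ?_ (fun i => ?_) i
  · rwa [Fin.insertNth_apply_same]
  · rw [Fin.insertNth_apply_succAbove]; exact hf i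

/-- The constructors of `Protocol` bundle their own finiteness instances, so the statement
quantifies over instances and each case identifies them by uniqueness. -/
theorem hybridRun_isState {Θ : Superchannel C A B D S} (hΘ : Θ.IsValid) {m k : ℕ} {X : Type}
    (P : Protocol C A B D m k X) : ∀ [hX : Fintype X] [DecidableEq X]
    {f : Fin k → SuperOp C (A × S)}, (∀ i, IsChannel (f i)) → IsState (hybridRun Θ P f) := by
  induction P with
  | @prepare X i₁ i₂ ρ hρ =>
    intro hX _ f hf
    obtain rfl : hX = i₁ := Subsingleton.elim _ _
    exact hρ.relabel _
  | @useEnc m k X R i₁ i₂ i₃ i₄ i₅ i₆ P 𝒜 h𝒜 ih =>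
    intro hX _ f hf
    obtain rfl : hX = instFintypeProd A R := Subsingleton.elim _ _
    obtain rfl : hC = i₅ := Subsingleton.elim _ _
    exact (isChannel_encStep (hf 0) h𝒜 k).map_isState (ih fun i => hf i.succ)
  | @useDec m k X R i₁ i₂ i₃ i₄ i₅ i₆ P 𝒜 h𝒜 j ih =>
    intro hX _ f hf
    obtain rfl : hX = instFintypeProd D R := Subsingleton.elim _ _
    obtain rfl : hB = i₅ := Subsingleton.elim _ _
    exact (isChannel_decStep hΘ.2 h𝒜 j).map_isState (ih (forall_insertNth j hΘ.1 hf))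

/-- The dependence of `G` on a channel `E : C → A S` is that of a comb with reference `R`. -/
def IsComb (R : Type) [Fintype R] {Y : Type} [Fintype Y]
    (G : SuperOp C (A × S) → Op (Y × S)) : Prop :=
  ∃ (N : SuperOp (A × R) Y) (ω : Op (C × R)), IsChannel N ∧ IsState ω ∧
    ∀ E, G E = tensorId N S (relabel (swapLast A S R) (tensorId E R ω))

theorem IsComb.comp {R Y Z : Type} [Fintype R] [DecidableEq R] [Fintype Y] [DecidableEq Y]
    [Fintype Z] [DecidableEq Z] {G : SuperOp C (A × S) → Op (Y × S)} (hG : IsComb R G)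
    {Ψ : SuperOp Y Z} (hΨ : IsChannel Ψ) : IsComb R fun E => tensorId Ψ S (G E) := by
  obtain ⟨N, ω, hN, hω, h⟩ := hG
  exact ⟨Ψ ∘ₗ N, ω, hΨ.comp hN, hω, fun E => congrArg (tensorId Ψ S) (h E)⟩

/-- The state of the protocol depends on the first component of each open superchannel as
a comb, whose reference system does not depend on the other components. -/
def HasCombs (S : Type) [Fintype S] [DecidableEq S] : ∀ {m k : ℕ} {X : Type},
    Protocol C A B D m k X → [Fintype X] → Prop
  | _, 0, _, _, _ => True
  | _, k + 1, X, P, _ => ∀ j : Fin (k + 1), ∃ (R : Type) (_ : Fintype R) (_ : DecidableEq R),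
      ∀ Θ : Superchannel C A B D S, Θ.IsValid → ∀ f : Fin k → SuperOp C (A × S),
        (∀ i, IsChannel (f i)) →
          IsComb R fun E => relabel (splitMemory X S j) (hybridRun Θ P (j.insertNth E f))

/-- A fresh encoder gives a comb whose reference holds R and all older memories. Every later
operation leaves that encoder's memory alone and is absorbed into the channel N of the comb. -/
theorem hasCombs {m k : ℕ} {X : Type} (P : Protocol C A B D m k X) :
    ∀ [hX : Fintype X] [DecidableEq X], HasCombs S P := by
  induction P with
  | prepare ρ hρ => intro _ _; trivial
  | @useEnc m k X R i₁ i₂ i₃ i₄ i₅ i₆ P 𝒜 h𝒜 ih =>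
    intro hX _ j
    obtain rfl : hX = instFintypeProd A R := Subsingleton.elim _ _
    obtain rfl : hC = i₅ := Subsingleton.elim _ _
    refine Fin.cases ?_ (fun j => ?_) j
    -- The input ω is the hybrid state just before the new encoder acts, and N only regroups.
    · refine ⟨R × (Fin k → S), inferInstance, inferInstance, fun Θ hΘ f hf => ?_⟩
      exact ⟨relabel (Equiv.prodAssoc A R (Fin k → S)).symm,
        relabel (Equiv.prodAssoc C R (Fin k → S)) (tensorId 𝒜 (Fin k → S) (hybridRun Θ P f)),
        isChannel_relabel _, ((h𝒜.tensorId _).map_isState (hybridRun_isState hΘ P hf)).relabel _,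
        fun E => splitMemory_encStep_zero E 𝒜 k _⟩
    · cases k with
      | zero => exact j.elim0
      | succ k =>
        obtain ⟨R₀, _, _, h⟩ := ih j
        refine ⟨R₀, inferInstance, inferInstance, fun Θ hΘ f hf => ?_⟩
        have h1 := (h Θ hΘ (fun i => f i.succ) fun i => hf i.succ).comp
          (isChannel_encStep (hf 0) h𝒜 k)
        convert h1 using 2 with E
        rw [← splitMemory_encStep_succ]
        have e : (j.succ.insertNth E f : Fin (k + 2) → SuperOp C (A × S))
            = Fin.cons (f 0)
              (j.insertNth E fun i => f i.succ : Fin (k + 1) → SuperOp C (A × S)) := by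
          rw [← Fin.insertNth_succ_cons]
          congr 1
          exact (Fin.cons_self_tail f).symm
        rw [e]
        rfl
  | @useDec m k X R i₁ i₂ i₃ i₄ i₅ i₆ P 𝒜 h𝒜 i ih =>
    intro hX _
    cases k with
    | zero => trivial
    | succ k =>
      intro j
      obtain rfl : hX = instFintypeProd D R := Subsingleton.elim _ _
      obtain rfl : hB = i₅ := Subsingleton.elim _ _
      obtain ⟨R₀, _, _, h⟩ := ih (i.succAbove j)
      refine ⟨R₀, inferInstance, inferInstance, fun Θ hΘ f hf => ?_⟩
      have h1 := (h Θ hΘ ((j.predAbove i).insertNth Θ.enc f)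
        (forall_insertNth _ hΘ.1 hf)).comp (isChannel_decStep hΘ.2 h𝒜 (j.predAbove i))
      convert h1 using 2 with E
      rw [← splitMemory_decStep]
      simp only [hybridRun]
      rw [insertNth_comm]

/-- Use of the second component after a channel, in terms of the action of the superchannel. -/
theorem decStep_eq_apply (Θ : Superchannel C A B D S) {X R R₀ : Type} {k : ℕ}
    (𝒜 : SuperOp X (B × R)) (j : Fin (k + 1)) (N : SuperOp (A × R₀) (X × (Fin k → S)))
    (ω : Op (C × R₀)) :
    decStep Θ.dec 𝒜 j (relabel (splitMemory X S j).symm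
        (tensorId N S (relabel (swapLast A S R₀) (tensorId Θ.enc R₀ ω))))
      = relabel (Equiv.prodAssoc D R (Fin k → S)).symm
          (Θ.apply (relabel (Equiv.prodAssoc B R (Fin k → S)) ∘ₗ tensorId 𝒜 (Fin k → S) ∘ₗ N) ω) := by
  -- The adaptive channel does not touch the memory of slot j, so it can be absorbed into N.
  have h : ∀ M : Op ((X × (Fin k → S)) × S),
      relabel (closeEquiv B R S k j) (tensorId 𝒜 (Fin (k + 1) → S)
          (relabel (splitMemory X S j).symm M))
        = relabel (swapLast B (R × (Fin k → S)) S)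
          (tensorId (relabel (Equiv.prodAssoc B R (Fin k → S)) ∘ₗ tensorId 𝒜 (Fin k → S)) S M) := by
    intro M
    ext ⟨⟨b, s⟩, ⟨r, t⟩⟩ ⟨⟨b', s'⟩, ⟨r', t'⟩⟩
    have e : ∀ s (t : Fin k → S), (fun x => splitMemory X S j (x, (j.insertNth s t : Fin (k + 1) → S)))
        = fun x => ((x, t), s) := by
      intro s t
      funext x
      rw [← Equiv.eq_symm_apply]
      rfl
    have hM : (Matrix.of fun x x' : X => M (splitMemory X S j (x, (j.insertNth s t : Fin (k + 1) → S)))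
        (splitMemory X S j (x', (j.insertNth s' t' : Fin (k + 1) → S))))
        = Matrix.of fun x x' => M ((x, t), s) ((x', t'), s') := by
      ext x x'
      exact congrArg₂ M (congrFun (e s t) x) (congrFun (e s' t') x')
    exact congrArg (fun K => 𝒜 K (b, r) (b', r')) hM
  simp only [decStep, LinearMap.comp_apply]
  rw [h]
  rfl

end

section

variable {C A B D S : Type} [hC : Fintype C] [dC : DecidableEq C] [Fintype A] [DecidableEq A]
  [hB : Fintype B] [dB : DecidableEq B] [Fintype D] [DecidableEq D] [Fintype S] [DecidableEq S]

/-- The crucial step: at the moment slot j closes, the second run exchanges its encoder for that of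
Θ₂ and applies the decoder of Θ₂. In comb form this passes from `applyEnc` of Θ₁ on both sides to
`apply` of Θ₁ and Θ₂, as the amortized bound requires. -/
theorem stateDiv_hybridRun_useDec_le {Θ₁ Θ₂ : Superchannel C A B D S} (hΘ₁ : Θ₁.IsValid)
    (hΘ₂ : Θ₂.IsValid) {δ : EReal} (hδ : IsAmortizedBound Θ₁ Θ₂ δ) {m k : ℕ} {X R : Type}
    [Fintype X] [DecidableEq X] [Fintype R] [DecidableEq R] (P : Protocol C A B D m (k + 1) X)
    {𝒜 : SuperOp X (B × R)} (h𝒜 : IsChannel 𝒜) (j : Fin (k + 1))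
    (hfin : stateDiv (hybridRun Θ₁ P fun _ => Θ₁.enc) (hybridRun Θ₂ P fun _ => Θ₁.enc) ≠ ⊤) :
    stateDiv (decStep Θ₁.dec 𝒜 j (hybridRun Θ₁ P (j.insertNth Θ₁.enc fun _ => Θ₁.enc)))
        (decStep Θ₂.dec 𝒜 j (hybridRun Θ₂ P (j.insertNth Θ₂.enc fun _ => Θ₁.enc)))
      ≤ δ + stateDiv (hybridRun Θ₁ P fun _ => Θ₁.enc) (hybridRun Θ₂ P fun _ => Θ₁.enc) := by
  -- One reference R₀ serves both runs, so that N and M have the same type.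
  obtain ⟨R₀, _, _, h⟩ := hasCombs (S := S) P j
  obtain ⟨N, ω₁, hN, hω₁, h1⟩ := h Θ₁ hΘ₁ (fun _ => Θ₁.enc) fun _ => hΘ₁.1
  obtain ⟨M, ω₂, hM, hω₂, h2⟩ := h Θ₂ hΘ₂ (fun _ => Θ₁.enc) fun _ => hΘ₁.1
  have hr : ∀ {Y Z : Type} (e : Y ≃ Z) {x : Op Y} {y : Op Z}, relabel e x = y →
      x = relabel e.symm y := by
    rintro Y Z e x _ rfl
    exact (relabel_symm_apply_relabel e x).symm
  have hN' : IsChannel (relabel (Equiv.prodAssoc B R (Fin k → S)) ∘ₗ tensorId 𝒜 (Fin k → S) ∘ₗ N) :=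
    (isChannel_relabel _).comp ((h𝒜.tensorId _).comp hN)
  have hM' : IsChannel (relabel (Equiv.prodAssoc B R (Fin k → S)) ∘ₗ tensorId 𝒜 (Fin k → S) ∘ₗ M) :=
    (isChannel_relabel _).comp ((h𝒜.tensorId _).comp hM)
  have hs1 := hybridRun_isState hΘ₁ P (f := fun _ => Θ₁.enc) fun _ => hΘ₁.1
  have hs2 := hybridRun_isState hΘ₂ P (f := fun _ => Θ₁.enc) fun _ => hΘ₁.1
  have key := hδ _ _ _ _ ω₁ ω₂ hN' hM' hω₁ hω₂
  have e1 : Θ₁.applyEnc (relabel (Equiv.prodAssoc B R (Fin k → S)) ∘ₗ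
      tensorId 𝒜 (Fin k → S) ∘ₗ N) ω₁ = tensorId (relabel (Equiv.prodAssoc B R (Fin k → S)) ∘ₗ
      tensorId 𝒜 (Fin k → S)) S (relabel (splitMemory X S j) (hybridRun Θ₁ P fun _ => Θ₁.enc)) := by
    have := h1 Θ₁.enc
    beta_reduce at this
    rw [insertNth_const] at this
    rw [this]
    rfl
  have e2 : Θ₁.applyEnc (relabel (Equiv.prodAssoc B R (Fin k → S)) ∘ₗ
      tensorId 𝒜 (Fin k → S) ∘ₗ M) ω₂ = tensorId (relabel (Equiv.prodAssoc B R (Fin k → S)) ∘ₗ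
      tensorId 𝒜 (Fin k → S)) S (relabel (splitMemory X S j) (hybridRun Θ₂ P fun _ => Θ₁.enc)) := by
    have := h2 Θ₁.enc
    beta_reduce at this
    rw [insertNth_const] at this
    rw [this]
    rfl
  -- The subtracted term comes from the hybrid states by a channel, so data processing bounds it.
  have hle : stateDiv (Θ₁.applyEnc (relabel (Equiv.prodAssoc B R (Fin k → S)) ∘ₗ
      tensorId 𝒜 (Fin k → S) ∘ₗ N) ω₁) (Θ₁.applyEnc (relabel (Equiv.prodAssoc B R (Fin k → S)) ∘ₗ
      tensorId 𝒜 (Fin k → S) ∘ₗ M) ω₂)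
      ≤ stateDiv (hybridRun Θ₁ P fun _ => Θ₁.enc) (hybridRun Θ₂ P fun _ => Θ₁.enc) := by
    rw [e1, e2]
    refine (stateDiv_map_le (hs1.relabel _).1 (hs2.relabel _).1
      (((isChannel_relabel _).comp (h𝒜.tensorId _)).tensorId S)).trans ?_
    exact stateDiv_map_le hs1.1 hs2.1 (isChannel_relabel _)
  rw [hr _ (h1 Θ₁.enc), hr _ (h2 Θ₂.enc), decStep_eq_apply, decStep_eq_apply,
    stateDiv_relabel ((hΘ₁.apply hN').map_isState hω₁).1 ((hΘ₂.apply hM').map_isState hω₂).1]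
  exact (key (ne_top_of_le_ne_top hfin hle)).trans (add_le_add_right hle δ)

/-- The invariant: c counts the completed superchannels, each costing δ, while opening is free
because both hybrids use the encoder of Θ₁. -/
theorem stateDiv_hybridRun_le {Θ₁ Θ₂ : Superchannel C A B D S} (hΘ₁ : Θ₁.IsValid)
    (hΘ₂ : Θ₂.IsValid) {δ : EReal} (hδ : IsAmortizedBound Θ₁ Θ₂ δ) (h0 : 0 ≤ δ) {m k : ℕ}
    {X : Type} (P : Protocol C A B D m k X) :
    ∀ [hX : Fintype X] [DecidableEq X], ∃ c : ℕ, m = c + k ∧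
      stateDiv (hybridRun Θ₁ P fun _ => Θ₁.enc) (hybridRun Θ₂ P fun _ => Θ₁.enc) ≤ c * δ := by
  induction P with
  | @prepare X i₁ i₂ ρ hρ =>
    intro hX dX
    obtain rfl : hX = i₁ := Subsingleton.elim _ _
    obtain rfl : dX = i₂ := Subsingleton.elim _ _
    refine ⟨0, rfl, ?_⟩
    rw [Nat.cast_zero, zero_mul]
    exact (stateDiv_self (hρ.relabel _)).le
  | @useEnc m k X R i₁ i₂ i₃ i₄ i₅ i₆ P 𝒜 h𝒜 ih =>
    intro hX dX
    obtain rfl : hX = instFintypeProd A R := Subsingleton.elim _ _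
    obtain rfl : hC = i₅ := Subsingleton.elim _ _
    obtain rfl : dX = instDecidableEqProd := Subsingleton.elim _ _
    obtain rfl : dC = i₆ := Subsingleton.elim _ _
    obtain ⟨c, hc, h⟩ := ih
    refine ⟨c, by omega, le_trans ?_ h⟩
    exact stateDiv_map_le (hybridRun_isState hΘ₁ P (f := fun _ => Θ₁.enc) fun _ => hΘ₁.1).1
      (hybridRun_isState hΘ₂ P (f := fun _ => Θ₁.enc) fun _ => hΘ₁.1).1
      (isChannel_encStep hΘ₁.1 h𝒜 k)
  | @useDec m k X R i₁ i₂ i₃ i₄ i₅ i₆ P 𝒜 h𝒜 j ih =>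
    intro hX dX
    obtain rfl : hX = instFintypeProd D R := Subsingleton.elim _ _
    obtain rfl : hB = i₅ := Subsingleton.elim _ _
    obtain rfl : dX = instDecidableEqProd := Subsingleton.elim _ _
    obtain rfl : dB = i₆ := Subsingleton.elim _ _
    obtain ⟨c, hc, h⟩ := ih
    refine ⟨c + 1, by omega, ?_⟩
    exact le_succ_mul_of_amortized h0
      (stateDiv_hybridRun_useDec_le hΘ₁ hΘ₂ hδ P h𝒜 j) h

theorem stateDiv_output_le_of_common_memory {Θ₁ Θ₂ : Superchannel C A B D S} (hΘ₁ : Θ₁.IsValid)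
    (hΘ₂ : Θ₂.IsValid) {δ : EReal} (hδ : IsAmortizedBound Θ₁ Θ₂ δ) (h0 : 0 ≤ δ) {m : ℕ}
    {X : Type} [Fintype X] [DecidableEq X] (P : Protocol C A B D m 0 X) :
    stateDiv (P.output Θ₁) (P.output Θ₂) ≤ m * δ := by
  obtain ⟨c, hc, h⟩ := stateDiv_hybridRun_le hΘ₁ hΘ₂ hδ h0 P
  obtain rfl : m = c := by omega
  have hs1 := hybridRun_isState hΘ₁ P (f := fun _ => Θ₁.enc) fun _ => hΘ₁.1
  have hs2 := hybridRun_isState hΘ₂ P (f := fun _ => Θ₁.enc) fun _ => hΘ₁.1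
  -- With no open slot the choice of encoder is vacuous, so the second hybrid is the true run of Θ₂.
  have e : (fun _ : Fin 0 => Θ₁.enc) = fun _ => Θ₂.enc := Subsingleton.elim _ _
  rw [← stateDiv_relabel hs1.1 hs2.1 (Equiv.prodUnique X (Fin 0 → S)), hybridRun_const, e,
    hybridRun_const] at h
  exact h

theorem output_isState {Θ : Superchannel C A B D S} (hΘ : Θ.IsValid) {m : ℕ}
    {X : Type} [Fintype X] [DecidableEq X] (P : Protocol C A B D m 0 X) :
    IsState (P.output Θ) := by
  have hs := hybridRun_isState hΘ P (f := fun _ => Θ.enc) fun _ => hΘ.1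
  rw [hybridRun_const] at hs
  exact hs.relabel _

/-- A hybrid places the encoder of Θ₁ into a run of Θ₂, so the memories must agree. Both are padded
to S₁ × S₂, which changes neither output. -/
theorem stateDiv_output_le [Nonempty C] {S₁ S₂ : Type} [Fintype S₁] [DecidableEq S₁] [Fintype S₂]
    [DecidableEq S₂] {Θ₁ : Superchannel C A B D S₁} {Θ₂ : Superchannel C A B D S₂}
    (hΘ₁ : Θ₁.IsValid) (hΘ₂ : Θ₂.IsValid) {δ : EReal} (hδ : IsAmortizedBound Θ₁ Θ₂ δ)
    (h0 : 0 ≤ δ) {m : ℕ} {X : Type} [Fintype X] [DecidableEq X] (P : Protocol C A B D m 0 X) :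
    stateDiv (P.output Θ₁) (P.output Θ₂) ≤ m * δ := by
  obtain ⟨ρ, hρ⟩ := exists_isState C
  -- The encoder maps a state to a state, so its memory cannot be empty.
  have : Nonempty S₁ := (hΘ₁.1.map_isState hρ).nonempty.map Prod.snd
  have : Nonempty S₂ := (hΘ₂.1.map_isState hρ).nonempty.map Prod.snd
  obtain ⟨τ₁, hτ₁⟩ := exists_isState S₁
  obtain ⟨τ₂, hτ₂⟩ := exists_isState S₂
  have h := stateDiv_output_le_of_common_memory (hΘ₁.pad (Equiv.refl (S₁ × S₂)) hτ₂)
    (hΘ₂.pad (Equiv.prodComm S₁ S₂) hτ₁) (hδ.pad hΘ₁ _ _ hτ₂ hτ₁) h0 P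
  rwa [output_pad Θ₁ _ hτ₂, output_pad Θ₂ _ hτ₁] at h

end

end Protocol

/-! ### The seven bounds on the error exponents -/

section Exponents

variable {C A B D S₁ S₂ : Type} [Fintype C] [DecidableEq C] [Fintype A] [DecidableEq A]
  [Fintype B] [DecidableEq B] [Fintype D] [DecidableEq D] [Fintype S₁] [DecidableEq S₁]
  [Fintype S₂] [DecidableEq S₂] {Θ₁ : Superchannel C A B D S₁} {Θ₂ : Superchannel C A B D S₂}
  {p : ℝ} {n : ℕ}

theorem bestExponent_le_of_le {X : Type} [Fintype X] [DecidableEq X] {ρ σ : Op X}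
    (hρ : IsState ρ) (hσ : IsState σ) (hp : 0 < p) (hp' : p < 1) {c : EReal}
    (h : ((1 / (n : ℝ) : ℝ) : EReal) * stateDiv ρ σ ≤ c) :
    bestExponent n p ρ σ ≤ ((-(1 / (n : ℝ)) * Real.logb 2 (p * (1 - p)) : ℝ) : EReal) + c :=
  (bestExponent_le hρ hσ hp hp' n).trans (add_le_add_right h _)

theorem one_div_mul_le_one_div_mul {d d' : EReal} (h : d ≤ d') :
    ((1 / (n : ℝ) : ℝ) : EReal) * d ≤ ((1 / (n : ℝ) : ℝ) : EReal) * d' :=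
  mul_le_mul_of_nonneg_left h (EReal.coe_nonneg.2 (by positivity))

theorem xiProduct_le (hΘ₁ : Θ₁.IsValid) (hΘ₂ : Θ₂.IsValid) (hp : 0 < p) (hp' : p < 1)
    (hn : 1 ≤ n) : xiProduct n p Θ₁ Θ₂
      ≤ ((-(1 / (n : ℝ)) * Real.logb 2 (p * (1 - p)) : ℝ) : EReal) + superDiv Θ₁ Θ₂ := by
  refine iSup_le fun R => iSup_le fun _ => iSup_le fun _ => iSup_le fun R' => iSup_le fun _ =>
    iSup_le fun _ => iSup_le fun N => iSup_le fun hN => iSup_le fun ρ => iSup_le fun hρ => ?_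
  have h1 := (hΘ₁.apply hN).map_isState hρ
  have h2 := (hΘ₂.apply hN).map_isState hρ
  refine bestExponent_le_of_le (h1.opPow n) (h2.opPow n) hp hp' (one_div_mul_le_of_le_mul hn ?_)
  rw [stateDiv_opPow h1 h2]
  exact mul_le_mul_of_nonneg_left (le_superDiv Θ₁ Θ₂ hN hρ) (by positivity)

theorem xiParallelProductChannel_le (hΘ₁ : Θ₁.IsValid) (hΘ₂ : Θ₂.IsValid) (hp : 0 < p)
    (hp' : p < 1) (hn : 1 ≤ n) : xiParallelProductChannel n p Θ₁ Θ₂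
      ≤ ((-(1 / (n : ℝ)) * Real.logb 2 (p * (1 - p)) : ℝ) : EReal) + superDivStateReg Θ₁ Θ₂ := by
  refine iSup_le fun R => iSup_le fun _ => iSup_le fun _ => iSup_le fun R' => iSup_le fun _ =>
    iSup_le fun _ => iSup_le fun E => iSup_le fun _ => iSup_le fun _ => iSup_le fun N =>
    iSup_le fun hN => iSup_le fun ρ => iSup_le fun hρ => ?_
  refine bestExponent_le_of_le ((((hΘ₁.apply hN).tensorPow n).tensorId E).map_isState hρ)
    ((((hΘ₂.apply hN).tensorPow n).tensorId E).map_isState hρ) hp hp' ?_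
  exact (one_div_mul_le_one_div_mul (le_productChannelDiv Θ₁ Θ₂ n hN hρ)).trans
    (le_liminf_of_le_div (productChannelDiv_le_div hΘ₁ hΘ₂) hn)

theorem xiParallelProductState_le [Nonempty B] (hΘ₁ : Θ₁.IsValid) (hΘ₂ : Θ₂.IsValid) (hp : 0 < p)
    (hp' : p < 1) (hn : 1 ≤ n) : xiParallelProductState n p Θ₁ Θ₂
      ≤ ((-(1 / (n : ℝ)) * Real.logb 2 (p * (1 - p)) : ℝ) : EReal) + superDivChanReg Θ₁ Θ₂ := by
  refine iSup_le fun R => iSup_le fun _ => iSup_le fun _ => iSup_le fun R' => iSup_le fun _ =>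
    iSup_le fun _ => iSup_le fun N => iSup_le fun hN => iSup_le fun ρ => iSup_le fun hρ => ?_
  refine bestExponent_le_of_le (productStateOutput_isState hΘ₁ n hN hρ)
    (productStateOutput_isState hΘ₂ n hN hρ) hp hp' ?_
  exact (one_div_mul_le_one_div_mul (le_productStateDiv Θ₁ Θ₂ n hN hρ)).trans
    (le_liminf_of_le_div (fun n k r _ => productStateDiv_le_div hΘ₁ hΘ₂ n k r) hn)

theorem xiParallel_le [Nonempty B] [Nonempty C] (hΘ₁ : Θ₁.IsValid) (hΘ₂ : Θ₂.IsValid)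
    (hp : 0 < p) (hp' : p < 1) (hn : 1 ≤ n) : xiParallel n p Θ₁ Θ₂
      ≤ ((-(1 / (n : ℝ)) * Real.logb 2 (p * (1 - p)) : ℝ) : EReal) + superDivReg Θ₁ Θ₂ := by
  refine iSup_le fun R => iSup_le fun _ => iSup_le fun _ => iSup_le fun R' => iSup_le fun _ =>
    iSup_le fun _ => iSup_le fun N => iSup_le fun hN => iSup_le fun ρ => iSup_le fun hρ => ?_
  refine bestExponent_le_of_le (((hΘ₁.pow n).apply hN).map_isState hρ)
    (((hΘ₂.pow n).apply hN).map_isState hρ) hp hp' ?_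
  exact (one_div_mul_le_one_div_mul (le_superDiv _ _ hN hρ)).trans
    (le_liminf_of_le_div (a := fun n => superDiv (Θ₁.pow n) (Θ₂.pow n))
      (fun n k r _ => superDiv_pow_le_div hΘ₁ hΘ₂ n k r) hn)

theorem xiSuccessive_le (hΘ₁ : Θ₁.IsValid) (hΘ₂ : Θ₂.IsValid) (hp : 0 < p) (hp' : p < 1)
    (hn : 1 ≤ n) : xiSuccessive n p Θ₁ Θ₂
      ≤ ((-(1 / (n : ℝ)) * Real.logb 2 (p * (1 - p)) : ℝ) : EReal) + superDivStateA Θ₁ Θ₂ := by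
  refine iSup_le fun R => iSup_le fun _ => iSup_le fun _ => iSup_le fun R' => iSup_le fun _ =>
    iSup_le fun _ => iSup_le fun M => iSup_le fun _ => iSup_le fun _ => iSup_le fun N =>
    iSup_le fun hN => iSup_le fun ρ => iSup_le fun hρ => iSup_le fun 𝒜 => iSup_le fun h𝒜 => ?_
  have h1 := hΘ₁.apply hN
  have h2 := hΘ₂.apply hN
  refine bestExponent_le_of_le (seqOutput_isState h1 hρ h𝒜 _) (seqOutput_isState h2 hρ h𝒜 _) hp hp'
    (one_div_mul_le_of_le_mul hn ?_)
  -- Index n - 1 is the operator after n uses, so the factor (n - 1) + 1 is n.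
  have h := stateDiv_seqOutput_le h1 h2 hρ h𝒜 (n - 1)
  rw [Nat.sub_add_cancel hn] at h
  refine h.trans (mul_le_mul_of_nonneg_left ?_ (by positivity))
  exact le_iSup_of_le R <| le_iSup_of_le inferInstance <| le_iSup_of_le inferInstance <|
    le_iSup_of_le R' <| le_iSup_of_le inferInstance <| le_iSup_of_le inferInstance <|
    le_iSup_of_le N <| le_iSup_of_le hN le_rfl

theorem xiNested_le [Nonempty C] [Nonempty A] [Nonempty B] (hΘ₁ : Θ₁.IsValid) (hΘ₂ : Θ₂.IsValid)
    (hp : 0 < p) (hp' : p < 1) (hn : 1 ≤ n) : xiNested n p Θ₁ Θ₂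
      ≤ ((-(1 / (n : ℝ)) * Real.logb 2 (p * (1 - p)) : ℝ) : EReal) + superDivA Θ₁ Θ₂ := by
  refine iSup_le fun R => iSup_le fun _ => iSup_le fun _ => iSup_le fun ρ => iSup_le fun hρ =>
    iSup_le fun mid => iSup_le fun hmid => iSup_le fun pre => iSup_le fun hpre =>
    iSup_le fun post => iSup_le fun hpost => ?_
  have : Nonempty R := hρ.nonempty.map Prod.snd
  have h1 := hΘ₁.nested hmid hpre hpost (n - 1)
  have h2 := hΘ₂.nested hmid hpre hpost (n - 1)
  refine bestExponent_le_of_le (h1.map_isState hρ) (h2.map_isState hρ) hp hp'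
    (one_div_mul_le_of_le_mul hn ((stateDiv_map_le_chanDivA h1 h2 hρ).trans ?_))
  have h := chanDivA_nested_le hΘ₁ hΘ₂ hmid hpre hpost (n - 1)
  rwa [Nat.sub_add_cancel hn] at h

theorem xiGeneral_le [Nonempty C] [Nonempty A] [Nonempty B] (hΘ₁ : Θ₁.IsValid) (hΘ₂ : Θ₂.IsValid)
    (hp : 0 < p) (hp' : p < 1) (hn : 1 ≤ n) : xiGeneral n p Θ₁ Θ₂
      ≤ ((-(1 / (n : ℝ)) * Real.logb 2 (p * (1 - p)) : ℝ) : EReal) + superDivAStar Θ₁ Θ₂ := by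
  refine iSup_le fun X => iSup_le fun _ => iSup_le fun _ => iSup_le fun P => ?_
  have hδ := isAmortizedBound_superDivAStar hΘ₁ hΘ₂
  exact bestExponent_le_of_le (Protocol.output_isState hΘ₁ P) (Protocol.output_isState hΘ₂ P) hp hp'
    (one_div_mul_le_of_le_mul hn
      (Protocol.stateDiv_output_le hΘ₁ hΘ₂ hδ (hδ.nonneg hΘ₁ hΘ₂) P))

end Exponents
end QND

theorem mainTheorem7 {C A B D S₁ S₂ : Type}
    [Fintype C] [DecidableEq C] [Nonempty C] [Fintype A] [DecidableEq A] [Nonempty A]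
    [Fintype B] [DecidableEq B] [Nonempty B] [Fintype D] [DecidableEq D] [Nonempty D]
    [Fintype S₁] [DecidableEq S₁] [Fintype S₂] [DecidableEq S₂]
    (Θ₁ : Superchannel C A B D S₁) (Θ₂ : Superchannel C A B D S₂)
    (hΘ₁ : Θ₁.IsValid) (hΘ₂ : Θ₂.IsValid) :
    (Filter.Tendsto (superDivStateSeq Θ₁ Θ₂) Filter.atTop (nhds (superDivStateReg Θ₁ Θ₂)) ∧
      Filter.Tendsto (superDivChanSeq Θ₁ Θ₂) Filter.atTop (nhds (superDivChanReg Θ₁ Θ₂)) ∧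
      Filter.Tendsto (superDivSeq Θ₁ Θ₂) Filter.atTop (nhds (superDivReg Θ₁ Θ₂))) ∧
    ∀ (p : ℝ), 0 < p → p < 1 → ∀ n : ℕ, 1 ≤ n →
      xiProduct n p Θ₁ Θ₂ ≤
        ((-(1 / (n : ℝ)) * Real.logb 2 (p * (1 - p)) : ℝ) : EReal) + superDiv Θ₁ Θ₂ ∧
      xiParallelProductChannel n p Θ₁ Θ₂ ≤
        ((-(1 / (n : ℝ)) * Real.logb 2 (p * (1 - p)) : ℝ) : EReal) + superDivStateReg Θ₁ Θ₂ ∧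
      xiParallelProductState n p Θ₁ Θ₂ ≤
        ((-(1 / (n : ℝ)) * Real.logb 2 (p * (1 - p)) : ℝ) : EReal) + superDivChanReg Θ₁ Θ₂ ∧
      xiParallel n p Θ₁ Θ₂ ≤
        ((-(1 / (n : ℝ)) * Real.logb 2 (p * (1 - p)) : ℝ) : EReal) + superDivReg Θ₁ Θ₂ ∧
      xiSuccessive n p Θ₁ Θ₂ ≤
        ((-(1 / (n : ℝ)) * Real.logb 2 (p * (1 - p)) : ℝ) : EReal) + superDivStateA Θ₁ Θ₂ ∧
      xiNested n p Θ₁ Θ₂ ≤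
        ((-(1 / (n : ℝ)) * Real.logb 2 (p * (1 - p)) : ℝ) : EReal) + superDivA Θ₁ Θ₂ ∧
      xiGeneral n p Θ₁ Θ₂ ≤
        ((-(1 / (n : ℝ)) * Real.logb 2 (p * (1 - p)) : ℝ) : EReal) + superDivAStar Θ₁ Θ₂ := by
  refine ⟨⟨?_, ?_, ?_⟩, fun p hp hp' n hn => ⟨?_, ?_, ?_, ?_, ?_, ?_, ?_⟩⟩
  · exact tendsto_liminf_of_le_div (productChannelDiv_le_div hΘ₁ hΘ₂)
  · exact tendsto_liminf_of_le_div fun n k r _ => productStateDiv_le_div hΘ₁ hΘ₂ n k r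
  · exact tendsto_liminf_of_le_div (a := fun n => superDiv (Θ₁.pow n) (Θ₂.pow n))
      fun n k r _ => superDiv_pow_le_div hΘ₁ hΘ₂ n k r
  · exact xiProduct_le hΘ₁ hΘ₂ hp hp' hn
  · exact xiParallelProductChannel_le hΘ₁ hΘ₂ hp hp' hn
  · exact xiParallelProductState_le hΘ₁ hΘ₂ hp hp' hn
  · exact xiParallel_le hΘ₁ hΘ₂ hp hp' hn
  · exact xiSuccessive_le hΘ₁ hΘ₂ hp hp' hn
  · exact xiNested_le hΘ₁ hΘ₂ hp hp' hn
  · exact xiGeneral_le hΘ₁ hΘ₂ hp hp' hn
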